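/- A \emph{lattice polygon} is the convex hull in $\mathbb{R}^2$ of finitely many (at least one) points of $\mathbb{Z}^2$. For a bounded set $A\subset\mathbb{R}^2$ write $|A|_{\mathbb{Z}}=|A\cap\mathbb{Z}^2|$, and let $V$ denote Euclidean area. For $A,B\subseteq\mathbb{R}^2$ let $A-B=\{u\in\mathbb{R}^2 : u+B\subseteq A\}$. Call two subsets of $\mathbb{R}^2$ \emph{equivalent} if one is the image of the other under a map $x\mapsto Ux+t$ with $U\in\operatorname{GL}(2,\mathbb{Z})$ and $t\in\mathbb{Z}^2$. Let $Q$ be a lattice polygon that is not a single point, and let $m_1,m_2,a$ be positive integers. Put $P_1=m_1Q$, $P_2=m_2Q$, $A=aQ$. Suppose that $$a<m_2,\qquad 2a<m_1+m_2,\qquad |aQ|_{\mathbb{Z}}-|(a-m_1)Q|_{\mathbb{Z}}=m_1m_2V(Q),$$ where $(a-m_1)Q$ stands for $A-P_1=aQ-m_1Q$, i.e. for the dilate of $Q$ by the factor $a-m_1$ if $a\ge m_1$, and for the empty set if $a<m_1$. Then one of the following three cases holds. (1) $Q$ is equivalent to the standard simplex with vertices $0,e_1,e_2$, and $a=(m_1+m_2-3)/2$.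 (2) $Q$ is equivalent to the triangle with vertices $0,2e_1,e_2$ or to the unit square $[0,1]^2$, and $a=(m_1+m_2-2)/2$. (3) $Q$ is a Fano polygon, i.e. it has exactly one interior lattice point, it is equivalent to one of the following sixteen Fano polygons, given by their vertices, and $a=(m_1+m_2-1)/2$: 1. $(1,0),(0,1),(-1,-1)$; 2. $(1,0),(0,1),(-1,0),(0,-1)$; 3. $(1,0),(0,1),(-1,1),(0,-1)$; 4. $(0,1),(1,-1),(-1,-1)$; 5. $(1,0),(1,1),(0,1),(-1,0),(0,-1)$; 6. $(0,1),(1,0),(1,-1),(-1,-1)$; 7. $(1,0),(1,1),(0,1),(-1,0),(-1,-1),(0,-1)$; 8. $(1,0),(0,1),(-1,0),(-1,-1),(1,-1)$; 9. $(0,1),(-1,1),(-1,-1),(1,-1)$; 10. $(-1,1),(-1,-1),(2,-1)$; 11. $(1,0),(0,1),(-1,1),(-1,-1),(1,-1)$; 12. $(1,0),(-1,1),(-1,-1),(2,-1)$; 13. $(0,1),(-1,1),(-1,-1),(2,-1)$; 14. $(1,1),(-1,1),(-1,-1),(1,-1)$; 15. $(-1,1),(-1,-1),(3,-1)$; 16.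 $(-1,2),(-1,-1),(2,-1)$. -/

import Mathlib

open scoped Pointwise

/-- The real point of the plane with the given integer coordinates. -/
def latticePoint (z : Fin 2 → ℤ) : Fin 2 → ℝ := fun i => (z i : ℝ)

/-- The convex hull in the plane of a set of lattice points. -/
def latticeHull (S : Set (Fin 2 → ℤ)) : Set (Fin 2 → ℝ) :=
  convexHull ℝ (latticePoint '' S)

/-- A lattice polygon: the convex hull of finitely many (and at least one) lattice points.
Points and segments are allowed. -/
def IsLatticePolygon (Q : Set (Fin 2 → ℝ)) : Prop :=
  ∃ S : Set (Fin 2 → ℤ), S.Finite ∧ S.Nonempty ∧ Q = latticeHull S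

/-- The number of lattice points in a (bounded) subset of the plane. -/
noncomputable def latticeCount (A : Set (Fin 2 → ℝ)) : ℕ :=
  {z : Fin 2 → ℤ | latticePoint z ∈ A}.ncard

/-- The Minkowski difference `A - B`: all translation vectors `u` with `u + B ⊆ A`. -/
def minkowskiDiff (A B : Set (Fin 2 → ℝ)) : Set (Fin 2 → ℝ) :=
  {u | ∀ b ∈ B, u + b ∈ A}

/-- Equivalence under `GL(2, ℤ)` and lattice translations: one set is the image of the other
under a map `x ↦ U x + t` with `U ∈ GL(2, ℤ)` and `t ∈ ℤ²`. -/
def LatticeEquivalent (Q R : Set (Fin 2 → ℝ)) : Prop :=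
  ∃ (U : Matrix.GeneralLinearGroup (Fin 2) ℤ) (t : Fin 2 → ℤ),
    Q = (fun x : Fin 2 → ℝ =>
      ((U : Matrix (Fin 2) (Fin 2) ℤ).map (fun n : ℤ => (n : ℝ))).mulVec x + latticePoint t) '' R

/-- The standard 2-simplex. -/
def standardSimplex : Set (Fin 2 → ℝ) := latticeHull {![0, 0], ![1, 0], ![0, 1]}

/-- The triangle with vertices `0`, `2 e₁`, `e₂`. -/
def doubleTriangle : Set (Fin 2 → ℝ) := latticeHull {![0, 0], ![2, 0], ![0, 1]}

/-- The unit square `[0, 1] × [0, 1]`. -/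
def standardSquare : Set (Fin 2 → ℝ) := latticeHull {![0, 0], ![1, 0], ![0, 1], ![1, 1]}

/-- A Fano polygon: a lattice polygon with exactly one interior lattice point. -/
def IsFanoPolygon (Q : Set (Fin 2 → ℝ)) : Prop :=
  IsLatticePolygon Q ∧ latticeCount (interior Q) = 1

/-- The vertices of representatives of the sixteen classes of Fano polygons. The origin is the
interior lattice point; the numbers of boundary lattice points are
3, 4, 4, 4, 5, 5, 6, 6, 6, 6, 7, 7, 8, 8, 8, 9. -/
def fanoVertices : Fin 16 → Set (Fin 2 → ℤ) :=
  ![{![1, 0], ![0, 1], ![-1, -1]},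
    {![1, 0], ![0, 1], ![-1, 0], ![0, -1]},
    {![1, 0], ![0, 1], ![-1, 1], ![0, -1]},
    {![0, 1], ![1, -1], ![-1, -1]},
    {![1, 0], ![1, 1], ![0, 1], ![-1, 0], ![0, -1]},
    {![0, 1], ![1, 0], ![1, -1], ![-1, -1]},
    {![1, 0], ![1, 1], ![0, 1], ![-1, 0], ![-1, -1], ![0, -1]},
    {![1, 0], ![0, 1], ![-1, 0], ![-1, -1], ![1, -1]},
    {![0, 1], ![-1, 1], ![-1, -1], ![1, -1]},
    {![-1, 1], ![-1, -1], ![2, -1]},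
    {![1, 0], ![0, 1], ![-1, 1], ![-1, -1], ![1, -1]},
    {![1, 0], ![-1, 1], ![-1, -1], ![2, -1]},
    {![0, 1], ![-1, 1], ![-1, -1], ![2, -1]},
    {![1, 1], ![-1, 1], ![-1, -1], ![1, -1]},
    {![-1, 1], ![-1, -1], ![3, -1]},
    {![-1, 2], ![-1, -1], ![2, -1]}]

/-- The sixteen representative Fano polygons. -/
def fanoPolygon (i : Fin 16) : Set (Fin 2 → ℝ) := latticeHull (fanoVertices i)

theorem IsLatticePolygon.convex {Q : Set (Fin 2 → ℝ)} (hQ : IsLatticePolygon Q) :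
    Convex ℝ Q := by
  obtain ⟨S, -, -, rfl⟩ := hQ
  exact convex_convexHull ℝ _

theorem IsLatticePolygon.isCompact {Q : Set (Fin 2 → ℝ)} (hQ : IsLatticePolygon Q) :
    IsCompact Q := by
  obtain ⟨S, hS, -, rfl⟩ := hQ
  exact (hS.image _).isCompact_convexHull (𝕜 := ℝ)

theorem IsLatticePolygon.nonempty {Q : Set (Fin 2 → ℝ)} (hQ : IsLatticePolygon Q) :
    Q.Nonempty := by
  obtain ⟨S, -, hS, rfl⟩ := hQ
  exact (hS.image _).convexHull

/-- For `m ≤ a` the Minkowski difference of the dilates `a Q` and `m Q` is `(a - m) Q`. -/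
theorem minkowskiDiff_smul_of_le {Q : Set (Fin 2 → ℝ)} (hQ : IsLatticePolygon Q) {a m : ℕ}
    (h : m ≤ a) :
    minkowskiDiff ((a : ℝ) • Q) ((m : ℝ) • Q) = ((a : ℝ) - (m : ℝ)) • Q := by
  have hle : (m : ℝ) ≤ a := by exact_mod_cast h
  have hm : (0 : ℝ) ≤ m := Nat.cast_nonneg m
  apply Set.Subset.antisymm
  · intro u hu
    by_contra hnot
    obtain ⟨f, s, h1, h2⟩ := geometric_hahn_banach_closed_point
      (hQ.convex.smul ((a : ℝ) - m)) (hQ.isCompact.smul ((a : ℝ) - m)).isClosed hnot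
    obtain ⟨x, hx, hmax⟩ := hQ.isCompact.exists_isMaxOn hQ.nonempty f.continuous.continuousOn
    obtain ⟨y, hy, hyu⟩ := hu _ (Set.smul_mem_smul_set hx)
    have e1 := congrArg f hyu
    simp only [map_smul, map_add, smul_eq_mul] at e1
    have e2 := h1 _ (Set.smul_mem_smul_set hx)
    simp only [map_smul, smul_eq_mul] at e2
    have e3 : f y ≤ f x := hmax hy
    nlinarith [mul_le_mul_of_nonneg_left e3 (hm.trans hle)]
  · rintro _ ⟨x, hx, rfl⟩ _ ⟨y, hy, rfl⟩
    have key := hQ.convex.add_smul (sub_nonneg.2 hle) hm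
    rw [sub_add_cancel] at key
    rw [key]
    exact Set.add_mem_add (Set.smul_mem_smul_set hx) (Set.smul_mem_smul_set hy)

/-- For `a < m` the dilate `a Q` contains no translate of `m Q`, unless `Q` is a point. -/
theorem minkowskiDiff_smul_of_lt {Q : Set (Fin 2 → ℝ)} (hQ : IsLatticePolygon Q)
    (hpt : Q.Nontrivial) {a m : ℕ} (h : a < m) :
    minkowskiDiff ((a : ℝ) • Q) ((m : ℝ) • Q) = ∅ := by
  have hlt : (a : ℝ) < m := by exact_mod_cast h
  have ha : (0 : ℝ) ≤ a := Nat.cast_nonneg a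
  rw [Set.eq_empty_iff_forall_notMem]
  intro u hu
  obtain ⟨p, hp, q, hq, hpq⟩ := hpt
  obtain ⟨f, hf⟩ := geometric_hahn_banach_point_point (E := Fin 2 → ℝ) hpq
  obtain ⟨x, hx, hmax⟩ := hQ.isCompact.exists_isMaxOn hQ.nonempty f.continuous.continuousOn
  obtain ⟨w, hw, hmin⟩ := hQ.isCompact.exists_isMinOn hQ.nonempty f.continuous.continuousOn
  obtain ⟨y, hy, hyu⟩ := hu _ (Set.smul_mem_smul_set hx)
  obtain ⟨z, hz, hzu⟩ := hu _ (Set.smul_mem_smul_set hw)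
  have e1 := congrArg f hyu
  have e2 := congrArg f hzu
  simp only [map_smul, map_add, smul_eq_mul] at e1 e2
  have e3 : f y ≤ f x := hmax hy
  have e4 : f w ≤ f z := hmin hz
  have e5 : f w ≤ f p := hmin hp
  have e6 : f q ≤ f x := hmax hq
  have e7 : f w < f x := by linarith
  nlinarith [mul_le_mul_of_nonneg_left e3 ha, mul_le_mul_of_nonneg_left e4 ha,
    mul_pos (sub_pos.2 hlt) (sub_pos.2 e7)]

/-! Let N and I be the numbers of lattice points of Q and of its interior. If V(Q) were 0, the
hypothesis would equate the counts of A - P₁ and A, but the first is always smaller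
(`latticeCount_minkowskiDiff_lt`); so Q has interior points. The Ehrhart formula 2|kQ| = 2V k² + (N
- I)k + 2, whose case k = 1 is Pick's theorem 2V = N + I - 2, then turns the hypothesis into an
equation between integers.

If a ≥ m₁, the equation is N - I = (N + I - 2)d with d = m₁ + m₂ - 2a ≥ 1. Hence I ≤ 1, and the
solutions with N ≥ 3 are I = 0, N = 3, d = 3; I = 0, N = 4, d = 2; and I = 1, d = 1
(`counts_of_le`). If a < m₁, both m₁ and m₂ exceed a, and the bound m₁m₂ ≥ (a + 1)² leaves only the
two solutions with I = 0 (`counts_of_lt`).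

The Ehrhart formula is counted row by row for parallelograms, halved for triangles, and extended to
all polygons by cutting along a diagonal and induction on the number of vertices
(`ehrhartFormula_of_interior_nonempty`).

To identify Q, it is moved so that it contains 0, e₁, e₂. With three lattice points nothing else is
left. With four and none interior, the barycentric coordinates of the last point decide. For I = 1,
with the interior point at the origin, no nonzero lattice point may lie strictly inside
(`IsOriginPolygon.le_one`). Polygons in the strip |y| ≤ 1 are covered by a finite table. Two lattice
points of Q that are congruent modulo 2 and neither equal nor opposite give an edge with three
lattice points, which leads back to a strip or to the sixteenth polygon. If there are no such
points, a parity argument shows that Q lies in a horizontal or vertical strip anyway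
(`IsOriginPolygon.isStandardFano_of_basis`). -/

/-! ### Unimodular affine maps -/

/-- The affine map `x ↦ U x + t` of the plane. -/
def latticeMap (U : Matrix.GeneralLinearGroup (Fin 2) ℤ) (t : Fin 2 → ℤ) (x : Fin 2 → ℝ) :
    Fin 2 → ℝ :=
  ((U : Matrix (Fin 2) (Fin 2) ℤ).map (fun n : ℤ => (n : ℝ))).mulVec x + latticePoint t

theorem latticePoint_add (z w : Fin 2 → ℤ) :
    latticePoint (z + w) = latticePoint z + latticePoint w := by
  ext i; simp [latticePoint]

theorem latticePoint_zero : latticePoint 0 = 0 := by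
  ext i; simp [latticePoint]

theorem latticePoint_injective : Function.Injective latticePoint := by
  intro z w h
  ext i
  have := congrFun h i
  simpa [latticePoint] using this

theorem latticePoint_natCast_smul (k : ℕ) (z : Fin 2 → ℤ) :
    latticePoint (k • z) = (k : ℝ) • latticePoint z := by
  ext i; simp [latticePoint]

theorem latticeMap_apply (U : Matrix.GeneralLinearGroup (Fin 2) ℤ) (t : Fin 2 → ℤ)
    (x : Fin 2 → ℝ) (i : Fin 2) :
    latticeMap U t x i = ((U i 0 : ℤ) : ℝ) * x 0 + ((U i 1 : ℤ) : ℝ) * x 1 + t i := by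
  fin_cases i <;> simp [latticeMap, latticePoint]

theorem latticeMap_comp (U W : Matrix.GeneralLinearGroup (Fin 2) ℤ) (t s : Fin 2 → ℤ)
    (x : Fin 2 → ℝ) : latticeMap U t (latticeMap W s x) =
      latticeMap (U * W) ((U : Matrix (Fin 2) (Fin 2) ℤ).mulVec s + t) x := by
  ext i
  simp only [latticeMap_apply, Matrix.GeneralLinearGroup.coe_mul, Matrix.mul_apply,
    Fin.sum_univ_two, Pi.add_apply, Matrix.mulVec, dotProduct]
  push_cast
  ring

theorem latticeMap_one_zero (x : Fin 2 → ℝ) : latticeMap 1 0 x = x := by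
  ext i
  fin_cases i <;> simp [latticeMap_apply]

theorem latticeMap_latticePoint (U : Matrix.GeneralLinearGroup (Fin 2) ℤ) (t z : Fin 2 → ℤ) :
    latticeMap U t (latticePoint z) =
      latticePoint ((U : Matrix (Fin 2) (Fin 2) ℤ).mulVec z + t) := by
  ext i
  fin_cases i <;> simp [latticeMap_apply, latticePoint]

/-- The translation part of the inverse of `latticeMap U t`. -/
def latticeInvShift (U : Matrix.GeneralLinearGroup (Fin 2) ℤ) (t : Fin 2 → ℤ) : Fin 2 → ℤ :=
  -((U⁻¹ : Matrix.GeneralLinearGroup (Fin 2) ℤ) : Matrix (Fin 2) (Fin 2) ℤ).mulVec t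

theorem latticeMap_inv_left (U : Matrix.GeneralLinearGroup (Fin 2) ℤ) (t : Fin 2 → ℤ)
    (x : Fin 2 → ℝ) : latticeMap U⁻¹ (latticeInvShift U t) (latticeMap U t x) = x := by
  rw [latticeMap_comp, inv_mul_cancel, latticeInvShift, add_neg_cancel, latticeMap_one_zero]

theorem latticeMap_inv_right (U : Matrix.GeneralLinearGroup (Fin 2) ℤ) (t : Fin 2 → ℤ)
    (x : Fin 2 → ℝ) : latticeMap U t (latticeMap U⁻¹ (latticeInvShift U t) x) = x := by
  rw [latticeMap_comp, mul_inv_cancel, latticeInvShift, Matrix.mulVec_neg, Matrix.mulVec_mulVec,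
    ← Matrix.GeneralLinearGroup.coe_mul, mul_inv_cancel, Matrix.GeneralLinearGroup.coe_one,
    Matrix.one_mulVec, neg_add_cancel, latticeMap_one_zero]

theorem continuous_latticeMap (U : Matrix.GeneralLinearGroup (Fin 2) ℤ) (t : Fin 2 → ℤ) :
    Continuous (latticeMap U t) := by
  refine continuous_pi fun i => ?_
  simp only [latticeMap_apply]
  fun_prop

/-- `latticeMap U t` as a homeomorphism of the plane. -/
def latticeHomeo (U : Matrix.GeneralLinearGroup (Fin 2) ℤ) (t : Fin 2 → ℤ) :
    (Fin 2 → ℝ) ≃ₜ (Fin 2 → ℝ) where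
  toFun := latticeMap U t
  invFun := latticeMap U⁻¹ (latticeInvShift U t)
  left_inv := latticeMap_inv_left U t
  right_inv := latticeMap_inv_right U t
  continuous_toFun := continuous_latticeMap _ _
  continuous_invFun := continuous_latticeMap _ _

theorem latticeMap_injective (U : Matrix.GeneralLinearGroup (Fin 2) ℤ) (t : Fin 2 → ℤ) :
    Function.Injective (latticeMap U t) :=
  (latticeHomeo U t).injective

theorem interior_latticeMap_image (U : Matrix.GeneralLinearGroup (Fin 2) ℤ) (t : Fin 2 → ℤ)
    (A : Set (Fin 2 → ℝ)) : interior (latticeMap U t '' A) = latticeMap U t '' interior A :=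
  ((latticeHomeo U t).image_interior A).symm

theorem latticeMap_image_convexHull (U : Matrix.GeneralLinearGroup (Fin 2) ℤ) (t : Fin 2 → ℤ)
    (A : Set (Fin 2 → ℝ)) :
    latticeMap U t '' convexHull ℝ A = convexHull ℝ (latticeMap U t '' A) :=
  ((Matrix.toLin' ((U : Matrix (Fin 2) (Fin 2) ℤ).map (fun n : ℤ => (n : ℝ)))).toAffineMap +
    AffineMap.const ℝ (Fin 2 → ℝ) (latticePoint t)).image_convexHull A

theorem latticeMap_image_latticeHull (U : Matrix.GeneralLinearGroup (Fin 2) ℤ) (t : Fin 2 → ℤ)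
    (S : Set (Fin 2 → ℤ)) : latticeMap U t '' latticeHull S =
      latticeHull ((fun z => (U : Matrix (Fin 2) (Fin 2) ℤ).mulVec z + t) '' S) := by
  rw [latticeHull, latticeMap_image_convexHull, latticeHull, Set.image_image, Set.image_image]
  simp_rw [latticeMap_latticePoint]

theorem IsLatticePolygon.latticeMap_image {Q : Set (Fin 2 → ℝ)} (hQ : IsLatticePolygon Q)
    (U : Matrix.GeneralLinearGroup (Fin 2) ℤ) (t : Fin 2 → ℤ) :
    IsLatticePolygon (latticeMap U t '' Q) := by
  obtain ⟨S, hS, hS', rfl⟩ := hQ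
  exact ⟨_, hS.image _, hS'.image _, latticeMap_image_latticeHull U t S⟩

theorem latticeCount_latticeMap_image (U : Matrix.GeneralLinearGroup (Fin 2) ℤ) (t : Fin 2 → ℤ)
    (A : Set (Fin 2 → ℝ)) : latticeCount (latticeMap U t '' A) = latticeCount A := by
  unfold latticeCount
  symm
  refine Set.ncard_congr
    (fun z _ => (U : Matrix (Fin 2) (Fin 2) ℤ).mulVec z + t) ?_ ?_ ?_
  · intro z hz
    exact ⟨latticePoint z, hz, latticeMap_latticePoint U t z⟩
  · intro z w _ _ h
    apply latticePoint_injective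
    apply latticeMap_injective U t
    rw [latticeMap_latticePoint, latticeMap_latticePoint, h]
  · rintro w ⟨x, hx, hxw⟩
    refine ⟨((U⁻¹ : Matrix.GeneralLinearGroup (Fin 2) ℤ) : Matrix (Fin 2) (Fin 2) ℤ).mulVec w +
      latticeInvShift U t, ?_, ?_⟩
    · change latticePoint _ ∈ A
      rwa [← latticeMap_latticePoint, ← hxw, latticeMap_inv_left]
    · apply latticePoint_injective
      rw [← latticeMap_latticePoint, ← latticeMap_latticePoint, latticeMap_inv_right]

theorem abs_det_generalLinear (U : Matrix.GeneralLinearGroup (Fin 2) ℤ) :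
    |((U : Matrix (Fin 2) (Fin 2) ℤ).map (fun n : ℤ => (n : ℝ))).det| = 1 := by
  have h : IsUnit (U : Matrix (Fin 2) (Fin 2) ℤ).det :=
    (Matrix.isUnit_iff_isUnit_det _).1 U.isUnit
  have h2 : ((U : Matrix (Fin 2) (Fin 2) ℤ).map (fun n : ℤ => (n : ℝ))).det =
      (((U : Matrix (Fin 2) (Fin 2) ℤ).det : ℤ) : ℝ) := by
    simp [Matrix.det_fin_two]
  rw [h2]
  rcases Int.isUnit_iff.1 h with h | h <;> rw [h] <;> simp

theorem volume_latticeMap_image (U : Matrix.GeneralLinearGroup (Fin 2) ℤ) (t : Fin 2 → ℤ)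
    (A : Set (Fin 2 → ℝ)) :
    MeasureTheory.volume.real (latticeMap U t '' A) = MeasureTheory.volume.real A := by
  have h : latticeMap U t '' A = (fun x => x + latticePoint t) ''
      ((Matrix.toLin' ((U : Matrix (Fin 2) (Fin 2) ℤ).map (fun n : ℤ => (n : ℝ)))) '' A) := by
    rw [Set.image_image]; rfl
  have h3 : MeasureTheory.volume (latticeMap U t '' A) = MeasureTheory.volume A := by
    rw [h, Set.image_add_right, MeasureTheory.measure_preimage_add_right,
      MeasureTheory.Measure.addHaar_image_linearMap, LinearMap.det_toLin',
      abs_det_generalLinear, ENNReal.ofReal_one, one_mul]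
  rw [MeasureTheory.Measure.real, MeasureTheory.Measure.real, h3]

theorem smul_latticeMap_image (U : Matrix.GeneralLinearGroup (Fin 2) ℤ) (t : Fin 2 → ℤ)
    (k : ℕ) (A : Set (Fin 2 → ℝ)) :
    (k : ℝ) • (latticeMap U t '' A) = latticeMap U (k • t) '' ((k : ℝ) • A) := by
  rw [← Set.image_smul, ← Set.image_smul, Set.image_image, Set.image_image]
  refine Set.image_congr fun x _ => ?_
  ext i
  simp [latticeMap_apply]
  ring

theorem latticeEquivalent_iff {Q R : Set (Fin 2 → ℝ)} :
    LatticeEquivalent Q R ↔ ∃ U t, Q = latticeMap U t '' R := Iff.rfl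

theorem LatticeEquivalent.trans {Q R S : Set (Fin 2 → ℝ)} (h : LatticeEquivalent Q R)
    (h' : LatticeEquivalent R S) : LatticeEquivalent Q S := by
  rw [latticeEquivalent_iff] at *
  obtain ⟨U, t, rfl⟩ := h
  obtain ⟨W, s, rfl⟩ := h'
  simp_rw [Set.image_image, latticeMap_comp]
  exact ⟨_, _, rfl⟩

theorem LatticeEquivalent.symm {Q R : Set (Fin 2 → ℝ)} (h : LatticeEquivalent Q R) :
    LatticeEquivalent R Q := by
  rw [latticeEquivalent_iff] at *
  obtain ⟨U, t, rfl⟩ := h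
  refine ⟨U⁻¹, latticeInvShift U t, ?_⟩
  rw [Set.image_image]
  simp_rw [latticeMap_inv_left, Set.image_id']

theorem latticeEquivalent_image (U : Matrix.GeneralLinearGroup (Fin 2) ℤ) (t : Fin 2 → ℤ)
    (R : Set (Fin 2 → ℝ)) : LatticeEquivalent (latticeMap U t '' R) R := ⟨U, t, rfl⟩

/-- The integral matrix with the given entries and determinant `±1`. -/
noncomputable def unimodular (a b c d : ℤ) (h : IsUnit (a * d - b * c)) :
    Matrix.GeneralLinearGroup (Fin 2) ℤ :=
  Matrix.GeneralLinearGroup.mk'' !![a, b; c, d] (by rwa [Matrix.det_fin_two_of])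

theorem coe_unimodular (a b c d : ℤ) (h : IsUnit (a * d - b * c)) :
    (unimodular a b c d h : Matrix (Fin 2) (Fin 2) ℤ) = !![a, b; c, d] := rfl

theorem latticeMap_unimodular (a b c d : ℤ) (h : IsUnit (a * d - b * c)) (t : Fin 2 → ℤ)
    (x : Fin 2 → ℝ) : latticeMap (unimodular a b c d h) t x =
      ![a * x 0 + b * x 1 + t 0, c * x 0 + d * x 1 + t 1] := by
  ext i
  fin_cases i <;> simp [latticeMap_apply, coe_unimodular]

/-- Every nonzero integral vector is mapped by `GL(2, ℤ)` to a positive multiple of `e₁`. -/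
theorem exists_unimodular_eq_gcd (x y : ℤ) (h : x ≠ 0 ∨ y ≠ 0) :
    ∃ (g a b c d : ℤ), 0 < g ∧ a * d - b * c = 1 ∧ a * x + b * y = g ∧ c * x + d * y = 0 := by
  have hg : 0 < (Int.gcd x y : ℤ) := by
    have : 0 < Int.gcd x y := Int.gcd_pos_iff.2 h
    exact_mod_cast this
  obtain ⟨x', hx⟩ := Int.gcd_dvd_left x y
  obtain ⟨y', hy⟩ := Int.gcd_dvd_right x y
  have hb := Int.gcd_eq_gcd_ab x y
  -- The first row consists of Bézout coefficients, the second is the primitive vector orthogonal to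
  -- (x, y).
  refine ⟨Int.gcd x y, Int.gcdA x y, Int.gcdB x y, -y', x', hg, ?_, ?_, ?_⟩
  · have : (Int.gcd x y : ℤ) * (x' * Int.gcdA x y + y' * Int.gcdB x y) = Int.gcd x y * 1 := by
      linear_combination -hb - Int.gcdA x y * hx - Int.gcdB x y * hy
    have := mul_left_cancel₀ hg.ne' this
    linear_combination this
  · linear_combination -hb
  · linear_combination -y' * hx + x' * hy

/-! ### Counting lattice points and the interior of convex sets in the plane -/

theorem finite_latticePoints {A : Set (Fin 2 → ℝ)} (hA : Bornology.IsBounded A) :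
    {z : Fin 2 → ℤ | latticePoint z ∈ A}.Finite := by
  obtain ⟨R, hR⟩ := hA.subset_closedBall 0
  refine (Set.finite_Icc (fun _ : Fin 2 => -⌈R⌉) (fun _ => ⌈R⌉)).subset fun z hz => ?_
  have h := hR hz
  rw [mem_closedBall_zero_iff] at h
  have h2 : ∀ i, |(z i : ℝ)| ≤ R := fun i => (norm_le_pi_norm (latticePoint z) i).trans h
  constructor <;> intro i
  · have h3 := (abs_le.1 (h2 i)).1
    have h4 := Int.le_ceil R
    change -⌈R⌉ ≤ z i
    have : (-(⌈R⌉ : ℝ)) ≤ z i := by linarith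
    exact_mod_cast this
  · have h3 := (abs_le.1 (h2 i)).2
    have h4 := Int.le_ceil R
    change z i ≤ ⌈R⌉
    have : (z i : ℝ) ≤ ⌈R⌉ := by linarith
    exact_mod_cast this

theorem latticeCount_union_add_inter {A B : Set (Fin 2 → ℝ)} (hA : Bornology.IsBounded A)
    (hB : Bornology.IsBounded B) :
    latticeCount (A ∪ B) + latticeCount (A ∩ B) = latticeCount A + latticeCount B :=
  Set.ncard_union_add_ncard_inter _ _ (finite_latticePoints hA) (finite_latticePoints hB)

theorem latticeCount_singleton (z : Fin 2 → ℤ) : latticeCount {latticePoint z} = 1 := by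
  rw [latticeCount, Set.ncard_eq_one]
  refine ⟨z, Set.ext fun w => ?_⟩
  exact ⟨fun h => latticePoint_injective h, fun h => congrArg latticePoint h⟩

theorem latticeCount_zero_smul {A : Set (Fin 2 → ℝ)} (hA : A.Nonempty) :
    latticeCount ((0 : ℝ) • A) = 1 := by
  rw [Set.zero_smul_set hA, ← latticeCount_singleton 0, latticePoint_zero]
  rfl

/-- The linear form with the given coefficients. -/
def linForm (A B : ℝ) : (Fin 2 → ℝ) →L[ℝ] ℝ :=
  A • ContinuousLinearMap.proj 0 + B • ContinuousLinearMap.proj 1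

theorem linForm_apply (A B : ℝ) (x : Fin 2 → ℝ) : linForm A B x = A * x 0 + B * x 1 := rfl

theorem linForm_surjective {A B : ℝ} (h : A ≠ 0 ∨ B ≠ 0) : Function.Surjective (linForm A B) := by
  intro c
  rcases h with h | h
  · exact ⟨![c / A, 0], by simp [linForm_apply]; field_simp⟩
  · exact ⟨![0, c / B], by simp [linForm_apply]; field_simp⟩

theorem exists_eq_linForm (f : (Fin 2 → ℝ) →ₗ[ℝ] ℝ) (hf : f ≠ 0) :
    ∃ A B : ℝ, (A ≠ 0 ∨ B ≠ 0) ∧ ∀ x, f x = linForm A B x := by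
  have key : ∀ x, f x = linForm (f ![1, 0]) (f ![0, 1]) x := by
    intro x
    have hx : x = x 0 • ![1, 0] + x 1 • ![0, 1] := by
      ext i; fin_cases i <;> simp
    conv_lhs => rw [hx]
    rw [map_add, map_smul, map_smul, linForm_apply, smul_eq_mul, smul_eq_mul]
    ring
  refine ⟨_, _, ?_, key⟩
  by_contra hcon
  push Not at hcon
  refine hf (LinearMap.ext fun x => ?_)
  rw [key, linForm_apply, hcon.1, hcon.2]
  simp

theorem interior_linForm_le {A B : ℝ} (h : A ≠ 0 ∨ B ≠ 0) (c : ℝ) :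
    interior {x | linForm A B x ≤ c} = {x | linForm A B x < c} := by
  have := ((linForm A B).isOpenMap (linForm_surjective h)).preimage_interior_eq_interior_preimage
    (linForm A B).continuous (Set.Iic c)
  rw [interior_Iic] at this
  exact this.symm

theorem interior_le_linForm {A B : ℝ} (h : A ≠ 0 ∨ B ≠ 0) (c : ℝ) :
    interior {x | c ≤ linForm A B x} = {x | c < linForm A B x} := by
  have := ((linForm A B).isOpenMap (linForm_surjective h)).preimage_interior_eq_interior_preimage
    (linForm A B).continuous (Set.Ici c)
  rw [interior_Ici] at this
  exact this.symm

theorem exists_lt_linForm_of_mem_interior {Q : Set (Fin 2 → ℝ)} {p : Fin 2 → ℝ}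
    (hp : p ∈ interior Q) {A B : ℝ} (h : A ≠ 0 ∨ B ≠ 0) :
    ∃ q ∈ Q, linForm A B p < linForm A B q := by
  by_contra! hcon
  have h1 : Q ⊆ {x | linForm A B x ≤ linForm A B p} := hcon
  have h2 := interior_mono h1 hp
  rw [interior_linForm_le h] at h2
  exact lt_irrefl (linForm A B p) h2

/-- A point of the plane is interior to a convex set as soon as no line supports the set there. -/
theorem mem_interior_of_forall_linForm {Q : Set (Fin 2 → ℝ)} (hQ : Convex ℝ Q) {p : Fin 2 → ℝ}
    (h : ∀ A B : ℝ, (A ≠ 0 ∨ B ≠ 0) → ∃ q ∈ Q, linForm A B p < linForm A B q) :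
    p ∈ interior Q := by
  -- If the affine span were proper, some nonzero form would be constant on Q, whereas the
  -- hypothesis, applied to the form and to its negative, gives values on both sides of the value at
  -- p.
  have hint : (interior Q).Nonempty := by
    rw [hQ.interior_nonempty_iff_affineSpan_eq_top]
    by_contra hne
    obtain ⟨q₀, hq₀, -⟩ := h 1 0 (by simp)
    have hdir : (affineSpan ℝ Q).direction < ⊤ := by
      rw [lt_top_iff_ne_top]
      intro htop
      exact hne ((AffineSubspace.direction_eq_top_iff_of_nonempty
        ⟨q₀, subset_affineSpan ℝ Q hq₀⟩).1 htop)
    obtain ⟨f, hf, hker⟩ := Submodule.exists_le_ker_of_lt_top _ hdir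
    obtain ⟨A, B, hAB, hfAB⟩ := exists_eq_linForm f hf
    obtain ⟨q, hq, hq'⟩ := h A B hAB
    obtain ⟨r, hr, hr'⟩ := h (-A) (-B) (by simpa using hAB)
    have hmem := hker (AffineSubspace.vsub_mem_direction (subset_affineSpan ℝ Q hq)
      (subset_affineSpan ℝ Q hr))
    rw [LinearMap.mem_ker, vsub_eq_sub, map_sub, hfAB, hfAB] at hmem
    simp only [linForm_apply] at *
    linarith
  by_contra hp
  obtain ⟨f, hf⟩ := geometric_hahn_banach_open_point hQ.interior isOpen_interior hp
  obtain ⟨q₀, hq₀⟩ := hint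
  have hf0 : (f : (Fin 2 → ℝ) →ₗ[ℝ] ℝ) ≠ 0 := by
    intro h0
    have h1 := hf q₀ hq₀
    have h2 : ∀ x, f x = 0 := fun x => LinearMap.congr_fun h0 x
    rw [h2, h2] at h1
    exact lt_irrefl _ h1
  obtain ⟨A, B, hAB, hfAB⟩ := exists_eq_linForm _ hf0
  obtain ⟨q, hq, hq'⟩ := h A B hAB
  rw [← hfAB, ← hfAB] at hq'
  have hcl : Q ⊆ {x | f x ≤ f p} := by
    have h1 : closure (interior Q) ⊆ {x | f x ≤ f p} :=
      closure_minimal (fun x hx => (hf x hx).le) (isClosed_le f.continuous continuous_const)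
    rw [hQ.closure_interior_eq_closure_of_nonempty_interior ⟨q₀, hq₀⟩] at h1
    exact subset_closure.trans h1
  exact absurd hq' (not_lt.2 (hcl hq))

/-- A line lies in the frontier of a half-plane, and the frontier of a convex set is null. -/
theorem volume_linForm_eq {A B : ℝ} (h : A ≠ 0 ∨ B ≠ 0) (c : ℝ) :
    MeasureTheory.volume {x | linForm A B x = c} = 0 := by
  have h1 : {x | linForm A B x = c} ⊆ frontier {x | linForm A B x ≤ c} := by
    intro x hx
    refine ⟨subset_closure (le_of_eq hx), ?_⟩
    rw [interior_linForm_le h]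
    exact fun hx' => ne_of_lt hx' hx
  refine MeasureTheory.measure_mono_null h1 (Convex.addHaar_frontier _ ?_)
  exact convex_halfSpace_le (linForm A B).isLinear c

/-! ### Cutting a convex set along a lattice segment -/

section Cut

variable {Q : Set (Fin 2 → ℝ)} {A B c : ℝ}

theorem cut_volume (hQ : IsCompact Q) (hAB : A ≠ 0 ∨ B ≠ 0) :
    MeasureTheory.volume.real Q = MeasureTheory.volume.real (Q ∩ {p | linForm A B p ≤ c}) +
      MeasureTheory.volume.real (Q ∩ {p | c ≤ linForm A B p}) := by
  have hm : MeasurableSet {p | linForm A B p ≤ c} :=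
    (isClosed_le (linForm A B).continuous continuous_const).measurableSet
  rw [← MeasureTheory.measureReal_inter_add_sdiff hm
    (h := hQ.measure_lt_top.ne)]
  congr 1
  refine MeasureTheory.measureReal_congr ?_
  have h0 : ∀ᵐ p, p ∉ {x | linForm A B x = c} :=
    MeasureTheory.measure_eq_zero_iff_ae_notMem.1 (volume_linForm_eq hAB c)
  filter_upwards [h0] with p hp
  apply propext
  change (p ∈ Q ∧ ¬ linForm A B p ≤ c) ↔ (p ∈ Q ∧ c ≤ linForm A B p)
  rw [not_le]
  exact ⟨fun h => ⟨h.1, h.2.le⟩, fun h => ⟨h.1, lt_of_le_of_ne h.2 (Ne.symm hp)⟩⟩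

theorem cut_latticeCount (hQ : IsCompact Q) (hne : (Q ∩ {p | linForm A B p = c}).Nonempty)
    (k : ℕ) :
    latticeCount ((k : ℝ) • Q) + latticeCount ((k : ℝ) • (Q ∩ {p | linForm A B p = c})) =
      latticeCount ((k : ℝ) • (Q ∩ {p | linForm A B p ≤ c})) +
        latticeCount ((k : ℝ) • (Q ∩ {p | c ≤ linForm A B p})) := by
  have hinter : Q ∩ {p | linForm A B p = c} =
      (Q ∩ {p | linForm A B p ≤ c}) ∩ (Q ∩ {p | c ≤ linForm A B p}) := by
    ext p
    change (p ∈ Q ∧ _ = c) ↔ ((p ∈ Q ∧ _ ≤ c) ∧ (p ∈ Q ∧ c ≤ _))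
    rw [le_antisymm_iff]
    tauto
  have hunion : Q = (Q ∩ {p | linForm A B p ≤ c}) ∪ (Q ∩ {p | c ≤ linForm A B p}) := by
    rw [← Set.inter_union_distrib_left]
    refine (Set.inter_eq_left.2 fun p _ => ?_).symm
    exact le_total (linForm A B p) c
  -- Dilation commutes with intersections only for a nonzero factor. For k = 0 each of the four sets
  -- collapses to the origin, and both sides are 2.
  rcases Nat.eq_zero_or_pos k with rfl | hk
  · rw [hinter] at hne
    simp only [Nat.cast_zero]
    rw [hinter, latticeCount_zero_smul hne, latticeCount_zero_smul (hne.mono Set.inter_subset_left),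
      latticeCount_zero_smul (hne.mono Set.inter_subset_right),
      latticeCount_zero_smul (hne.mono (Set.inter_subset_left.trans Set.inter_subset_left))]
  · have hk0 : (k : ℝ) ≠ 0 := by positivity
    have hb : ∀ s ⊆ Q, Bornology.IsBounded ((k : ℝ) • s) := fun s hs =>
      ((hQ.smul (k : ℝ)).isBounded).subset (Set.smul_set_mono hs)
    rw [hinter, Set.smul_set_inter₀ hk0]
    conv_lhs => enter [1, 1, 2]; rw [hunion]
    rw [Set.smul_set_union]
    exact latticeCount_union_add_inter (hb _ Set.inter_subset_left) (hb _ Set.inter_subset_left)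

/-- Interior points of Q are those of the two halves together with the cut minus its two endpoints,
whence the 2. -/
theorem cut_latticeCount_interior (hQc : Convex ℝ Q) (hQ : IsCompact Q) (hAB : A ≠ 0 ∨ B ≠ 0)
    {x y : Fin 2 → ℤ} (hxy : x ≠ y)
    (hseg : Q ∩ {p | linForm A B p = c} = segment ℝ (latticePoint x) (latticePoint y))
    (hlo : ∃ p ∈ Q, linForm A B p < c) (hhi : ∃ p ∈ Q, c < linForm A B p)
    (hx : latticePoint x ∉ interior Q) (hy : latticePoint y ∉ interior Q) :
    latticeCount (interior Q) + 2 = latticeCount (interior (Q ∩ {p | linForm A B p ≤ c})) +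
      latticeCount (interior (Q ∩ {p | c ≤ linForm A B p})) +
      latticeCount (segment ℝ (latticePoint x) (latticePoint y)) := by
  -- A line supporting Q at a point of the open chord would contain the chord, hence be the cutting
  -- line itself; but Q has points strictly on both sides of that line.
  have hopen : openSegment ℝ (latticePoint x) (latticePoint y) ⊆ interior Q := by
    intro p hp
    refine mem_interior_of_forall_linForm hQc fun A' B' h' => ?_
    have hxQ := hseg ▸ left_mem_segment ℝ (latticePoint x) (latticePoint y)
    have hyQ := hseg ▸ right_mem_segment ℝ (latticePoint x) (latticePoint y)
    obtain ⟨hxQ, hxc⟩ := hxQ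
    obtain ⟨hyQ, hyc⟩ := hyQ
    change linForm A B (latticePoint x) = c at hxc
    change linForm A B (latticePoint y) = c at hyc
    obtain ⟨s, t, hs, ht, hst, rfl⟩ := hp
    by_contra! hcon
    have h1 := hcon _ hxQ
    have h2 := hcon _ hyQ
    rw [map_add, map_smul, map_smul, smul_eq_mul, smul_eq_mul] at h1 h2
    have h3 : linForm A' B' (latticePoint x) = linForm A' B' (latticePoint y) := by
      have hs' : s = 1 - t := by linarith
      subst hs'
      nlinarith
    obtain ⟨p, hpQ, hp⟩ := hlo
    obtain ⟨q, hqQ, hq⟩ := hhi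
    have h4 := hcon _ hpQ
    have h5 := hcon _ hqQ
    rw [map_add, map_smul, map_smul, smul_eq_mul, smul_eq_mul] at h4 h5
    have h6 : s * linForm A' B' (latticePoint x) + t * linForm A' B' (latticePoint y) =
      linForm A' B' (latticePoint x) := by rw [← h3, ← add_mul, hst, one_mul]
    rw [h6] at h4 h5
    simp only [linForm_apply] at *
    set x0 := latticePoint x 0
    set x1 := latticePoint x 1
    set y0 := latticePoint y 0
    set y1 := latticePoint y 1
    have hcross : A' * B = B' * A := by
      have e1 : A * (x0 - y0) + B * (x1 - y1) = 0 := by linarith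
      have e2 : A' * (x0 - y0) + B' * (x1 - y1) = 0 := by linarith
      have hne : x0 - y0 ≠ 0 ∨ x1 - y1 ≠ 0 := by
        by_contra! hne
        apply hxy
        apply latticePoint_injective
        ext i
        fin_cases i
        · exact sub_eq_zero.1 hne.1
        · exact sub_eq_zero.1 hne.2
      rcases hne with hne | hne
      · apply mul_right_cancel₀ hne
        linear_combination B * e2 - B' * e1
      · apply mul_right_cancel₀ hne
        linear_combination A' * e1 - A * e2
    rcases hAB with hA | hB
    · have hr : ∀ u0 u1 : ℝ, A' * u0 + B' * u1 = A' / A * (A * u0 + B * u1) := by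
        intro u0 u1
        have hB' : B' = A' * B / A := by rw [hcross]; field_simp
        rw [hB']; field_simp
      have hr0 : A' / A ≠ 0 := by
        intro h0
        rcases (div_eq_zero_iff.1 h0) with h0 | h0
        · rw [h0, zero_mul] at hcross
          rcases h' with h' | h'
          · exact h' h0
          · exact (mul_ne_zero h' hA) hcross.symm
        · exact hA h0
      rw [hr, hr x0] at h4 h5
      rcases lt_or_gt_of_ne hr0 with h | h <;> nlinarith
    · have hr : ∀ u0 u1 : ℝ, A' * u0 + B' * u1 = B' / B * (A * u0 + B * u1) := by
        intro u0 u1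
        have hB' : A' = B' * A / B := by rw [← hcross]; field_simp
        rw [hB']; field_simp
      have hr0 : B' / B ≠ 0 := by
        intro h0
        rcases (div_eq_zero_iff.1 h0) with h0 | h0
        · rw [h0, zero_mul] at hcross
          rcases h' with h' | h'
          · exact (mul_ne_zero h' hB) hcross
          · exact h' h0
        · exact hB h0
      rw [hr, hr x0] at h4 h5
      rcases lt_or_gt_of_ne hr0 with h | h <;> nlinarith
  have hI := finite_latticePoints (hQ.isBounded.subset interior_subset)
  unfold latticeCount
  have e1 : {z | latticePoint z ∈ segment ℝ (latticePoint x) (latticePoint y)}.ncard =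
      {z | latticePoint z ∈ interior Q ∧ linForm A B (latticePoint z) = c}.ncard + 2 := by
    have h2 : 2 = ({x, y} : Set (Fin 2 → ℤ)).ncard := (Set.ncard_pair hxy).symm
    refine Eq.trans ?_ (congrArg (_ + ·) h2.symm)
    rw [← Set.ncard_union_eq ?_ (hI.subset fun z hz => hz.1) (Set.toFinite _)]
    · congr 1
      ext z
      constructor
      · intro hz
        by_cases hzx : z = x
        · exact Or.inr (Or.inl hzx)
        by_cases hzy : z = y
        · exact Or.inr (Or.inr hzy)
        left
        refine ⟨hopen (mem_openSegment_of_ne_left_right ?_ ?_ hz), (hseg ▸ hz : _ ∈ Q ∩ _).2⟩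
        · exact fun h => hzx (latticePoint_injective h).symm
        · exact fun h => hzy (latticePoint_injective h).symm
      · rintro (hz | rfl | rfl)
        · change _ ∈ segment ℝ _ _
          rw [← hseg]
          exact ⟨interior_subset hz.1, hz.2⟩
        · exact left_mem_segment ℝ _ _
        · exact right_mem_segment ℝ _ _
    · rw [Set.disjoint_left]
      rintro z hz (rfl | rfl)
      · exact hx hz.1
      · exact hy hz.1
  have e2 : {z | latticePoint z ∈ interior (Q ∩ {p | linForm A B p ≤ c})} =
      {z | latticePoint z ∈ interior Q ∧ linForm A B (latticePoint z) < c} := by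
    ext z
    change latticePoint z ∈ interior (Q ∩ {p | linForm A B p ≤ c}) ↔ _
    rw [interior_inter, interior_linForm_le hAB]
    rfl
  have e3 : {z | latticePoint z ∈ interior (Q ∩ {p | c ≤ linForm A B p})} =
      {z | latticePoint z ∈ interior Q ∧ c < linForm A B (latticePoint z)} := by
    ext z
    change latticePoint z ∈ interior (Q ∩ {p | c ≤ linForm A B p}) ↔ _
    rw [interior_inter, interior_le_linForm hAB]
    rfl
  have hlt : {z | latticePoint z ∈ interior Q ∧ linForm A B (latticePoint z) < c}.Finite :=
    hI.subset fun z hz => hz.1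
  have hgt : {z | latticePoint z ∈ interior Q ∧ c < linForm A B (latticePoint z)}.Finite :=
    hI.subset fun z hz => hz.1
  have heq : {z | latticePoint z ∈ interior Q ∧ linForm A B (latticePoint z) = c}.Finite :=
    hI.subset fun z hz => hz.1
  rw [e1, e2, e3, ← add_assoc, ← Set.ncard_union_eq ?_ hlt hgt,
    ← Set.ncard_union_eq ?_ (hlt.union hgt) heq]
  · congr 2
    ext z
    change latticePoint z ∈ interior Q ↔ (((_ ∧ _) ∨ (_ ∧ _)) ∨ (_ ∧ _))
    have := lt_trichotomy (linForm A B (latticePoint z)) c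
    tauto
  · rw [Set.disjoint_left]
    rintro z (hz | hz) hz'
    · exact hz.2.ne hz'.2
    · exact hz.2.ne' hz'.2
  · rw [Set.disjoint_left]
    rintro z hz hz'
    exact lt_asymm hz.2 hz'.2

end Cut

/-! ### The Ehrhart polynomial -/

/-- The formula `2 |kQ| = 2 V(Q) k² + (|Q| - |int Q|) k + 2`, which combines Pick's theorem and the
shape of the Ehrhart polynomial of a lattice polygon. -/
def EhrhartFormula (Q : Set (Fin 2 → ℝ)) : Prop :=
  ∀ k : ℕ, 2 * (latticeCount ((k : ℝ) • Q) : ℝ) =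
    2 * MeasureTheory.volume.real Q * (k : ℝ) ^ 2 +
      ((latticeCount Q : ℝ) - (latticeCount (interior Q) : ℝ)) * k + 2

theorem EhrhartFormula.image {Q : Set (Fin 2 → ℝ)} (h : EhrhartFormula Q)
    (U : Matrix.GeneralLinearGroup (Fin 2) ℤ) (t : Fin 2 → ℤ) :
    EhrhartFormula (latticeMap U t '' Q) := by
  intro k
  rw [smul_latticeMap_image, latticeCount_latticeMap_image, latticeCount_latticeMap_image,
    interior_latticeMap_image, latticeCount_latticeMap_image, volume_latticeMap_image]
  exact h k

theorem ehrhartFormula_image_iff {Q : Set (Fin 2 → ℝ)}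
    (U : Matrix.GeneralLinearGroup (Fin 2) ℤ) (t : Fin 2 → ℤ) :
    EhrhartFormula (latticeMap U t '' Q) ↔ EhrhartFormula Q := by
  refine ⟨fun h => ?_, fun h => h.image U t⟩
  have := h.image U⁻¹ (latticeInvShift U t)
  rw [Set.image_image] at this
  simpa only [latticeMap_inv_left, Set.image_id'] using this

theorem ncard_Icc_int (a b : ℤ) : (Set.Icc a b).ncard = (b + 1 - a).toNat := by
  rw [← Int.card_Icc, ← Finset.coe_Icc, Set.ncard_coe_finset]

theorem latticeMap_image_segment (U : Matrix.GeneralLinearGroup (Fin 2) ℤ) (t : Fin 2 → ℤ)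
    (x y : Fin 2 → ℝ) :
    latticeMap U t '' segment ℝ x y = segment ℝ (latticeMap U t x) (latticeMap U t y) := by
  rw [← convexHull_pair, latticeMap_image_convexHull, Set.image_pair, convexHull_pair]

theorem latticeCount_horizontal (g : ℤ) (hg : 0 ≤ g) :
    (latticeCount (segment ℝ 0 (latticePoint ![g, 0])) : ℤ) = g + 1 := by
  have h : latticeCount (segment ℝ 0 (latticePoint ![g, 0])) = (Set.Icc 0 g).ncard := by
    symm
    refine Set.ncard_congr (fun j _ => ![j, 0]) ?_ ?_ ?_
    · rintro j ⟨hj0, hjg⟩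
      change latticePoint ![j, 0] ∈ segment ℝ 0 (latticePoint ![g, 0])
      rcases hg.eq_or_lt with rfl | hg
      · have : j = 0 := by omega
        subst this
        exact right_mem_segment ℝ _ _
      rw [segment_eq_image]
      have hg' : (0 : ℝ) < g := by exact_mod_cast hg
      have hj0' : (0 : ℝ) ≤ j := by exact_mod_cast hj0
      have hjg' : (j : ℝ) ≤ g := by exact_mod_cast hjg
      refine ⟨(j : ℝ) / g, ⟨by positivity, (div_le_one hg').2 hjg'⟩, ?_⟩
      ext i
      fin_cases i
      · simp [latticePoint]; field_simp
      · simp [latticePoint]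
    · intro i j _ _ h
      exact congrFun h 0
    · intro z hz
      obtain ⟨s, t, hs, ht, hst, h⟩ := hz
      have h0 := congrFun h 0
      have h1 := congrFun h 1
      simp only [latticePoint, Pi.add_apply, Pi.smul_apply, Pi.zero_apply, smul_eq_mul,
        Matrix.cons_val_zero, Matrix.cons_val_one, Int.cast_zero, mul_zero, add_zero,
        zero_add] at h0 h1
      have hg' : (0 : ℝ) ≤ g := by exact_mod_cast hg
      refine ⟨z 0, ⟨?_, ?_⟩, ?_⟩
      · have : (0 : ℝ) ≤ z 0 := by rw [← h0]; positivity
        exact_mod_cast this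
      · have : (z 0 : ℝ) ≤ g := by rw [← h0]; nlinarith
        exact_mod_cast this
      · have hz1 : z 1 = 0 := by exact_mod_cast h1.symm
        ext i
        fin_cases i
        · rfl
        · exact hz1.symm
  rw [h, ncard_Icc_int]
  omega

theorem smul_segment (k : ℝ) (x y : Fin 2 → ℝ) :
    k • segment ℝ x y = segment ℝ (k • x) (k • y) := by
  rw [← convexHull_pair, ← convexHull_smul, ← convexHull_pair, ← Set.image_smul, Set.image_pair]

/-- A lattice segment is the unimodular image of a horizontal one. -/
theorem exists_segment_eq_image {x y : Fin 2 → ℤ} (hxy : x ≠ y) :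
    ∃ (U : Matrix.GeneralLinearGroup (Fin 2) ℤ) (t : Fin 2 → ℤ) (g : ℤ), 0 < g ∧
      segment ℝ (latticePoint x) (latticePoint y) =
        latticeMap U t '' segment ℝ 0 (latticePoint ![g, 0]) := by
  have hne : y 0 - x 0 ≠ 0 ∨ y 1 - x 1 ≠ 0 := by
    by_contra! h
    apply hxy
    ext i
    fin_cases i
    · change x 0 = y 0; linarith [h.1]
    · change x 1 = y 1; linarith [h.2]
  obtain ⟨g, a, b, c, d, hg, hdet, h1, h2⟩ := exists_unimodular_eq_gcd _ _ hne
  have hdet' : IsUnit (d * a - (-b) * (-c)) := by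
    rw [show d * a - (-b) * (-c) = 1 by linear_combination hdet]; exact isUnit_one
  refine ⟨unimodular d (-b) (-c) a hdet', x, g, hg, ?_⟩
  have e0 : (y 0 : ℝ) - x 0 = d * g := by
    have : y 0 - x 0 = d * g := by
      linear_combination -(y 0 - x 0) * hdet + d * h1 - b * h2
    exact_mod_cast this
  have e1 : (y 1 : ℝ) - x 1 = -c * g := by
    have : y 1 - x 1 = -c * g := by
      linear_combination -(y 1 - x 1) * hdet - c * h1 + a * h2
    exact_mod_cast this
  rw [latticeMap_image_segment]
  congr 1
  · rw [latticeMap_unimodular]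
    ext i; fin_cases i <;> simp [latticePoint]
  · rw [latticeMap_unimodular]
    ext i; fin_cases i
    · simp [latticePoint]; linarith
    · simp [latticePoint]; linarith

theorem latticeCount_smul_segment {x y : Fin 2 → ℤ} (hxy : x ≠ y) (k : ℕ) :
    (latticeCount ((k : ℝ) • segment ℝ (latticePoint x) (latticePoint y)) : ℝ) =
      k * ((latticeCount (segment ℝ (latticePoint x) (latticePoint y)) : ℝ) - 1) + 1 := by
  obtain ⟨U, t, g, hg, h⟩ := exists_segment_eq_image hxy
  rw [h, smul_latticeMap_image, latticeCount_latticeMap_image, latticeCount_latticeMap_image,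
    smul_segment, smul_zero, ← latticePoint_natCast_smul]
  have e : k • ![g, 0] = ![k * g, 0] := by
    ext i; fin_cases i <;> simp
  have h1 := latticeCount_horizontal (k * g) (by positivity)
  have h2 := latticeCount_horizontal g hg.le
  have h1' : (latticeCount (segment ℝ 0 (latticePoint ![k * g, 0])) : ℝ) = k * g + 1 := by
    exact_mod_cast h1
  have h2' : (latticeCount (segment ℝ 0 (latticePoint ![g, 0])) : ℝ) = g + 1 := by
    exact_mod_cast h2
  rw [e, h1', h2']
  ring

/-! ### Gluing along a segment -/

section Glue

variable {Q : Set (Fin 2 → ℝ)} {A B c : ℝ}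

/-- Let s be the number of lattice points on the cut. Adding the two formulas overcounts 2|kQ| by
2(k(s - 1) + 1), while N - I drops by 2s - 2. The two corrections agree and reduce the constant term
from 4 to 2. -/
theorem ehrhart_glue (hQc : Convex ℝ Q) (hQ : IsCompact Q) (hAB : A ≠ 0 ∨ B ≠ 0)
    {x y : Fin 2 → ℤ} (hxy : x ≠ y)
    (hseg : Q ∩ {p | linForm A B p = c} = segment ℝ (latticePoint x) (latticePoint y))
    (hlo : ∃ p ∈ Q, linForm A B p < c) (hhi : ∃ p ∈ Q, c < linForm A B p)
    (hx : latticePoint x ∉ interior Q) (hy : latticePoint y ∉ interior Q)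
    (h1 : EhrhartFormula (Q ∩ {p | linForm A B p ≤ c}))
    (h2 : EhrhartFormula (Q ∩ {p | c ≤ linForm A B p})) : EhrhartFormula Q := by
  intro k
  have hne : (Q ∩ {p | linForm A B p = c}).Nonempty := by
    rw [hseg]; exact ⟨_, left_mem_segment ℝ _ _⟩
  have c1 := cut_latticeCount hQ hne k
  have c2 := cut_latticeCount hQ hne 1
  have ci := cut_latticeCount_interior hQc hQ hAB hxy hseg hlo hhi hx hy
  have cs := latticeCount_smul_segment hxy k
  rw [hseg] at c1 c2
  simp only [Nat.cast_one, one_smul] at c2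
  have h1k := h1 k
  have h2k := h2 k
  rw [cut_volume (c := c) hQ hAB]
  rify at c1 c2 ci
  linear_combination 2 * c1 + h1k + h2k - 2 * cs - k * c2 + k * ci

/-- This is the gluing computation read backwards: equivalent halves have the same counts and area,
so the formula for the whole determines them. -/
theorem ehrhart_half (hQc : Convex ℝ Q) (hQ : IsCompact Q) (hAB : A ≠ 0 ∨ B ≠ 0)
    {x y : Fin 2 → ℤ} (hxy : x ≠ y)
    (hseg : Q ∩ {p | linForm A B p = c} = segment ℝ (latticePoint x) (latticePoint y))
    (hlo : ∃ p ∈ Q, linForm A B p < c) (hhi : ∃ p ∈ Q, c < linForm A B p)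
    (hx : latticePoint x ∉ interior Q) (hy : latticePoint y ∉ interior Q)
    (heq : LatticeEquivalent (Q ∩ {p | c ≤ linForm A B p}) (Q ∩ {p | linForm A B p ≤ c}))
    (h : EhrhartFormula Q) : EhrhartFormula (Q ∩ {p | linForm A B p ≤ c}) := by
  intro k
  have hne : (Q ∩ {p | linForm A B p = c}).Nonempty := by
    rw [hseg]; exact ⟨_, left_mem_segment ℝ _ _⟩
  have c1 := cut_latticeCount hQ hne k
  have c2 := cut_latticeCount hQ hne 1
  have ci := cut_latticeCount_interior hQc hQ hAB hxy hseg hlo hhi hx hy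
  have cv := cut_volume (c := c) hQ hAB
  have cs := latticeCount_smul_segment hxy k
  obtain ⟨U, t, hUt⟩ := latticeEquivalent_iff.1 heq
  rw [hseg] at c1 c2
  rw [hUt] at c1 c2 ci cv
  rw [smul_latticeMap_image, latticeCount_latticeMap_image] at c1 c2
  rw [interior_latticeMap_image, latticeCount_latticeMap_image] at ci
  rw [volume_latticeMap_image] at cv
  simp only [Nat.cast_one, one_smul] at c2
  have hk := h k
  rify at c1 c2 ci
  linear_combination (-1) * c1 + hk / 2 + cs + k ^ 2 * cv + (k * c2 - k * ci) / 2

end Glue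

/-! ### Parallelograms and triangles -/

theorem Convex.triple_mem {Q : Set (Fin 2 → ℝ)} (hQ : Convex ℝ Q) {a b c p : Fin 2 → ℝ}
    (ha : a ∈ Q) (hb : b ∈ Q) (hc : c ∈ Q) (r s t : ℝ) (hr : 0 ≤ r) (hs : 0 ≤ s) (ht : 0 ≤ t)
    (h : r + s + t = 1) (h0 : p 0 = r * a 0 + s * b 0 + t * c 0)
    (h1 : p 1 = r * a 1 + s * b 1 + t * c 1) : p ∈ Q := by
  have key := hQ.sum_mem (t := Finset.univ) (w := ![r, s, t]) (z := ![a, b, c])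
    (by intro i _; fin_cases i <;> simpa) (by simp [Fin.sum_univ_three, h])
    (by intro i _; fin_cases i <;> simpa)
  rw [Fin.sum_univ_three] at key
  convert key using 1
  ext i
  fin_cases i
  · simpa using h0
  · simpa using h1

/-- The parallelogram with vertices `0`, `(g, 0)`, `(c, h)`, `(g + c, h)`. -/
def parallelogram (g c h : ℤ) : Set (Fin 2 → ℝ) :=
  {p | 0 ≤ p 1 ∧ p 1 ≤ h ∧ c * p 1 ≤ h * p 0 ∧ h * p 0 ≤ c * p 1 + g * h}

section Parallelogram

variable {g c h : ℤ}

theorem mem_parallelogram {p : Fin 2 → ℝ} : p ∈ parallelogram g c h ↔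
    0 ≤ p 1 ∧ p 1 ≤ h ∧ c * p 1 ≤ h * p 0 ∧ h * p 0 ≤ c * p 1 + g * h := Iff.rfl

theorem parallelogram_eq_image (hg : 0 < g) (hh : 0 < h) :
    parallelogram g c h = Matrix.toLin' !![(g : ℝ), c; 0, h] '' Set.Icc 0 1 := by
  have hg' : (0 : ℝ) < g := by exact_mod_cast hg
  have hh' : (0 : ℝ) < h := by exact_mod_cast hh
  ext p
  rw [mem_parallelogram]
  constructor
  · rintro ⟨h1, h2, h3, h4⟩
    refine ⟨![(p 0 - c * (p 1 / h)) / g, p 1 / h], ⟨?_, ?_⟩, ?_⟩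
    · intro i
      fin_cases i
      · change 0 ≤ (p 0 - c * (p 1 / h)) / g
        refine div_nonneg ?_ hg'.le
        rw [sub_nonneg, ← mul_div_assoc, div_le_iff₀ hh']
        linarith
      · exact div_nonneg h1 hh'.le
    · intro i
      fin_cases i
      · change (p 0 - c * (p 1 / h)) / g ≤ 1
        rw [div_le_one hg', sub_le_iff_le_add, ← mul_div_assoc, ← sub_le_iff_le_add',
          le_div_iff₀ hh']
        linarith
      · exact (div_le_one hh').2 h2
    · ext i
      fin_cases i
      · simp [Matrix.toLin'_apply]; field_simp; ring
      · simp [Matrix.toLin'_apply]; field_simp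
  · rintro ⟨q, ⟨hq0, hq1⟩, rfl⟩
    have a0 := hq0 0
    have a1 := hq0 1
    have b0 := hq1 0
    have b1 := hq1 1
    simp only [Pi.zero_apply, Pi.one_apply] at a0 a1 b0 b1
    simp only [Matrix.toLin'_apply, Matrix.mulVec, dotProduct, Fin.sum_univ_two]
    simp
    refine ⟨by positivity, by nlinarith, ?_, ?_⟩
    · have : 0 ≤ h * (g * q 0) := by positivity
      linarith
    · have : h * (g * q 0) ≤ h * (g * 1) := by gcongr
      linarith

theorem convex_parallelogram (hg : 0 < g) (hh : 0 < h) : Convex ℝ (parallelogram g c h) := by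
  rw [parallelogram_eq_image hg hh]
  exact (convex_Icc _ _).linear_image _

theorem isCompact_parallelogram (hg : 0 < g) (hh : 0 < h) : IsCompact (parallelogram g c h) := by
  rw [parallelogram_eq_image hg hh]
  exact isCompact_Icc.image (LinearMap.continuous_of_finiteDimensional _)

theorem volume_parallelogram (hg : 0 < g) (hh : 0 < h) :
    MeasureTheory.volume.real (parallelogram g c h) = g * h := by
  have hg' : (0 : ℝ) < g := by exact_mod_cast hg
  have hh' : (0 : ℝ) < h := by exact_mod_cast hh
  rw [parallelogram_eq_image hg hh, MeasureTheory.Measure.real,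
    MeasureTheory.Measure.addHaar_image_linearMap, LinearMap.det_toLin', Matrix.det_fin_two_of,
    Real.volume_Icc_pi]
  simp [abs_of_pos hg', abs_of_pos hh', hg'.le, hh.le]

theorem interior_parallelogram (hh : 0 < h) : interior (parallelogram g c h) =
    {p : Fin 2 → ℝ | 0 < p 1 ∧ p 1 < (h : ℝ) ∧ (c : ℝ) * p 1 < (h : ℝ) * p 0 ∧
      (h : ℝ) * p 0 < c * p 1 + g * h} := by
  have hh' : (h : ℝ) ≠ 0 := by exact_mod_cast hh.ne'
  have e : parallelogram g c h = ((({p | 0 ≤ linForm 0 1 p} ∩ {p | linForm 0 1 p ≤ h}) ∩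
      {p | 0 ≤ linForm h (-c) p}) ∩ {p | linForm h (-c) p ≤ g * h}) := by
    ext p
    change _ ↔ ((0 ≤ linForm 0 1 p ∧ linForm 0 1 p ≤ h) ∧ 0 ≤ linForm h (-c) p) ∧
      linForm h (-c) p ≤ g * h
    rw [mem_parallelogram, linForm_apply, linForm_apply]
    constructor
    · rintro ⟨h1, h2, h3, h4⟩
      exact ⟨⟨⟨by linarith, by linarith⟩, by linarith⟩, by linarith⟩
    · rintro ⟨⟨⟨h1, h2⟩, h3⟩, h4⟩
      exact ⟨by linarith, by linarith, by linarith, by linarith⟩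
  rw [e, interior_inter, interior_inter, interior_inter, interior_le_linForm (by simp),
    interior_linForm_le (by simp), interior_le_linForm (Or.inl hh'),
    interior_linForm_le (Or.inl hh')]
  ext p
  change ((0 < linForm 0 1 p ∧ linForm 0 1 p < h) ∧ 0 < linForm h (-c) p) ∧
      linForm h (-c) p < g * h ↔ 0 < p 1 ∧ p 1 < (h : ℝ) ∧ (c : ℝ) * p 1 < (h : ℝ) * p 0 ∧
      (h : ℝ) * p 0 < c * p 1 + g * h
  rw [linForm_apply, linForm_apply]
  constructor
  · rintro ⟨⟨⟨h1, h2⟩, h3⟩, h4⟩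
    exact ⟨by linarith, by linarith, by linarith, by linarith⟩
  · rintro ⟨h1, h2, h3, h4⟩
    exact ⟨⟨⟨by linarith, by linarith⟩, by linarith⟩, by linarith⟩

theorem latticePoint_mem_side (hh : 0 < h) (z : Fin 2 → ℤ) :
    latticePoint z ∈ segment ℝ 0 (latticePoint ![c, h]) ↔
      0 ≤ z 1 ∧ z 1 ≤ h ∧ c * z 1 = h * z 0 := by
  have hh' : (0 : ℝ) < h := by exact_mod_cast hh
  rw [segment_eq_image]
  constructor
  · rintro ⟨t, ⟨ht0, ht1⟩, ht⟩
    have e0 : t * c = z 0 := by simpa [latticePoint] using congrFun ht 0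
    have e1 : t * h = z 1 := by simpa [latticePoint] using congrFun ht 1
    have a1 : (0 : ℝ) ≤ z 1 := by rw [← e1]; positivity
    have a2 : (z 1 : ℝ) ≤ h := by rw [← e1]; nlinarith
    have a3 : (c * z 1 : ℝ) = h * z 0 := by rw [← e1, ← e0]; ring
    exact ⟨by exact_mod_cast a1, by exact_mod_cast a2, by exact_mod_cast a3⟩
  · rintro ⟨h1, h2, h3⟩
    have h1' : (0 : ℝ) ≤ z 1 := by exact_mod_cast h1
    have h2' : (z 1 : ℝ) ≤ h := by exact_mod_cast h2
    have h3' : (c * z 1 : ℝ) = h * z 0 := by exact_mod_cast h3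
    refine ⟨z 1 / h, ⟨by positivity, (div_le_one hh').2 h2'⟩, ?_⟩
    ext i
    fin_cases i
    · simp [latticePoint]; field_simp; linarith
    · simp [latticePoint]; field_simp

/-- Each row of a half-open parallelogram contains `g` lattice points. -/
theorem ncard_rows (hh : 0 < h) (I : Set ℤ) :
    {z : Fin 2 → ℤ | z 1 ∈ I ∧ c * z 1 < h * z 0 ∧ h * z 0 ≤ c * z 1 + g * h}.ncard =
      I.ncard * g.toNat := by
  have e : g.toNat = (Set.Icc 1 g).ncard := by
    rw [ncard_Icc_int]; congr 1; ring
  rw [e, ← Set.ncard_prod]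
  -- Subtracting the floor of the left end turns the lattice points of each row into 1, …, g.
  refine Set.ncard_congr (fun z _ => (z 1, z 0 - c * z 1 / h)) ?_ ?_ ?_
  · rintro z ⟨h1, h2, h3⟩
    refine ⟨h1, ?_, ?_⟩
    · have : c * z 1 / h < z 0 := by rw [Int.ediv_lt_iff_lt_mul hh]; linarith
      change 1 ≤ z 0 - c * z 1 / h
      omega
    · have : z 0 - g ≤ c * z 1 / h := by rw [Int.le_ediv_iff_mul_le hh]; linarith
      change z 0 - c * z 1 / h ≤ g
      omega
  · intro z w _ _ hzw
    have h1 : z 1 = w 1 := congrArg Prod.fst hzw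
    have h2 : z 0 - c * z 1 / h = w 0 - c * w 1 / h := congrArg Prod.snd hzw
    rw [h1] at h2
    ext i
    fin_cases i
    · change z 0 = w 0; linarith
    · exact h1
  · rintro ⟨y, j⟩ ⟨hy, hj1, hjg⟩
    change 1 ≤ j at hj1
    change j ≤ g at hjg
    refine ⟨![j + c * y / h, y], ⟨hy, ?_, ?_⟩, ?_⟩
    · change c * y < h * (j + c * y / h)
      have := Int.lt_ediv_add_one_mul_self (c * y) hh
      nlinarith
    · change h * (j + c * y / h) ≤ c * y + g * h
      have := Int.ediv_mul_le (c * y) hh.ne'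
      nlinarith
    · simp

theorem latticePoint_mem_parallelogram (z : Fin 2 → ℤ) :
    latticePoint z ∈ parallelogram g c h ↔
      0 ≤ z 1 ∧ z 1 ≤ h ∧ c * z 1 ≤ h * z 0 ∧ h * z 0 ≤ c * z 1 + g * h := by
  rw [mem_parallelogram]
  simp only [latticePoint]
  exact_mod_cast Iff.rfl

theorem latticePoint_mem_interior_parallelogram (hh : 0 < h) (z : Fin 2 → ℤ) :
    latticePoint z ∈ interior (parallelogram g c h) ↔
      0 < z 1 ∧ z 1 < h ∧ c * z 1 < h * z 0 ∧ h * z 0 < c * z 1 + g * h := by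
  rw [interior_parallelogram hh]
  change _ ∧ _ ∧ _ ∧ _ ↔ _
  simp only [latticePoint]
  exact_mod_cast Iff.rfl

theorem isBounded_segment (x y : Fin 2 → ℝ) : Bornology.IsBounded (segment ℝ x y) := by
  rw [← convexHull_pair]
  exact ((Set.toFinite {x, y}).isCompact_convexHull (𝕜 := ℝ)).isBounded

/-- The rows at heights 0, …, h, open on the left, leave out exactly the left side. -/
theorem latticeCount_parallelogram (hg : 0 < g) (hh : 0 < h) :
    (latticeCount (parallelogram g c h) : ℤ) =
      g * (h + 1) + latticeCount (segment ℝ 0 (latticePoint ![c, h])) := by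
  have hfin := finite_latticePoints
    (isCompact_parallelogram (g := g) (c := c) (h := h) hg hh).isBounded
  have hrow := ncard_rows (g := g) (c := c) hh (Set.Icc 0 h)
  rw [ncard_Icc_int] at hrow
  have : latticeCount (parallelogram g c h) =
      {z : Fin 2 → ℤ | z 1 ∈ Set.Icc 0 h ∧ c * z 1 < h * z 0 ∧ h * z 0 ≤ c * z 1 + g * h}.ncard +
        latticeCount (segment ℝ 0 (latticePoint ![c, h])) := by
    unfold latticeCount
    rw [← Set.ncard_union_eq ?_ ?_ (finite_latticePoints (isBounded_segment _ _))]
    · congr 1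
      ext z
      change latticePoint z ∈ parallelogram g c h ↔ ((0 ≤ z 1 ∧ z 1 ≤ h) ∧ _ ∧ _) ∨
        latticePoint z ∈ segment ℝ 0 (latticePoint ![c, h])
      rw [latticePoint_mem_side hh, latticePoint_mem_parallelogram]
      constructor
      · rintro ⟨h1, h2, h3, h4⟩
        rcases h3.lt_or_eq with h3 | h3
        · exact Or.inl ⟨⟨h1, h2⟩, h3, h4⟩
        · exact Or.inr ⟨h1, h2, h3⟩
      · rintro (⟨⟨h1, h2⟩, h3, h4⟩ | ⟨h1, h2, h3⟩)
        · exact ⟨h1, h2, h3.le, h4⟩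
        · exact ⟨h1, h2, h3.le, by nlinarith⟩
    · rw [Set.disjoint_left]
      intro z hz hz'
      have := (latticePoint_mem_side hh z).1 hz'
      exact hz.2.1.ne this.2.2
    · refine hfin.subset fun z hz => ?_
      exact (latticePoint_mem_parallelogram z).2 ⟨hz.1.1, hz.1.2, hz.2.1.le, hz.2.2⟩
  rw [this, hrow]
  push_cast
  rw [Int.toNat_of_nonneg (by omega), Int.toNat_of_nonneg hg.le]
  ring

/-- The half-open rows at heights 1, …, h - 1 contain the interior points and those of the right
side without its endpoints. Translation by (g, 0) carries the left side to the right side, and the 2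
accounts for its endpoints. -/
theorem latticeCount_interior_parallelogram (hg : 0 < g) (hh : 0 < h) :
    (latticeCount (interior (parallelogram g c h)) : ℤ) +
      latticeCount (segment ℝ 0 (latticePoint ![c, h])) = g * (h - 1) + 2 := by
  have hfin := finite_latticePoints
    ((isCompact_parallelogram (g := g) (c := c) (h := h) hg hh).isBounded.subset interior_subset)
  have hseg := finite_latticePoints (isBounded_segment 0 (latticePoint ![c, h]))
  have hrow := ncard_rows (g := g) (c := c) hh (Set.Icc 1 (h - 1))
  rw [ncard_Icc_int] at hrow
  have hne : (0 : Fin 2 → ℤ) ≠ ![c, h] := fun h0 => hh.ne (congrFun h0 1)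
  have hside : latticeCount (segment ℝ 0 (latticePoint ![c, h])) =
      {z : Fin 2 → ℤ | 0 < z 1 ∧ z 1 < h ∧ c * z 1 = h * z 0}.ncard + 2 := by
    have h2 : 2 = ({0, ![c, h]} : Set (Fin 2 → ℤ)).ncard := (Set.ncard_pair hne).symm
    refine Eq.trans ?_ (congrArg (_ + ·) h2.symm)
    unfold latticeCount
    rw [← Set.ncard_union_eq ?_ (hseg.subset fun z hz =>
      (latticePoint_mem_side hh z).2 ⟨hz.1.le, hz.2.1.le, hz.2.2⟩) (Set.toFinite _)]
    · congr 1
      ext z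
      change latticePoint z ∈ segment ℝ 0 (latticePoint ![c, h]) ↔ (_ ∧ _ ∧ _) ∨ z = 0 ∨ z = ![c, h]
      rw [latticePoint_mem_side hh]
      constructor
      · rintro ⟨h1, h2, h3⟩
        rcases h1.eq_or_lt with h1 | h1
        · right; left
          ext i
          rw [← h1, mul_zero, zero_eq_mul] at h3
          fin_cases i
          · exact h3.resolve_left hh.ne'
          · exact h1.symm
        rcases h2.eq_or_lt with h2 | h2
        · right; right
          ext i
          rw [h2, mul_comm] at h3
          fin_cases i
          · exact (mul_left_cancel₀ hh.ne' h3).symm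
          · exact h2
        exact Or.inl ⟨h1, h2, h3⟩
      · rintro (⟨h1, h2, h3⟩ | rfl | rfl)
        · exact ⟨h1.le, h2.le, h3⟩
        · simp [hh.le]
        · simp [hh.le, mul_comm]
    · rw [Set.disjoint_left]
      rintro z hz (rfl | rfl)
      · exact lt_irrefl _ hz.1
      · exact lt_irrefl h hz.2.1
  have hshift : {z : Fin 2 → ℤ | 0 < z 1 ∧ z 1 < h ∧ c * z 1 = h * z 0}.ncard =
      {z : Fin 2 → ℤ | 0 < z 1 ∧ z 1 < h ∧ c * z 1 + g * h = h * z 0}.ncard := by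
    refine Set.ncard_congr (fun z _ => z + ![g, 0]) ?_ ?_ ?_
    · rintro z ⟨h1, h2, h3⟩
      refine ⟨by simpa using h1, by simpa using h2, ?_⟩
      simp
      linear_combination h3
    · intro z w _ _ hzw
      exact add_right_cancel hzw
    · rintro z ⟨h1, h2, h3⟩
      refine ⟨z - ![g, 0], ⟨by simpa using h1, by simpa using h2, ?_⟩, sub_add_cancel _ _⟩
      simp
      linear_combination h3
  have hsplit : {z : Fin 2 → ℤ | z 1 ∈ Set.Icc 1 (h - 1) ∧ c * z 1 < h * z 0 ∧
      h * z 0 ≤ c * z 1 + g * h}.ncard = latticeCount (interior (parallelogram g c h)) +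
        {z : Fin 2 → ℤ | 0 < z 1 ∧ z 1 < h ∧ c * z 1 + g * h = h * z 0}.ncard := by
    unfold latticeCount
    rw [← Set.ncard_union_eq ?_ hfin ?_]
    · congr 1
      ext z
      change ((1 ≤ z 1 ∧ z 1 ≤ h - 1) ∧ _ ∧ _) ↔ latticePoint z ∈ interior (parallelogram g c h) ∨
        (_ ∧ _ ∧ _)
      rw [latticePoint_mem_interior_parallelogram hh]
      constructor
      · rintro ⟨⟨h1, h2⟩, h3, h4⟩
        rcases h4.lt_or_eq with h4 | h4
        · exact Or.inl ⟨by omega, by omega, h3, h4⟩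
        · exact Or.inr ⟨by omega, by omega, h4.symm⟩
      · rintro (⟨h1, h2, h3, h4⟩ | ⟨h1, h2, h3⟩)
        · exact ⟨⟨by omega, by omega⟩, h3, h4.le⟩
        · refine ⟨⟨by omega, by omega⟩, ?_, h3.ge⟩
          rw [← h3]
          have := mul_pos hg hh
          linarith
    · rw [Set.disjoint_left]
      intro z hz hz'
      have := (latticePoint_mem_interior_parallelogram hh z).1 hz
      exact this.2.2.2.ne' hz'.2.2
    · refine (finite_latticePoints (isCompact_parallelogram (g := g) (c := c) (h := h) hg
        hh).isBounded).subset fun z hz => ?_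
      refine (latticePoint_mem_parallelogram z).2 ⟨hz.1.le, hz.2.1.le, ?_, hz.2.2.ge⟩
      have h3 := hz.2.2
      have := mul_pos hg hh
      linarith
  rw [hside, hshift]
  rw [hrow] at hsplit
  zify at hsplit
  rw [Int.toNat_of_nonneg (by omega), Int.toNat_of_nonneg hg.le] at hsplit
  push_cast
  linear_combination -hsplit

theorem smul_parallelogram {k : ℕ} (hk : 0 < k) :
    (k : ℝ) • parallelogram g c h = parallelogram (k * g) (k * c) (k * h) := by
  have hk' : (0 : ℝ) < k := by exact_mod_cast hk
  ext p
  rw [Set.mem_smul_set_iff_inv_smul_mem₀ hk'.ne', mem_parallelogram, mem_parallelogram]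
  simp only [Pi.smul_apply, smul_eq_mul]
  push_cast
  obtain ⟨q, rfl⟩ : ∃ q : Fin 2 → ℝ, p = (k : ℝ) • q := ⟨(k : ℝ)⁻¹ • p, by simp [hk'.ne']⟩
  simp only [Pi.smul_apply, smul_eq_mul, inv_mul_cancel_left₀ hk'.ne']
  have hk2 : (0 : ℝ) < k * k := by positivity
  rw [mul_nonneg_iff_of_pos_left hk', mul_le_mul_iff_right₀ hk',
    show (k : ℝ) * c * (k * q 1) = (k * k) * (c * q 1) by ring,
    show (k : ℝ) * h * (k * q 0) = (k * k) * (h * q 0) by ring,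
    show (k : ℝ) * k * (c * q 1) + k * g * (k * h) = (k * k) * (c * q 1 + g * h) by ring,
    mul_le_mul_iff_right₀ hk2, mul_le_mul_iff_right₀ hk2]

theorem ehrhartFormula_parallelogram (hg : 0 < g) (hh : 0 < h) :
    EhrhartFormula (parallelogram g c h) := by
  intro k
  have hne : (0 : Fin 2 → ℤ) ≠ ![c, h] := fun h0 => hh.ne (congrFun h0 1)
  have c1 := latticeCount_parallelogram (c := c) hg hh
  have ci := latticeCount_interior_parallelogram (c := c) hg hh
  have cv := volume_parallelogram (c := c) hg hh
  rcases Nat.eq_zero_or_pos k with rfl | hk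
  · have : (parallelogram g c h).Nonempty := ⟨0, by
      rw [mem_parallelogram]
      have hg' : (0 : ℝ) < g := by exact_mod_cast hg
      have hh' : (0 : ℝ) < h := by exact_mod_cast hh
      simp [hh'.le, mul_nonneg hg'.le hh'.le]⟩
    rw [Nat.cast_zero, latticeCount_zero_smul this]
    norm_num
  have hk' : (0 : ℤ) < k := by exact_mod_cast hk
  have ck := latticeCount_parallelogram (c := k * c) (mul_pos hk' hg) (mul_pos hk' hh)
  have cs := latticeCount_smul_segment hne k
  have e : k • ![c, h] = ![k * c, k * h] := by
    ext i; fin_cases i <;> simp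
  rw [latticePoint_zero, smul_segment, smul_zero, ← latticePoint_natCast_smul, e] at cs
  rw [smul_parallelogram hk, cv]
  rify at c1 ci ck
  linear_combination 2 * ck + 2 * cs - k * c1 + k * ci

end Parallelogram

theorem convexHull_triangle_eq {g c h : ℤ} (hg : 0 < g) (hh : 0 < h) :
    convexHull ℝ {0, latticePoint ![g, 0], latticePoint ![c, h]} =
      parallelogram g c h ∩ {p | linForm h (g - c) p ≤ g * h} := by
  have hg' : (0 : ℝ) < g := by exact_mod_cast hg
  have hh' : (0 : ℝ) < h := by exact_mod_cast hh
  have hgh : (0 : ℝ) < g * h := mul_pos hg' hh'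
  apply Set.Subset.antisymm
  · refine convexHull_min ?_ ((convex_parallelogram hg hh).inter
      (convex_halfSpace_le (linForm h (g - c)).isLinear _))
    rintro p (rfl | rfl | rfl)
    · exact ⟨by simp [mem_parallelogram, hh'.le, hgh.le], by simp [hgh.le]⟩
    · refine ⟨?_, ?_⟩
      · simp [mem_parallelogram, latticePoint, hh'.le]
        exact ⟨by nlinarith, by nlinarith⟩
      · change linForm _ _ _ ≤ _
        simp [linForm_apply, latticePoint]
        nlinarith
    · refine ⟨?_, ?_⟩
      · simp [mem_parallelogram, latticePoint, hh'.le]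
        exact ⟨by nlinarith, by nlinarith⟩
      · change linForm _ _ _ ≤ _
        simp [linForm_apply, latticePoint]
        nlinarith
  · rintro p ⟨⟨h1, h2, h3, h4⟩, h5⟩
    change linForm _ _ _ ≤ _ at h5
    rw [linForm_apply] at h5
    refine (convex_convexHull ℝ _).triple_mem
      (subset_convexHull ℝ _ (Set.mem_insert _ _))
      (subset_convexHull ℝ _ (Set.mem_insert_of_mem _ (Set.mem_insert _ _)))
      (subset_convexHull ℝ _ (Set.mem_insert_of_mem _ (Set.mem_insert_of_mem _ rfl)))
      -- The weights are the barycentric coordinates of p; the diagonal inequality says that the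
      -- first one is nonnegative.
      (1 - (h * p 0 - c * p 1) / (g * h) - p 1 / h) ((h * p 0 - c * p 1) / (g * h)) (p 1 / h)
      ?_ ?_ ?_ ?_ ?_ ?_
    · have : (h * p 0 - c * p 1) / (g * h) + p 1 / h ≤ 1 := by
        rw [div_add_div _ _ hgh.ne' hh'.ne', div_le_one (by positivity)]
        nlinarith
      linarith
    · exact div_nonneg (by linarith) hgh.le
    · positivity
    · ring
    · simp [latticePoint]; field_simp; ring
    · simp [latticePoint]; field_simp

/-- The triangle is one half of a parallelogram cut along its diagonal, and the reflection in the
centre of the parallelogram exchanges the halves. -/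
theorem ehrhartFormula_based_triangle {g c h : ℤ} (hg : 0 < g) (hh : 0 < h) :
    EhrhartFormula (convexHull ℝ {0, latticePoint ![g, 0], latticePoint ![c, h]}) := by
  have hg' : (0 : ℝ) < g := by exact_mod_cast hg
  have hh' : (0 : ℝ) < h := by exact_mod_cast hh
  have hgh : (0 : ℝ) < g * h := mul_pos hg' hh'
  rw [convexHull_triangle_eq hg hh]
  refine ehrhart_half (x := ![g, 0]) (y := ![c, h]) (convex_parallelogram hg hh)
    (isCompact_parallelogram hg hh) (Or.inl hh'.ne') ?_ ?_ ?_ ?_ ?_ ?_ ?_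
    (ehrhartFormula_parallelogram hg hh)
  · exact fun h0 => hh.ne (congrFun h0 1)
  · apply Set.Subset.antisymm
    · rintro p ⟨⟨h1, h2, h3, h4⟩, h5⟩
      change linForm _ _ _ = _ at h5
      rw [linForm_apply] at h5
      rw [segment_eq_image]
      refine ⟨p 1 / h, ⟨by positivity, (div_le_one hh').2 h2⟩, ?_⟩
      ext i
      fin_cases i
      · simp [latticePoint]; field_simp; linarith
      · simp [latticePoint]; field_simp
    · rw [segment_eq_image]
      rintro _ ⟨t, ⟨ht0, ht1⟩, rfl⟩
      refine ⟨?_, ?_⟩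
      · simp only [mem_parallelogram, latticePoint, Pi.add_apply, Pi.smul_apply, smul_eq_mul,
          Matrix.cons_val_zero, Matrix.cons_val_one, Int.cast_zero, mul_zero, zero_add]
        have e1 : 0 ≤ h * (1 - t) * (g : ℝ) := by
          have : 0 ≤ 1 - t := by linarith
          positivity
        have e2 : 0 ≤ h * t * (g : ℝ) := by positivity
        exact ⟨by positivity, by nlinarith, by nlinarith, by nlinarith⟩
      · change linForm _ _ _ = _
        simp [linForm_apply, latticePoint]
        ring
  · exact ⟨0, by simp [mem_parallelogram, hh'.le, hgh.le], by simp [linForm_apply, hgh]⟩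
  · refine ⟨latticePoint ![g + c, h], ?_, ?_⟩
    · simp [mem_parallelogram, latticePoint, hh'.le]
      exact ⟨by nlinarith, by nlinarith⟩
    · simp [linForm_apply, latticePoint]
      nlinarith
  · rw [interior_parallelogram hh]
    rintro ⟨h1, -⟩
    simp [latticePoint] at h1
  · rw [interior_parallelogram hh]
    rintro ⟨-, h1, -⟩
    simp [latticePoint] at h1
  · rw [latticeEquivalent_iff]
    refine ⟨unimodular (-1) 0 0 (-1) (by norm_num), ![g + c, h], ?_⟩
    have hmap : ∀ p : Fin 2 → ℝ, latticeMap (unimodular (-1) 0 0 (-1) (by norm_num)) ![g + c, h] p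
        = ![g + c - p 0, h - p 1] := by
      intro p
      rw [latticeMap_unimodular]
      ext i
      fin_cases i
      · simp; ring
      · simp; ring
    have key : ∀ p : Fin 2 → ℝ, (p ∈ parallelogram g c h ↔
        (![g + c - p 0, h - p 1] : Fin 2 → ℝ) ∈ parallelogram g c h) := by
      intro p
      simp only [mem_parallelogram, Matrix.cons_val_zero, Matrix.cons_val_one]
      constructor
      · rintro ⟨h1, h2, h3, h4⟩
        exact ⟨by linarith, by linarith, by nlinarith, by nlinarith⟩
      · rintro ⟨h1, h2, h3, h4⟩
        exact ⟨by linarith, by linarith, by nlinarith, by nlinarith⟩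
    ext p
    constructor
    · rintro ⟨hp, hp'⟩
      change _ ≤ linForm _ _ _ at hp'
      rw [linForm_apply] at hp'
      refine ⟨![g + c - p 0, h - p 1], ⟨(key p).1 hp, ?_⟩, ?_⟩
      · change linForm _ _ _ ≤ _
        simp [linForm_apply]
        linarith
      · rw [hmap]
        ext i
        fin_cases i <;> simp
    · rintro ⟨q, ⟨hq, hq'⟩, rfl⟩
      change linForm _ _ _ ≤ _ at hq'
      rw [linForm_apply] at hq'
      rw [hmap]
      refine ⟨(key q).1 hq, ?_⟩
      change _ ≤ linForm _ _ _
      simp [linForm_apply]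
      linarith

/-- A unimodular map sends x to the origin and y to the positive horizontal axis; the sign σ then
puts z above that axis. -/
theorem ehrhartFormula_triangle {x y z : Fin 2 → ℤ}
    (hdet : (y 0 - x 0) * (z 1 - x 1) - (y 1 - x 1) * (z 0 - x 0) ≠ 0) :
    EhrhartFormula (convexHull ℝ {latticePoint x, latticePoint y, latticePoint z}) := by
  have hne : y 0 - x 0 ≠ 0 ∨ y 1 - x 1 ≠ 0 := by
    by_contra! h
    rw [h.1, h.2] at hdet
    simp at hdet
  obtain ⟨g, a, b, c, d, hg, hd, h1, h2⟩ := exists_unimodular_eq_gcd _ _ hne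
  have hlast : c * (z 0 - x 0) + d * (z 1 - x 1) ≠ 0 := by
    intro h0
    apply hdet
    have e0 : y 0 - x 0 = d * g := by
      linear_combination -(y 0 - x 0) * hd + d * h1 - b * h2
    have e1 : y 1 - x 1 = -c * g := by
      linear_combination -(y 1 - x 1) * hd - c * h1 + a * h2
    rw [e0, e1]
    linear_combination g * h0
  obtain ⟨σ, hσ, hpos⟩ : ∃ σ : ℤ, IsUnit σ ∧ 0 < σ * (c * (z 0 - x 0) + d * (z 1 - x 1)) := by
    rcases lt_or_gt_of_ne hlast with h | h
    · exact ⟨-1, by simp, by linarith⟩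
    · exact ⟨1, by simp, by linarith⟩
  have hU : IsUnit (a * (σ * d) - b * (σ * c)) := by
    rw [show a * (σ * d) - b * (σ * c) = σ by linear_combination σ * hd]
    exact hσ
  rw [← ehrhartFormula_image_iff (unimodular a b (σ * c) (σ * d) hU)
    ![-(a * x 0 + b * x 1), -(σ * (c * x 0 + d * x 1))], latticeMap_image_convexHull,
    Set.image_insert_eq, Set.image_pair]
  convert ehrhartFormula_based_triangle (c := a * (z 0 - x 0) + b * (z 1 - x 1)) hg hpos using 3
  · rw [latticeMap_unimodular]
    ext i
    fin_cases i
    · simp [latticePoint]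
    · simp [latticePoint]; ring
  congr 1
  · rw [latticeMap_unimodular]
    rify at h1 h2
    ext i
    fin_cases i
    · simp [latticePoint]
      linear_combination h1
    · simp [latticePoint]
      linear_combination (σ : ℝ) * h2
  · rw [latticeMap_unimodular]
    congr 1
    ext i
    fin_cases i
    · simp [latticePoint]; ring
    · simp [latticePoint]; ring

/-! ### The Ehrhart formula for all lattice polygons -/

theorem IsLatticePolygon.finite_extremePoints {Q : Set (Fin 2 → ℝ)} (hQ : IsLatticePolygon Q) :
    (Q.extremePoints ℝ).Finite := by
  obtain ⟨S, hS, -, rfl⟩ := hQ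
  exact (hS.image _).subset extremePoints_convexHull_subset

theorem IsLatticePolygon.exists_of_mem_extremePoints {Q : Set (Fin 2 → ℝ)}
    (hQ : IsLatticePolygon Q) {p : Fin 2 → ℝ} (hp : p ∈ Q.extremePoints ℝ) :
    ∃ z, latticePoint z = p := by
  obtain ⟨S, hS, -, rfl⟩ := hQ
  obtain ⟨z, -, hz⟩ := extremePoints_convexHull_subset hp
  exact ⟨z, hz⟩

theorem IsLatticePolygon.convexHull_extremePoints {Q : Set (Fin 2 → ℝ)}
    (hQ : IsLatticePolygon Q) : convexHull ℝ (Q.extremePoints ℝ) = Q := by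
  have h := closure_convexHull_extremePoints hQ.isCompact hQ.convex
  rwa [(hQ.finite_extremePoints.isCompact_convexHull (𝕜 := ℝ)).isClosed.closure_eq] at h

theorem isLatticePolygon_convexHull {E : Set (Fin 2 → ℝ)} (hE : E.Finite) (hne : E.Nonempty)
    (h : ∀ p ∈ E, ∃ z, latticePoint z = p) : IsLatticePolygon (convexHull ℝ E) := by
  have himg : latticePoint '' (latticePoint ⁻¹' E) = E :=
    Set.image_preimage_eq_of_subset fun p hp => h p hp
  refine ⟨latticePoint ⁻¹' E, hE.preimage latticePoint_injective.injOn, ?_, ?_⟩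
  · obtain ⟨p, hp⟩ := hne
    obtain ⟨z, rfl⟩ := h p hp
    exact ⟨z, hp⟩
  · rw [latticeHull, himg]

theorem notMem_convexHull_of_mem_extremePoints {Q E : Set (Fin 2 → ℝ)} (hQ : Convex ℝ Q)
    {p : Fin 2 → ℝ} (hp : p ∈ Q.extremePoints ℝ) (hE : E ⊆ Q) (hpE : p ∉ E) :
    p ∉ convexHull ℝ E := by
  have h := (hQ.mem_extremePoints_iff_mem_sdiff_convexHull_sdiff.1 hp).2
  have hs : E ⊆ Q \ {p} := fun q hq => ⟨hE hq, fun hqp => hpE ((hqp : q = p) ▸ hq)⟩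
  exact fun hp' => h (convexHull_mono hs hp')

theorem exists_extremePoint_linForm_ne {Q : Set (Fin 2 → ℝ)} (hQ : IsLatticePolygon Q)
    (hint : (interior Q).Nonempty) {A B : ℝ} (hAB : A ≠ 0 ∨ B ≠ 0) (c : ℝ) :
    ∃ p ∈ Q.extremePoints ℝ, linForm A B p ≠ c := by
  by_contra! hcon
  have hsub : Q ⊆ {p | linForm A B p = c} := by
    rw [← hQ.convexHull_extremePoints]
    exact convexHull_min hcon (convex_hyperplane (linForm A B).isLinear c)
  obtain ⟨p, hp⟩ := hint
  obtain ⟨q, hq, hlt⟩ := exists_lt_linForm_of_mem_interior hp hAB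
  exact hlt.ne ((hsub (interior_subset hp) : _ = c).trans (hsub hq : _ = c).symm)

/-- A lattice polygon with nonempty interior has three vertices that are not collinear. -/
theorem IsLatticePolygon.exists_noncollinear_extremePoints {Q : Set (Fin 2 → ℝ)} (hQ : IsLatticePolygon Q)
    (hint : (interior Q).Nonempty) : ∃ x y z : Fin 2 → ℤ, latticePoint x ∈ Q.extremePoints ℝ ∧
      latticePoint y ∈ Q.extremePoints ℝ ∧ latticePoint z ∈ Q.extremePoints ℝ ∧
      (y 0 - x 0) * (z 1 - x 1) - (y 1 - x 1) * (z 0 - x 0) ≠ 0 := by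
  obtain ⟨X, hX⟩ : (Q.extremePoints ℝ).Nonempty := hQ.isCompact.extremePoints_nonempty hQ.nonempty
  obtain ⟨x, rfl⟩ := hQ.exists_of_mem_extremePoints hX
  obtain ⟨Y, hY, hYX⟩ := exists_extremePoint_linForm_ne hQ hint (A := 1) (B := 0) (by simp)
    (linForm 1 0 (latticePoint x))
  obtain ⟨y, rfl⟩ := hQ.exists_of_mem_extremePoints hY
  have hxy : y 0 - x 0 ≠ 0 := by
    intro h
    apply hYX
    have : y 0 = x 0 := by linarith
    simp [linForm_apply, latticePoint, this]
  obtain ⟨Z, hZ, hZX⟩ := exists_extremePoint_linForm_ne hQ hint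
    (A := -((y 1 : ℝ) - x 1)) (B := (y 0 : ℝ) - x 0) (by right; exact_mod_cast hxy)
    (linForm (-((y 1 : ℝ) - x 1)) ((y 0 : ℝ) - x 0) (latticePoint x))
  obtain ⟨z, rfl⟩ := hQ.exists_of_mem_extremePoints hZ
  refine ⟨x, y, z, hX, hY, hZ, ?_⟩
  intro h
  apply hZX
  rify at h
  simp only [linForm_apply, latticePoint]
  linarith

section Halves

variable {Q : Set (Fin 2 → ℝ)} {A B c : ℝ} {y z : Fin 2 → ℝ}

/-- A line through two vertices meets the polygon in the segment between them. -/
theorem inter_line_eq_segment (hQ : Convex ℝ Q) (hAB : A ≠ 0 ∨ B ≠ 0) (hyz : y ≠ z)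
    (hy : y ∈ Q.extremePoints ℝ) (hz : z ∈ Q.extremePoints ℝ) (hyc : linForm A B y = c)
    (hzc : linForm A B z = c) : Q ∩ {p | linForm A B p = c} = segment ℝ y z := by
  apply Set.Subset.antisymm
  · rintro p ⟨hp, hpc⟩
    change linForm A B p = c at hpc
    obtain ⟨t, ht⟩ : ∃ t : ℝ, p = (1 - t) • y + t • z := by
      rw [linForm_apply] at hyc hzc hpc
      have e1 : A * (z 0 - y 0) + B * (z 1 - y 1) = 0 := by linarith
      have e2 : A * (p 0 - y 0) + B * (p 1 - y 1) = 0 := by linarith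
      have hcross : (z 0 - y 0) * (p 1 - y 1) = (z 1 - y 1) * (p 0 - y 0) := by
        rcases hAB with h | h
        · apply mul_left_cancel₀ h
          linear_combination (p 1 - y 1) * e1 - (z 1 - y 1) * e2
        · apply mul_left_cancel₀ h
          linear_combination (z 0 - y 0) * e2 - (p 0 - y 0) * e1
      have hne : z 0 - y 0 ≠ 0 ∨ z 1 - y 1 ≠ 0 := by
        by_contra! hne
        apply hyz
        ext i
        fin_cases i
        · exact (sub_eq_zero.1 hne.1).symm
        · exact (sub_eq_zero.1 hne.2).symm
      rcases hne with hne | hne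
      · refine ⟨(p 0 - y 0) / (z 0 - y 0), ?_⟩
        ext i
        fin_cases i
        · simp; field_simp; ring
        · simp; field_simp; linarith
      · refine ⟨(p 1 - y 1) / (z 1 - y 1), ?_⟩
        ext i
        fin_cases i
        · simp; field_simp; linarith
        · simp; field_simp; ring
    -- A point beyond y would put the vertex y strictly between it and z; the case t > 1 is the same
    -- for z.
    by_cases h0 : t < 0
    · exfalso
      have hmem : y ∈ openSegment ℝ p z := by
        refine ⟨1 / (1 - t), -t / (1 - t), by apply div_pos <;> linarith,
          by apply div_pos <;> linarith, ?_, ?_⟩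
        · rw [← add_div]; exact div_self (by linarith)
        · have h1 : 1 - t ≠ 0 := by linarith
          rw [ht]
          ext i
          simp
          field_simp
          ring
      exact hyz ((mem_extremePoints_iff_left.1 hy).2 z hz.1 p hp
        (by rwa [openSegment_symm])).symm
    by_cases h1 : 1 < t
    · exfalso
      have hmem : z ∈ openSegment ℝ p y := by
        refine ⟨1 / t, (t - 1) / t, by positivity, by apply div_pos <;> linarith, ?_, ?_⟩
        · rw [← add_div]
          rw [div_eq_one_iff_eq (by linarith)]
          ring
        · have h1 : t ≠ 0 := by linarith
          rw [ht]
          ext i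
          simp
          field_simp
          ring
      exact hyz ((mem_extremePoints_iff_left.1 hz).2 y hy.1 p hp
        (by rwa [openSegment_symm]))
    exact ⟨1 - t, t, by linarith, by linarith, by ring, ht.symm⟩
  · intro p hp
    refine ⟨hQ.segment_subset hy.1 hz.1 hp, ?_⟩
    obtain ⟨s, t, -, -, hst, rfl⟩ := hp
    change linForm A B _ = c
    rw [map_add, map_smul, map_smul, hyc, hzc, smul_eq_mul, smul_eq_mul, ← add_mul, hst, one_mul]

/-- A point of Q lies on a segment from the hull of the near vertices to the hull of the far ones.
That segment leaves the half-plane at a point of the chord from y to z, whose ends count as near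
vertices. -/
theorem half_eq_convexHull (hQ : IsLatticePolygon Q)
    (hseg : Q ∩ {p | linForm A B p = c} = segment ℝ y z)
    (hy : y ∈ Q.extremePoints ℝ) (hz : z ∈ Q.extremePoints ℝ) (hyc : linForm A B y = c)
    (hzc : linForm A B z = c) : Q ∩ {p | linForm A B p ≤ c} =
      convexHull ℝ (Q.extremePoints ℝ ∩ {p | linForm A B p ≤ c}) := by
  apply Set.Subset.antisymm
  · rintro q ⟨hq, hqc⟩
    change linForm A B q ≤ c at hqc
    set S := Q.extremePoints ℝ ∩ {p | linForm A B p ≤ c} with hS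
    set T := Q.extremePoints ℝ ∩ {p | c ≤ linForm A B p} with hT
    have hunion : Q.extremePoints ℝ = S ∪ T := by
      rw [hS, hT, ← Set.inter_union_distrib_left]
      exact (Set.inter_eq_left.2 fun p _ => le_total (linForm A B p) c).symm
    have hyS : y ∈ convexHull ℝ S := subset_convexHull ℝ _ ⟨hy, hyc.le⟩
    have hzS : z ∈ convexHull ℝ S := subset_convexHull ℝ _ ⟨hz, hzc.le⟩
    have hTc : convexHull ℝ T ⊆ Q ∩ {p | c ≤ linForm A B p} := by
      refine convexHull_min (fun p hp => ⟨hp.1.1, hp.2⟩)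
        (hQ.convex.inter (convex_halfSpace_ge (linForm A B).isLinear c))
    have hSc : convexHull ℝ S ⊆ Q ∩ {p | linForm A B p ≤ c} := by
      refine convexHull_min (fun p hp => ⟨hp.1.1, hp.2⟩)
        (hQ.convex.inter (convex_halfSpace_le (linForm A B).isLinear c))
    rw [← hQ.convexHull_extremePoints, hunion,
      convexHull_union (show S.Nonempty from ⟨y, hy, hyc.le⟩)
        (show T.Nonempty from ⟨y, hy, hyc.ge⟩), mem_convexJoin] at hq
    obtain ⟨u, hu, v, hv, hq⟩ := hq
    rw [segment_eq_image] at hq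
    obtain ⟨t, ⟨ht0, ht1⟩, rfl⟩ := hq
    have hu2 : linForm A B u ≤ c := (hSc hu).2
    have hv2 : c ≤ linForm A B v := (hTc hv).2
    have hline : ∀ r ∈ Q, linForm A B r = c → r ∈ convexHull ℝ S := by
      intro r hr hrc
      have : r ∈ segment ℝ y z := hseg ▸ ⟨hr, hrc⟩
      exact (convex_convexHull ℝ S).segment_subset hyS hzS this
    rcases hv2.eq_or_lt with hv2 | hv2
    · exact (convex_convexHull ℝ S) hu (hline v (hTc hv).1 hv2.symm) (by linarith) ht0 (by ring)
    · simp only [map_add, map_smul, smul_eq_mul] at hqc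
      have hd : 0 < linForm A B v - linForm A B u := by linarith
      -- The segment from u to v crosses the line at parameter s, and the given point precedes the
      -- crossing.
      set s := (c - linForm A B u) / (linForm A B v - linForm A B u) with hs
      have hsd : s * (linForm A B v - linForm A B u) = c - linForm A B u :=
        div_mul_cancel₀ _ hd.ne'
      have hts : t ≤ s := by
        rw [hs, le_div_iff₀ hd]
        linarith
      have hs1 : s ≤ 1 := by
        rw [hs, div_le_one hd]
        linarith
      rcases (ht0.trans hts).eq_or_lt with hs0 | hs0
      · have : t = 0 := by linarith
        simpa [this] using hu
      have hr : (1 - s) • u + s • v ∈ convexHull ℝ S := by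
        refine hline _ (hQ.convex (hSc hu).1 (hTc hv).1 (by linarith) hs0.le (by ring)) ?_
        simp only [map_add, map_smul, smul_eq_mul]
        linarith
      convert (convex_convexHull ℝ S) hu hr (a := 1 - t / s) (b := t / s)
        (by rw [sub_nonneg, div_le_one hs0]; exact hts) (by positivity) (by ring) using 1
      ext i
      simp
      field_simp
      ring
  · refine convexHull_min (fun p hp => ⟨hp.1.1, hp.2⟩)
      (hQ.convex.inter (convex_halfSpace_le (linForm A B).isLinear c))

/-- All vertices of the half are vertices of Q, and the one strictly beyond the line is lost; this
drives the induction on the number of vertices. -/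
theorem half_lattice_polygon (hQ : IsLatticePolygon Q) (hint : (interior Q).Nonempty)
    (hAB : A ≠ 0 ∨ B ≠ 0) (hyz : y ≠ z)
    (hy : y ∈ Q.extremePoints ℝ) (hz : z ∈ Q.extremePoints ℝ) (hyc : linForm A B y = c)
    (hzc : linForm A B z = c) (hlo : ∃ p ∈ Q, linForm A B p < c)
    (hhi : ∃ p ∈ Q.extremePoints ℝ, c < linForm A B p) :
    IsLatticePolygon (Q ∩ {p | linForm A B p ≤ c}) ∧
      (interior (Q ∩ {p | linForm A B p ≤ c})).Nonempty ∧
      ((Q ∩ {p | linForm A B p ≤ c}).extremePoints ℝ).ncard < (Q.extremePoints ℝ).ncard := by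
  have hhalf := half_eq_convexHull hQ (inter_line_eq_segment hQ.convex hAB hyz hy hz hyc hzc)
    hy hz hyc hzc
  refine ⟨?_, ?_, ?_⟩
  · rw [hhalf]
    exact isLatticePolygon_convexHull (hQ.finite_extremePoints.subset Set.inter_subset_left)
      ⟨y, hy, hyc.le⟩ fun p hp => hQ.exists_of_mem_extremePoints hp.1
  · rw [interior_inter, interior_linForm_le hAB]
    obtain ⟨p, hp, hpc⟩ := hlo
    have hcl : p ∈ closure (interior Q) := by
      rw [hQ.convex.closure_interior_eq_closure_of_nonempty_interior hint]
      exact subset_closure hp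
    obtain ⟨q, hq, hq'⟩ := mem_closure_iff.1 hcl {p | linForm A B p < c}
      (isOpen_lt (linForm A B).continuous continuous_const) hpc
    exact ⟨q, hq', hq⟩
  · obtain ⟨p, hp, hpc⟩ := hhi
    rw [hhalf]
    refine Set.ncard_lt_ncard ⟨extremePoints_convexHull_subset.trans Set.inter_subset_left, ?_⟩
      hQ.finite_extremePoints
    intro hsub
    have hp2 : linForm A B p ≤ c := (extremePoints_convexHull_subset (hsub hp)).2
    exact absurd hpc (not_lt.2 hp2)

end Halves

theorem notMem_interior_of_mem_extremePoints {Q : Set (Fin 2 → ℝ)} {p : Fin 2 → ℝ}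
    (hp : p ∈ Q.extremePoints ℝ) : p ∉ interior Q := by
  intro h
  obtain ⟨ε, hε, hball⟩ := Metric.mem_nhds_iff.1 (mem_interior_iff_mem_nhds.1 h)
  have hv : ∀ s : ℝ, |s| < ε → p + (fun _ => s) ∈ Q := by
    intro s hs
    apply hball
    rw [mem_ball_iff_norm, add_sub_cancel_left, pi_norm_lt_iff hε]
    exact fun _ => hs
  have h1 := (mem_extremePoints_iff_left.1 hp).2 _
    (hv (ε / 2) (by rw [abs_of_pos (by linarith)]; linarith)) _
    (hv (-(ε / 2)) (by rw [abs_neg, abs_of_pos (by linarith)]; linarith))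
    ⟨1 / 2, 1 / 2, by norm_num, by norm_num, by norm_num, by ext i; simp; ring⟩
  have h2 := congrFun h1 0
  simp at h2
  linarith

/-- A polygon with more than three vertices has a diagonal with vertices strictly on both sides.
Cutting along it gives two polygons with fewer vertices, which are glued by `ehrhart_glue`. -/
theorem ehrhartFormula_of_interior_nonempty {Q : Set (Fin 2 → ℝ)} (hQ : IsLatticePolygon Q)
    (hint : (interior Q).Nonempty) : EhrhartFormula Q := by
  induction hn : (Q.extremePoints ℝ).ncard using Nat.strong_induction_on generalizing Q with
  | _ n ih =>
  subst hn
  have step : ∀ y z v w : Fin 2 → ℤ, ∀ A B c : ℝ, latticePoint y ∈ Q.extremePoints ℝ →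
      latticePoint z ∈ Q.extremePoints ℝ → latticePoint v ∈ Q.extremePoints ℝ →
      latticePoint w ∈ Q.extremePoints ℝ → (A ≠ 0 ∨ B ≠ 0) → y ≠ z →
      linForm A B (latticePoint y) = c → linForm A B (latticePoint z) = c →
      linForm A B (latticePoint v) < c → c < linForm A B (latticePoint w) →
      EhrhartFormula Q := by
    intro y z v w A B c hy hz hv hw hAB hyz hyc hzc hvc hwc
    have hyz' : latticePoint y ≠ latticePoint z := fun h => hyz (latticePoint_injective h)
    have hneg : ∀ p, linForm (-A) (-B) p = - linForm A B p := fun p => by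
      simp only [linForm_apply]; ring
    have hset : {p | c ≤ linForm A B p} = {p | linForm (-A) (-B) p ≤ -c} := by
      ext p
      change c ≤ _ ↔ linForm (-A) (-B) p ≤ -c
      rw [hneg, neg_le_neg_iff]
    obtain ⟨l1, l2, l3⟩ := half_lattice_polygon hQ hint hAB hyz' hy hz hyc hzc ⟨_, hv.1, hvc⟩
      ⟨_, hw, hwc⟩
    obtain ⟨r1, r2, r3⟩ := half_lattice_polygon (A := -A) (B := -B) (c := -c) hQ hint
      (by simpa using hAB) hyz' hy hz (by rw [hneg, hyc]) (by rw [hneg, hzc])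
      ⟨_, hw.1, by rw [hneg]; linarith⟩ ⟨_, hv, by rw [hneg]; linarith⟩
    refine ehrhart_glue hQ.convex hQ.isCompact hAB hyz
      (inter_line_eq_segment hQ.convex hAB hyz' hy hz hyc hzc) ⟨_, hv.1, hvc⟩ ⟨_, hw.1, hwc⟩
      (notMem_interior_of_mem_extremePoints hy) (notMem_interior_of_mem_extremePoints hz)
      (ih _ l3 l1 l2 rfl) ?_
    rw [hset]
    exact ih _ r3 r1 r2 rfl
  obtain ⟨x, y, z, hX, hY, hZ, hD⟩ := hQ.exists_noncollinear_extremePoints hint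
  by_cases hall : Q.extremePoints ℝ ⊆ {latticePoint x, latticePoint y, latticePoint z}
  · have h3 : Q.extremePoints ℝ = {latticePoint x, latticePoint y, latticePoint z} := by
      refine Set.Subset.antisymm hall ?_
      rintro p (rfl | rfl | rfl) <;> assumption
    rw [← hQ.convexHull_extremePoints, h3]
    exact ehrhartFormula_triangle hD
  obtain ⟨W, hW, hWn⟩ := Set.not_subset.1 hall
  obtain ⟨w, rfl⟩ := hQ.exists_of_mem_extremePoints hW
  have hnot : latticePoint w ∉ convexHull ℝ {latticePoint x, latticePoint y, latticePoint z} := by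
    refine notMem_convexHull_of_mem_extremePoints hQ.convex hW ?_ hWn
    rintro p (rfl | rfl | rfl)
    exacts [hX.1, hY.1, hZ.1]
  -- the oriented line form through two points
  have line : ∀ u v p q : Fin 2 → ℤ, latticePoint u ∈ Q.extremePoints ℝ →
      latticePoint v ∈ Q.extremePoints ℝ → latticePoint p ∈ Q.extremePoints ℝ →
      latticePoint q ∈ Q.extremePoints ℝ →
      (((v 0 - u 0) * (p 1 - u 1) - (v 1 - u 1) * (p 0 - u 0)) *
        ((v 0 - u 0) * (q 1 - u 1) - (v 1 - u 1) * (q 0 - u 0)) < 0) → EhrhartFormula Q := by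
    intro u v p q hu hv hp hq hneg
    have hAB : (-((v 1 : ℝ) - u 1)) ≠ 0 ∨ ((v 0 : ℝ) - u 0) ≠ 0 := by
      by_contra! h
      have e1 : v 1 - u 1 = 0 := by
        have := neg_eq_zero.1 h.1
        exact_mod_cast this
      have e2 : v 0 - u 0 = 0 := by exact_mod_cast h.2
      rw [e1, e2] at hneg
      simp at hneg
    have huv : u ≠ v := by
      rintro rfl
      simp at hneg
    rify at hneg
    rcases mul_neg_iff.1 hneg with h | h
    · refine step u v q p (-((v 1 : ℝ) - u 1)) ((v 0 : ℝ) - u 0)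
        (-((v 1 : ℝ) - u 1) * u 0 + ((v 0 : ℝ) - u 0) * u 1) hu hv hq hp hAB huv ?_ ?_ ?_ ?_
      all_goals simp only [linForm_apply, latticePoint]
      all_goals linarith [h.1, h.2]
    · refine step u v p q (-((v 1 : ℝ) - u 1)) ((v 0 : ℝ) - u 0)
        (-((v 1 : ℝ) - u 1) * u 0 + ((v 0 : ℝ) - u 0) * u 1) hu hv hp hq hAB huv ?_ ?_ ?_ ?_
      all_goals simp only [linForm_apply, latticePoint]
      all_goals linarith [h.1, h.2]
  by_contra hcon
  -- If no side of the triangle xyz separates w strictly from the opposite vertex, all barycentric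
  -- coordinates of w are nonnegative. Then w lies in the triangle, which is impossible for a
  -- further vertex.
  have n1 := not_lt.1 fun h => hcon (line y z x w hY hZ hX hW h)
  have n2 := not_lt.1 fun h => hcon (line z x y w hZ hX hY hW h)
  have n3 := not_lt.1 fun h => hcon (line x y z w hX hY hZ hW h)
  apply hnot
  have hD' : ((y 0 : ℝ) - x 0) * (z 1 - x 1) - (y 1 - x 1) * (z 0 - x 0) ≠ 0 := by
    exact_mod_cast hD
  have hD2 := mul_self_pos.2 hD'
  rify at n1 n2 n3
  set D := ((y 0 : ℝ) - x 0) * (z 1 - x 1) - (y 1 - x 1) * (z 0 - x 0) with hDdef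
  have m1 : ((z 0 : ℝ) - y 0) * (x 1 - y 1) - (z 1 - y 1) * (x 0 - y 0) = D := by
    rw [hDdef]; ring
  have m2 : ((x 0 : ℝ) - z 0) * (y 1 - z 1) - (x 1 - z 1) * (y 0 - z 0) = D := by
    rw [hDdef]; ring
  rw [m1] at n1
  rw [m2] at n2
  refine (convex_convexHull ℝ _).triple_mem
    (subset_convexHull ℝ _ (Set.mem_insert _ _))
    (subset_convexHull ℝ _ (Set.mem_insert_of_mem _ (Set.mem_insert _ _)))
    (subset_convexHull ℝ _ (Set.mem_insert_of_mem _ (Set.mem_insert_of_mem _ rfl)))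
    (D * (((z 0 : ℝ) - y 0) * (w 1 - y 1) - (z 1 - y 1) * (w 0 - y 0)) / (D * D))
    (D * (((x 0 : ℝ) - z 0) * (w 1 - z 1) - (x 1 - z 1) * (w 0 - z 0)) / (D * D))
    (D * (((y 0 : ℝ) - x 0) * (w 1 - x 1) - (y 1 - x 1) * (w 0 - x 0)) / (D * D))
    (by positivity) (by positivity) (by positivity) ?_ ?_ ?_
  · rw [← add_div, ← add_div, div_eq_one_iff_eq hD2.ne', hDdef]
    ring
  · simp only [latticePoint]
    rw [mul_div_mul_left _ _ hD', mul_div_mul_left _ _ hD', mul_div_mul_left _ _ hD']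
    field_simp
    rw [hDdef]; ring
  · simp only [latticePoint]
    rw [mul_div_mul_left _ _ hD', mul_div_mul_left _ _ hD', mul_div_mul_left _ _ hD']
    field_simp
    rw [hDdef]; ring

/-! ### Lattice hulls of explicit lists of points -/

theorem latticePoint_mk (x y : ℤ) : latticePoint ![x, y] = ![(x : ℝ), (y : ℝ)] := by
  ext i; fin_cases i <;> rfl

theorem latticePoint_eq_mk (z : Fin 2 → ℤ) : latticePoint z = ![(z 0 : ℝ), (z 1 : ℝ)] := by
  ext i; fin_cases i <;> rfl

theorem IsLatticePolygon.eq_latticeHull {Q : Set (Fin 2 → ℝ)} (hQ : IsLatticePolygon Q) :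
    Q = latticeHull {z | latticePoint z ∈ Q} := by
  apply Set.Subset.antisymm
  · obtain ⟨S, -, -, rfl⟩ := hQ
    exact convexHull_mono (Set.image_mono fun z hz => subset_convexHull ℝ _ ⟨z, hz, rfl⟩)
  · refine convexHull_min ?_ hQ.convex
    rintro _ ⟨z, hz, rfl⟩
    exact hz

/-- The lattice hull of a list of points. -/
def hullList (l : List (ℤ × ℤ)) : Set (Fin 2 → ℝ) := latticeHull {z | (z 0, z 1) ∈ l}

theorem mem_hullList_of_mem {l : List (ℤ × ℤ)} {x y : ℤ} (h : (x, y) ∈ l) :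
    ![(x : ℝ), (y : ℝ)] ∈ hullList l :=
  subset_convexHull ℝ _ ⟨![x, y], h, latticePoint_mk x y⟩

theorem IsLatticePolygon.eq_hullList {Q : Set (Fin 2 → ℝ)} (hQ : IsLatticePolygon Q)
    {l : List (ℤ × ℤ)} (h : ∀ x y : ℤ, ![(x : ℝ), (y : ℝ)] ∈ Q ↔ (x, y) ∈ l) :
    Q = hullList l := by
  rw [hQ.eq_latticeHull, hullList]
  congr 1
  ext z
  change latticePoint z ∈ Q ↔ (z 0, z 1) ∈ l
  rw [latticePoint_eq_mk, h]

/-- Whether the integral affine map with the given coefficients sends `S` into `T` and every point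
of `T` lies on a segment between two points of the image, at a multiple of one twelfth of it. -/
def coverCheck (a b c d s t : ℤ) (S T : List (ℤ × ℤ)) : Bool :=
  S.all (fun p => T.contains (a * p.1 + b * p.2 + s, c * p.1 + d * p.2 + t)) &&
  -- Twelve is a common multiple of 1, 2, 3, 4: on a lattice segment of lattice length at most 4
  -- every lattice point sits at a multiple of one twelfth.
  T.all fun z => S.any fun u => S.any fun v => (List.range 13).any fun j =>
    (12 * z.1 == j * (a * u.1 + b * u.2 + s) + (12 - j) * (a * v.1 + b * v.2 + s)) &&
    (12 * z.2 == j * (c * u.1 + d * u.2 + t) + (12 - j) * (c * v.1 + d * v.2 + t))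

theorem latticeEquivalent_hullList {a b c d s t : ℤ} {S T : List (ℤ × ℤ)}
    (hdet : IsUnit (a * d - b * c)) (h : coverCheck a b c d s t S T = true) :
    LatticeEquivalent (hullList T) (hullList S) := by
  rw [latticeEquivalent_iff]
  refine ⟨unimodular a b c d hdet, ![s, t], ?_⟩
  have himg : ∀ x y : ℤ, latticeMap (unimodular a b c d hdet) ![s, t] ![(x : ℝ), (y : ℝ)] =
      latticePoint ![a * x + b * y + s, c * x + d * y + t] := by
    intro x y
    rw [latticeMap_unimodular, latticePoint_mk]
    ext i; fin_cases i <;> simp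
  simp only [coverCheck, Bool.and_eq_true, List.all_eq_true, List.any_eq_true, beq_iff_eq,
    List.contains_iff_mem, List.mem_range] at h
  obtain ⟨h1, h2⟩ := h
  apply Set.Subset.antisymm
  · have hconv : Convex ℝ (latticeMap (unimodular a b c d hdet) ![s, t] '' hullList S) := by
      rw [hullList, latticeHull, latticeMap_image_convexHull]
      exact convex_convexHull ℝ _
    refine convexHull_min ?_ hconv
    rintro _ ⟨z, hz, rfl⟩
    obtain ⟨u, hu, v, hv, j, hj, e0, e1⟩ := h2 (z 0, z 1) hz
    have hu' := Set.mem_image_of_mem (latticeMap (unimodular a b c d hdet) ![s, t])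
      (mem_hullList_of_mem (x := u.1) (y := u.2) hu)
    have hv' := Set.mem_image_of_mem (latticeMap (unimodular a b c d hdet) ![s, t])
      (mem_hullList_of_mem (x := v.1) (y := v.2) hv)
    rw [himg] at hu' hv'
    have hj' : (j : ℝ) ≤ 12 := by
      have : j ≤ 12 := by omega
      exact_mod_cast this
    rify at e0 e1
    refine hconv.triple_mem hu' hv' hv' (j / 12) ((12 - j) / 12) 0 (by positivity)
      (div_nonneg (by linarith) (by norm_num)) le_rfl (by ring) ?_ ?_
    · simp [latticePoint]
      linarith
    · simp [latticePoint]
      linarith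
  · rw [hullList, latticeHull, latticeMap_image_convexHull]
    refine convexHull_min ?_ (convex_convexHull ℝ _)
    rintro _ ⟨_, ⟨z, hz, rfl⟩, rfl⟩
    rw [latticePoint_eq_mk, himg, latticePoint_mk]
    exact mem_hullList_of_mem (h1 (z 0, z 1) hz)

theorem doubleTriangle_eq : doubleTriangle = hullList [(0, 0), (2, 0), (0, 1)] := by
  rw [doubleTriangle, hullList]
  congr 1
  ext z
  simp [funext_iff, Set.mem_insert_iff]

theorem standardSquare_eq : standardSquare = hullList [(0, 0), (1, 0), (0, 1), (1, 1)] := by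
  rw [standardSquare, hullList]
  congr 1
  ext z
  simp [funext_iff, Set.mem_insert_iff]

/-! ### Unimodular triangles in lattice polygons -/

theorem mem_image_latticeMap {Q : Set (Fin 2 → ℝ)} {a b c d : ℤ} {t : Fin 2 → ℤ}
    (h : IsUnit (a * d - b * c)) {x y x' y' : ℝ} (hxy : ![x, y] ∈ Q)
    (h0 : x' = a * x + b * y + t 0) (h1 : y' = c * x + d * y + t 1) :
    ![x', y'] ∈ latticeMap (unimodular a b c d h) t '' Q := by
  refine ⟨_, hxy, ?_⟩
  rw [latticeMap_unimodular, h0, h1]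
  simp

theorem exists_of_mem_image_latticeMap {Q : Set (Fin 2 → ℝ)} {a b c d : ℤ} {t : Fin 2 → ℤ}
    (h : IsUnit (a * d - b * c)) {x' y' : ℝ}
    (hxy : ![x', y'] ∈ latticeMap (unimodular a b c d h) t '' Q) :
    ∃ x y : ℝ, ![x, y] ∈ Q ∧ x' = a * x + b * y + t 0 ∧ y' = c * x + d * y + t 1 := by
  obtain ⟨p, hp, hpe⟩ := hxy
  rw [latticeMap_unimodular] at hpe
  refine ⟨p 0, p 1, ?_, (congrFun hpe 0).symm, (congrFun hpe 1).symm⟩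
  convert hp
  ext i; fin_cases i <;> rfl

/-- At height σ the triangle with vertices (0, 0), (1, 0), (x, σy) has the section from x / y to (x
+ y - 1) / y. Among the y consecutive numerators one is divisible by y, so the section contains an
integer. -/
theorem exists_height_one {Q : Set (Fin 2 → ℝ)} (hQ : Convex ℝ Q) (h0 : ![0, 0] ∈ Q)
    (h1 : ![1, 0] ∈ Q) {x y : ℤ} (hy : 0 < y) (σ : ℝ) (hxy : ![(x : ℝ), σ * y] ∈ Q) :
    ∃ c : ℤ, ![(c : ℝ), σ] ∈ Q ∧ x ≤ c * y ∧ c * y ≤ x + y - 1 := by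
  have e1 := Int.lt_ediv_add_one_mul_self (x + y - 1) hy
  have e2 := Int.ediv_mul_le (x + y - 1) hy.ne'
  set c := (x + y - 1) / y
  have e1' : x ≤ c * y := by linarith
  refine ⟨c, ?_, e1', e2⟩
  have hy' : (0 : ℝ) < y := by exact_mod_cast hy
  rify at e1' e2
  refine hQ.triple_mem h0 h1 hxy ((x + y - 1 - c * y) / y) ((c * y - x) / y) (1 / y)
    (div_nonneg (by linarith) hy'.le) (div_nonneg (by linarith) hy'.le) (by positivity) ?_ ?_ ?_
  · field_simp; ring
  · simp; field_simp; ring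
  · simp; field_simp

theorem exists_width_one {Q : Set (Fin 2 → ℝ)} (hQ : Convex ℝ Q) (h0 : ![0, 0] ∈ Q)
    (h1 : ![0, 1] ∈ Q) {x y : ℤ} (hx : 0 < x) (σ : ℝ) (hxy : ![σ * x, (y : ℝ)] ∈ Q) :
    ∃ c : ℤ, ![σ, (c : ℝ)] ∈ Q ∧ y ≤ c * x ∧ c * x ≤ y + x - 1 := by
  have e1 := Int.lt_ediv_add_one_mul_self (y + x - 1) hx
  have e2 := Int.ediv_mul_le (y + x - 1) hx.ne'
  set c := (y + x - 1) / x
  have e1' : y ≤ c * x := by linarith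
  refine ⟨c, ?_, e1', e2⟩
  have hx' : (0 : ℝ) < x := by exact_mod_cast hx
  rify at e1' e2
  refine hQ.triple_mem h0 h1 hxy ((y + x - 1 - c * x) / x) ((c * x - y) / x) (1 / x)
    (div_nonneg (by linarith) hx'.le) (div_nonneg (by linarith) hx'.le) (by positivity) ?_ ?_ ?_
  · field_simp; ring
  · simp; field_simp
  · simp; field_simp; ring

theorem latticeMap_image_comp (U W : Matrix.GeneralLinearGroup (Fin 2) ℤ)
    (Q : Set (Fin 2 → ℝ)) :
    latticeMap U 0 '' (latticeMap W 0 '' Q) = latticeMap (U * W) 0 '' Q := by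
  rw [Set.image_image]
  simp_rw [latticeMap_comp, Matrix.mulVec_zero, add_zero]

theorem latticeMap_zero_right (U : Matrix.GeneralLinearGroup (Fin 2) ℤ) :
    latticeMap U 0 0 = 0 := by
  ext i
  simp [latticeMap_apply]

/-- The first vector is moved to (g, 0), so that (1, 0) lies in the image by convexity. The second
is moved to positive height, which yields a lattice point at height one, and a shear carries that
point to (0, 1). -/
theorem exists_unimodular_basis {Q : Set (Fin 2 → ℝ)} (hQ : Convex ℝ Q) (h0 : ![0, 0] ∈ Q)
    {u₀ u₁ v₀ v₁ : ℤ} (hu : ![(u₀ : ℝ), (u₁ : ℝ)] ∈ Q) (hv : ![(v₀ : ℝ), (v₁ : ℝ)] ∈ Q)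
    (hdet : u₀ * v₁ - u₁ * v₀ ≠ 0) :
    ∃ U, ![1, 0] ∈ latticeMap U 0 '' Q ∧ ![0, 1] ∈ latticeMap U 0 '' Q := by
  have hne : u₀ ≠ 0 ∨ u₁ ≠ 0 := by
    by_contra! h
    rw [h.1, h.2] at hdet
    simp at hdet
  obtain ⟨g, a, b, c, d, hg, hd, e1, e2⟩ := exists_unimodular_eq_gcd _ _ hne
  have hlast : c * v₀ + d * v₁ ≠ 0 := by
    intro h
    apply hdet
    have f0 : u₀ = d * g := by linear_combination -u₀ * hd + d * e1 - b * e2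
    have f1 : u₁ = -c * g := by linear_combination -u₁ * hd - c * e1 + a * e2
    rw [f0, f1]
    linear_combination g * h
  obtain ⟨σ, hσ, hpos⟩ : ∃ σ : ℤ, IsUnit σ ∧ 0 < σ * (c * v₀ + d * v₁) := by
    rcases lt_or_gt_of_ne hlast with h | h
    · exact ⟨-1, by simp, by linarith⟩
    · exact ⟨1, by simp, by linarith⟩
  have hU : IsUnit (a * (σ * d) - b * (σ * c)) := by
    rw [show a * (σ * d) - b * (σ * c) = σ by linear_combination σ * hd]
    exact hσ
  set W := unimodular a b (σ * c) (σ * d) hU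
  have hg' : (0 : ℝ) < g := by exact_mod_cast hg
  have hQ' : Convex ℝ (latticeMap W 0 '' Q) := by
    have : latticeMap W 0 '' Q = latticeMap W 0 '' convexHull ℝ Q := by rw [hQ.convexHull_eq]
    rw [this, latticeMap_image_convexHull]
    exact convex_convexHull ℝ _
  have m0 : ![0, 0] ∈ latticeMap W 0 '' Q := mem_image_latticeMap hU h0 (by simp) (by simp)
  rify at e1 e2
  have mg : ![(g : ℝ), 0] ∈ latticeMap W 0 '' Q := by
    refine mem_image_latticeMap hU hu ?_ ?_
    · simp [← e1]
    · push_cast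
      simp
      linear_combination -(σ : ℝ) * e2
  have m1 : ![1, 0] ∈ latticeMap W 0 '' Q := by
    have hg1 : (1 : ℝ) ≤ g := by
      have : 1 ≤ g := hg
      exact_mod_cast this
    refine hQ'.triple_mem m0 mg mg (1 - 1 / g) (1 / g) 0 ?_ (by positivity) le_rfl (by ring) ?_ ?_
    · rw [sub_nonneg, div_le_one hg']
      exact hg1
    · simp; field_simp
    · simp
  have mv : ![((a * v₀ + b * v₁ : ℤ) : ℝ), ((σ * (c * v₀ + d * v₁) : ℤ) : ℝ)] ∈
      latticeMap W 0 '' Q := by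
    refine mem_image_latticeMap hU hv ?_ ?_
    · push_cast; simp
    · push_cast; simp; ring
  obtain ⟨k, hk, -⟩ := exists_height_one hQ' m0 m1 hpos 1 (by rwa [one_mul])
  have hS : IsUnit ((1 : ℤ) * 1 - (-k) * 0) := by simp
  refine ⟨unimodular 1 (-k) 0 1 hS * W, ?_, ?_⟩
  · rw [← latticeMap_image_comp]
    exact mem_image_latticeMap hS m1 (by simp) (by simp)
  · rw [← latticeMap_image_comp]
    exact mem_image_latticeMap hS hk (by simp) (by simp)

theorem LatticeEquivalent.latticeCount_eq {Q R : Set (Fin 2 → ℝ)} (h : LatticeEquivalent Q R) :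
    latticeCount Q = latticeCount R := by
  obtain ⟨U, t, rfl⟩ := latticeEquivalent_iff.1 h
  exact latticeCount_latticeMap_image U t R

theorem LatticeEquivalent.isLatticePolygon {Q R : Set (Fin 2 → ℝ)}
    (h : LatticeEquivalent Q R) (hR : IsLatticePolygon R) : IsLatticePolygon Q := by
  obtain ⟨U, t, rfl⟩ := latticeEquivalent_iff.1 h
  exact hR.latticeMap_image U t

/-- Up to equivalence, a lattice polygon with nonempty interior contains the standard simplex. -/
theorem IsLatticePolygon.exists_equivalent_basis {Q : Set (Fin 2 → ℝ)} (hQ : IsLatticePolygon Q)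
    (hint : (interior Q).Nonempty) : ∃ R, LatticeEquivalent R Q ∧ ![0, 0] ∈ R ∧ ![1, 0] ∈ R ∧
      ![0, 1] ∈ R := by
  obtain ⟨x, y, z, hx, hy, hz, hdet⟩ := hQ.exists_noncollinear_extremePoints hint
  have h1 : IsUnit ((1 : ℤ) * 1 - 0 * 0) := by simp
  set R₁ := latticeMap (unimodular 1 0 0 1 h1) (-x) '' Q with hR₁
  have hR : IsLatticePolygon R₁ := hQ.latticeMap_image _ _
  replace hx := hx.1
  replace hy := hy.1
  replace hz := hz.1
  rw [latticePoint_eq_mk] at hx hy hz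
  have m0 : ![0, 0] ∈ R₁ := mem_image_latticeMap h1 hx (by simp) (by simp)
  have my : ![((y 0 - x 0 : ℤ) : ℝ), ((y 1 - x 1 : ℤ) : ℝ)] ∈ R₁ :=
    mem_image_latticeMap h1 hy (by simp; ring) (by simp; ring)
  have mz : ![((z 0 - x 0 : ℤ) : ℝ), ((z 1 - x 1 : ℤ) : ℝ)] ∈ R₁ :=
    mem_image_latticeMap h1 hz (by simp; ring) (by simp; ring)
  obtain ⟨U, hU1, hU2⟩ := exists_unimodular_basis hR.convex m0 my mz hdet
  refine ⟨latticeMap U 0 '' R₁, (latticeEquivalent_image _ _ _).trans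
    (latticeEquivalent_image _ _ _), ⟨0, ?_, ?_⟩, hU1, hU2⟩
  · convert m0
    ext i; fin_cases i <;> rfl
  · rw [latticeMap_zero_right]
    ext i; fin_cases i <;> rfl

/-! ### Polygons without interior lattice points and with at most four lattice points -/

theorem IsLatticePolygon.latticeEquivalent_standardSimplex {Q : Set (Fin 2 → ℝ)}
    (hQ : IsLatticePolygon Q) (hint : (interior Q).Nonempty) (hN : latticeCount Q = 3) :
    LatticeEquivalent Q standardSimplex := by
  obtain ⟨R, hRQ, h0, h1, h2⟩ := hQ.exists_equivalent_basis hint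
  refine hRQ.symm.trans ?_
  have hR := hRQ.isLatticePolygon hQ
  rw [← hRQ.latticeCount_eq] at hN
  have hsub : ({![0, 0], ![1, 0], ![0, 1]} : Set (Fin 2 → ℤ)) ⊆ {z | latticePoint z ∈ R} := by
    rintro z (rfl | rfl | rfl)
    · change latticePoint _ ∈ R
      rw [latticePoint_mk]; simpa using h0
    · change latticePoint _ ∈ R
      rw [latticePoint_mk]; simpa using h1
    · change latticePoint _ ∈ R
      rw [latticePoint_mk]; simpa using h2
  have hcard : ({![0, 0], ![1, 0], ![0, 1]} : Set (Fin 2 → ℤ)).ncard = 3 := by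
    rw [Set.ncard_eq_three]
    exact ⟨_, _, _, by decide, by decide, by decide, rfl⟩
  have heq := Set.eq_of_subset_of_ncard_le hsub (by rw [hcard]; exact hN.le)
    (finite_latticePoints hR.isCompact.isBounded)
  have h : R = standardSimplex := by
    rw [hR.eq_latticeHull, ← heq]
    rfl
  rw [h]
  exact latticeEquivalent_iff.2 ⟨1, 0, by simp_rw [latticeMap_one_zero, Set.image_id']⟩

/-- A lattice polygon whose lattice points are `0`, `e₁`, `e₂` and one more point in the closed
positive quadrant. -/
theorem latticeEquivalent_of_quadrant {Q : Set (Fin 2 → ℝ)} (hQ : IsLatticePolygon Q) {x y : ℤ}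
    (hL : ∀ u v : ℤ, ![(u : ℝ), (v : ℝ)] ∈ Q ↔ (u, v) ∈ [(0, 0), (1, 0), (0, 1), (x, y)])
    (hnew : (x, y) ∉ [((0 : ℤ), (0 : ℤ)), (1, 0), (0, 1)]) (hx : 0 ≤ x) (hy : 0 ≤ y) :
    LatticeEquivalent Q doubleTriangle ∨ LatticeEquivalent Q standardSquare := by
  have hQl := hQ.eq_hullList hL
  have h0 := (hL 0 0).2 (by simp)
  have h1 := (hL 1 0).2 (by simp)
  have h2 := (hL 0 1).2 (by simp)
  have hw := (hL x y).2 (by simp)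
  simp only [List.mem_cons, Prod.mk.injEq, List.not_mem_nil, or_false] at hL hnew
  have hx' : (0 : ℝ) ≤ x := by exact_mod_cast hx
  have hy' : (0 : ℝ) ≤ y := by exact_mod_cast hy
  rcases hx.eq_or_lt with rfl | hx
  · have hy2 : 2 ≤ y := by omega
    have hy2' : (2 : ℝ) ≤ y := by exact_mod_cast hy2
    have hmem : ![((0 : ℤ) : ℝ), ((2 : ℤ) : ℝ)] ∈ Q := by
      refine hQ.convex.triple_mem h0 hw hw (1 - 2 / y) (2 / y) 0 ?_ (by positivity) le_rfl
        (by ring) ?_ ?_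
      · rw [sub_nonneg, div_le_one (by linarith)]; exact hy2'
      · simp
      · simp; field_simp
    obtain rfl : y = 2 := by
      have := (hL 0 2).1 hmem
      omega
    left
    rw [hQl, doubleTriangle_eq]
    exact latticeEquivalent_hullList (a := 0) (b := 1) (c := 1) (d := 0) (s := 0) (t := 0)
      (by simp) (by decide)
  rcases hy.eq_or_lt with rfl | hy
  · have hx2 : 2 ≤ x := by omega
    have hx2' : (2 : ℝ) ≤ x := by exact_mod_cast hx2
    have hmem : ![((2 : ℤ) : ℝ), ((0 : ℤ) : ℝ)] ∈ Q := by
      refine hQ.convex.triple_mem h0 hw hw (1 - 2 / x) (2 / x) 0 ?_ (by positivity) le_rfl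
        (by ring) ?_ ?_
      · rw [sub_nonneg, div_le_one (by linarith)]; exact hx2'
      · simp; field_simp
      · simp
    obtain rfl : x = 2 := by
      have := (hL 2 0).1 hmem
      omega
    left
    rw [hQl, doubleTriangle_eq]
    exact latticeEquivalent_hullList (a := 1) (b := 0) (c := 0) (d := 1) (s := 0) (t := 0)
      (by simp) (by decide)
  have hx1 : (1 : ℝ) ≤ x := by exact_mod_cast (show 1 ≤ x from hx)
  have hy1 : (1 : ℝ) ≤ y := by exact_mod_cast (show 1 ≤ y from hy)
  have hpos : (0 : ℝ) < x + y - 1 := by linarith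
  -- When x, y ≥ 1, the triangle with vertices e₁, e₂, (x, y) contains (1, 1), which must therefore
  -- be the fourth lattice point.
  have hmem : ![((1 : ℤ) : ℝ), ((1 : ℤ) : ℝ)] ∈ Q := by
    refine hQ.convex.triple_mem h1 h2 hw ((y - 1) / (x + y - 1)) ((x - 1) / (x + y - 1))
      (1 / (x + y - 1)) (div_nonneg (by linarith) hpos.le) (div_nonneg (by linarith) hpos.le)
      (by positivity) ?_ ?_ ?_
    · field_simp; ring
    · simp; field_simp; ring
    · simp; field_simp; ring
  obtain ⟨rfl, rfl⟩ : x = 1 ∧ y = 1 := by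
    have := (hL 1 1).1 hmem
    omega
  right
  rw [hQl, standardSquare_eq]
  exact latticeEquivalent_hullList (a := 1) (b := 0) (c := 0) (d := 1) (s := 0) (t := 0)
    (by simp) (by decide)

theorem zero_mem_interior_of_neg {Q : Set (Fin 2 → ℝ)} (hQ : Convex ℝ Q) {x y : ℝ}
    (h1 : ![1, 0] ∈ Q) (h2 : ![0, 1] ∈ Q) (hw : ![x, y] ∈ Q) (hx : x < 0) (hy : y < 0) :
    (0 : Fin 2 → ℝ) ∈ interior Q := by
  refine mem_interior_of_forall_linForm hQ fun A B hAB => ?_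
  by_contra! hcon
  have a1 := hcon _ h1
  have a2 := hcon _ h2
  have a3 := hcon _ hw
  simp [linForm_apply] at a1 a2 a3
  have b1 : 0 ≤ A * x := mul_nonneg_of_nonpos_of_nonpos a1 hx.le
  have b2 : 0 ≤ B * y := mul_nonneg_of_nonpos_of_nonpos a2 hy.le
  have c1 : A * x = 0 := by linarith
  have c2 : B * y = 0 := by linarith
  rcases hAB with h | h
  · exact (mul_ne_zero h hx.ne) c1
  · exact (mul_ne_zero h hy.ne) c2

theorem LatticeEquivalent.forall_notMem_interior {Q R : Set (Fin 2 → ℝ)}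
    (h : LatticeEquivalent R Q) (hQ : ∀ z, latticePoint z ∉ interior Q) (z : Fin 2 → ℤ) :
    latticePoint z ∉ interior R := by
  obtain ⟨U, t, rfl⟩ := latticeEquivalent_iff.1 h.symm
  intro hz
  apply hQ ((U : Matrix (Fin 2) (Fin 2) ℤ).mulVec z + t)
  rw [interior_latticeMap_image, ← latticeMap_latticePoint]
  exact Set.mem_image_of_mem _ hz

/-- The fourth point has integral barycentric coordinates 1 - x - y, x, y with respect to the
simplex 0, e₁, e₂. Two negative ones would make a vertex of the simplex interior. So two are
nonnegative, and an affine symmetry of the simplex moves them to the positions required by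
`latticeEquivalent_of_quadrant`. -/
theorem IsLatticePolygon.latticeEquivalent_of_four {Q : Set (Fin 2 → ℝ)}
    (hQ : IsLatticePolygon Q) (hint : (interior Q).Nonempty) (hN : latticeCount Q = 4)
    (hI : latticeCount (interior Q) = 0) :
    LatticeEquivalent Q doubleTriangle ∨ LatticeEquivalent Q standardSquare := by
  have hI' : ∀ z, latticePoint z ∉ interior Q := by
    intro z hz
    rw [latticeCount, Set.ncard_eq_zero (finite_latticePoints
      (hQ.isCompact.isBounded.subset interior_subset))] at hI
    have : z ∈ ({z | latticePoint z ∈ interior Q} : Set (Fin 2 → ℤ)) := hz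
    rw [hI] at this
    exact this
  obtain ⟨R, hRQ, h0, h1, h2⟩ := hQ.exists_equivalent_basis hint
  suffices h : LatticeEquivalent R doubleTriangle ∨ LatticeEquivalent R standardSquare from
    h.imp hRQ.symm.trans hRQ.symm.trans
  have hR := hRQ.isLatticePolygon hQ
  rw [← hRQ.latticeCount_eq] at hN
  set T : Set (Fin 2 → ℤ) := {![0, 0], ![1, 0], ![0, 1]} with hT
  have hsub : T ⊆ {z | latticePoint z ∈ R} := by
    rintro z (rfl | rfl | rfl)
    · change latticePoint _ ∈ R
      rw [latticePoint_mk]; simpa using h0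
    · change latticePoint _ ∈ R
      rw [latticePoint_mk]; simpa using h1
    · change latticePoint _ ∈ R
      rw [latticePoint_mk]; simpa using h2
  have hcard : T.ncard = 3 := by
    rw [Set.ncard_eq_three]
    exact ⟨_, _, _, by decide, by decide, by decide, rfl⟩
  have hdiff : ({z | latticePoint z ∈ R} \ T).ncard = 1 := by
    rw [Set.ncard_sdiff hsub (Set.toFinite _), hcard]
    change latticeCount R - 3 = 1
    omega
  obtain ⟨w, hw⟩ := Set.ncard_eq_one.1 hdiff
  have hwmem : latticePoint w ∈ R ∧ w ∉ T := by
    have : w ∈ {z | latticePoint z ∈ R} \ T := by rw [hw]; rfl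
    exact this
  have memT : ∀ u v : ℤ, ![u, v] ∈ T ↔ (u, v) ∈ [((0 : ℤ), (0 : ℤ)), (1, 0), (0, 1)] := by
    intro u v
    simp [hT, funext_iff, Set.mem_insert_iff]
  obtain ⟨x, y, rfl⟩ : ∃ x y, w = ![x, y] := ⟨w 0, w 1, by ext i; fin_cases i <;> rfl⟩
  have hL : ∀ u v : ℤ, ![(u : ℝ), (v : ℝ)] ∈ R ↔ (u, v) ∈ [(0, 0), (1, 0), (0, 1), (x, y)] := by
    intro u v
    rw [← latticePoint_mk]
    have hsplit : latticePoint ![u, v] ∈ R ↔ ![u, v] ∈ T ∨ ![u, v] = ![x, y] := by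
      constructor
      · intro h
        by_cases huT : ![u, v] ∈ T
        · exact Or.inl huT
        · right
          have : ![u, v] ∈ {z | latticePoint z ∈ R} \ T := ⟨h, huT⟩
          rw [hw] at this
          exact this
      · rintro (h | h)
        · exact hsub h
        · rw [h]; exact hwmem.1
    rw [hsplit, memT]
    simp [funext_iff, or_assoc]
  have hnew := hwmem.2
  rw [memT] at hnew
  -- the affine symmetries of the standard simplex
  have hs₁ : IsUnit ((-1 : ℤ) * 1 - (-1) * 0) := by simp
  have hs₂ : IsUnit ((1 : ℤ) * (-1) - 0 * (-1)) := by simp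
  set R₁ := latticeMap (unimodular (-1) (-1) 0 1 hs₁) ![1, 0] '' R with hR₁
  set R₂ := latticeMap (unimodular 1 0 (-1) (-1) hs₂) ![0, 1] '' R with hR₂
  have hE₁ : LatticeEquivalent R₁ R := latticeEquivalent_image _ _ _
  have hE₂ : LatticeEquivalent R₂ R := latticeEquivalent_image _ _ _
  have hL₁ : ∀ u v : ℤ, ![(u : ℝ), (v : ℝ)] ∈ R₁ ↔
      (u, v) ∈ [(0, 0), (1, 0), (0, 1), (1 - x - y, y)] := by
    intro u v
    have : ![(u : ℝ), (v : ℝ)] ∈ R₁ ↔ ![((1 - u - v : ℤ) : ℝ), (v : ℝ)] ∈ R := by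
      constructor
      · intro h
        obtain ⟨p, q, hpq, e0, e1⟩ := exists_of_mem_image_latticeMap hs₁ h
        simp at e0 e1
        subst e1
        convert hpq using 2
        push_cast
        rw [e0]; ring
      · intro h
        refine mem_image_latticeMap hs₁ h ?_ ?_
        · simp; ring
        · simp
    rw [this, hL]
    simp only [List.mem_cons, Prod.mk.injEq, List.not_mem_nil, or_false]
    omega
  have hL₂ : ∀ u v : ℤ, ![(u : ℝ), (v : ℝ)] ∈ R₂ ↔
      (u, v) ∈ [(0, 0), (1, 0), (0, 1), (x, 1 - x - y)] := by
    intro u v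
    have : ![(u : ℝ), (v : ℝ)] ∈ R₂ ↔ ![(u : ℝ), ((1 - u - v : ℤ) : ℝ)] ∈ R := by
      constructor
      · intro h
        obtain ⟨p, q, hpq, e0, e1⟩ := exists_of_mem_image_latticeMap hs₂ h
        simp at e0 e1
        subst e0
        convert hpq using 2
        push_cast
        rw [e1]
        ext i; fin_cases i; simp; ring
      · intro h
        refine mem_image_latticeMap hs₂ h ?_ ?_
        · simp
        · simp; ring
    rw [this, hL]
    simp only [List.mem_cons, Prod.mk.injEq, List.not_mem_nil, or_false]
    omega
  have hneg : ∀ (S : Set (Fin 2 → ℝ)) (p q : ℤ), LatticeEquivalent S R →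
      (∀ u v : ℤ, ![(u : ℝ), (v : ℝ)] ∈ S ↔ (u, v) ∈ [(0, 0), (1, 0), (0, 1), (p, q)]) →
      ¬ (p < 0 ∧ q < 0) := by
    rintro S p q hS hSL ⟨hp, hq⟩
    have hSI := (hS.trans hRQ).forall_notMem_interior hI' 0
    rw [latticePoint_zero] at hSI
    refine hSI (zero_mem_interior_of_neg (x := p) (y := q) (hS.isLatticePolygon hR).convex ?_ ?_ ?_
      (by exact_mod_cast hp) (by exact_mod_cast hq))
    · have := (hSL 1 0).2 (by simp)
      simpa using this
    · have := (hSL 0 1).2 (by simp)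
      simpa using this
    · exact (hSL p q).2 (by simp)
  simp only [List.mem_cons, Prod.mk.injEq, List.not_mem_nil, or_false] at hnew
  by_cases hxy : 0 ≤ x ∧ 0 ≤ y
  · refine latticeEquivalent_of_quadrant hR hL ?_ hxy.1 hxy.2
    simpa using hnew
  by_cases hly : 0 ≤ 1 - x - y ∧ 0 ≤ y
  · refine (latticeEquivalent_of_quadrant (hE₁.isLatticePolygon hR) hL₁ ?_ hly.1 hly.2).imp
      hE₁.symm.trans hE₁.symm.trans
    simp only [List.mem_cons, Prod.mk.injEq, List.not_mem_nil, or_false]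
    omega
  by_cases hxl : 0 ≤ x ∧ 0 ≤ 1 - x - y
  · refine (latticeEquivalent_of_quadrant (hE₂.isLatticePolygon hR) hL₂ ?_ hxl.1 hxl.2).imp
      hE₂.symm.trans hE₂.symm.trans
    simp only [List.mem_cons, Prod.mk.injEq, List.not_mem_nil, or_false]
    omega
  have n0 := hneg R x y (latticeEquivalent_iff.2
    ⟨1, 0, by simp_rw [latticeMap_one_zero, Set.image_id']⟩) hL
  have n1 := hneg R₁ _ _ hE₁ hL₁
  have n2 := hneg R₂ _ _ hE₂ hL₂
  omega

/-! ### Fano polygons -/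

/-- The vertices of the sixteen Fano polygons, as lists. -/
def fanoList : Fin 16 → List (ℤ × ℤ) :=
  ![[(1, 0), (0, 1), (-1, -1)],
    [(1, 0), (0, 1), (-1, 0), (0, -1)],
    [(1, 0), (0, 1), (-1, 1), (0, -1)],
    [(0, 1), (1, -1), (-1, -1)],
    [(1, 0), (1, 1), (0, 1), (-1, 0), (0, -1)],
    [(0, 1), (1, 0), (1, -1), (-1, -1)],
    [(1, 0), (1, 1), (0, 1), (-1, 0), (-1, -1), (0, -1)],
    [(1, 0), (0, 1), (-1, 0), (-1, -1), (1, -1)],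
    [(0, 1), (-1, 1), (-1, -1), (1, -1)],
    [(-1, 1), (-1, -1), (2, -1)],
    [(1, 0), (0, 1), (-1, 1), (-1, -1), (1, -1)],
    [(1, 0), (-1, 1), (-1, -1), (2, -1)],
    [(0, 1), (-1, 1), (-1, -1), (2, -1)],
    [(1, 1), (-1, 1), (-1, -1), (1, -1)],
    [(-1, 1), (-1, -1), (3, -1)],
    [(-1, 2), (-1, -1), (2, -1)]]

/-- The set of integral vectors with coordinates in a list. -/
def listSet : List (ℤ × ℤ) → Set (Fin 2 → ℤ)
  | [] => ∅
  -- The separate singleton case makes the result unfold to set-builder braces, so that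
  -- `fanoVertices_eq` holds by `rfl`.
  | [p] => {![p.1, p.2]}
  | p :: q :: l => insert ![p.1, p.2] (listSet (q :: l))

theorem eq_mk_iff (z : Fin 2 → ℤ) (p : ℤ × ℤ) : z = ![p.1, p.2] ↔ (z 0, z 1) = p := by
  simp [funext_iff, Prod.ext_iff]

theorem listSet_eq : ∀ l : List (ℤ × ℤ), listSet l = {z | (z 0, z 1) ∈ l}
  | [] => by ext z; simp [listSet]
  | [p] => by ext z; simp [listSet, eq_mk_iff]
  | p :: q :: l => by
    ext z
    rw [listSet, listSet_eq (q :: l), Set.mem_insert_iff, eq_mk_iff]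
    simp

theorem fanoVertices_eq (i : Fin 16) : fanoVertices i = listSet (fanoList i) := by
  fin_cases i <;> rfl

theorem fanoPolygon_eq (i : Fin 16) : fanoPolygon i = hullList (fanoList i) := by
  rw [fanoPolygon, hullList, fanoVertices_eq, listSet_eq]

/-- The polygon is equivalent to one of the sixteen Fano polygons. -/
def IsStandardFano (Q : Set (Fin 2 → ℝ)) : Prop := ∃ i, LatticeEquivalent Q (fanoPolygon i)

theorem IsStandardFano.of_image {Q : Set (Fin 2 → ℝ)} {U : Matrix.GeneralLinearGroup (Fin 2) ℤ}
    {t : Fin 2 → ℤ} (h : IsStandardFano (latticeMap U t '' Q)) : IsStandardFano Q := by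
  obtain ⟨i, hi⟩ := h
  exact ⟨i, (latticeEquivalent_image U t Q).symm.trans hi⟩

/-! ### Polygons whose only interior lattice point is the origin -/

/-- A lattice polygon whose only interior lattice point is the origin. -/
structure IsOriginPolygon (Q : Set (Fin 2 → ℝ)) : Prop where
  isLatticePolygon : IsLatticePolygon Q
  zero_mem_interior : (0 : Fin 2 → ℝ) ∈ interior Q
  eq_zero : ∀ z, latticePoint z ∈ interior Q → z = 0

namespace IsOriginPolygon

variable {Q : Set (Fin 2 → ℝ)}

theorem image (hQ : IsOriginPolygon Q) (U : Matrix.GeneralLinearGroup (Fin 2) ℤ) :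
    IsOriginPolygon (latticeMap U 0 '' Q) where
  isLatticePolygon := hQ.isLatticePolygon.latticeMap_image U 0
  zero_mem_interior := by
    rw [interior_latticeMap_image]
    exact ⟨0, hQ.zero_mem_interior, latticeMap_zero_right U⟩
  eq_zero := by
    intro z hz
    rw [interior_latticeMap_image] at hz
    obtain ⟨p, hp, hpz⟩ := hz
    have hU : latticeMap U⁻¹ (latticeInvShift U 0) (latticePoint z) = p := by
      rw [← hpz, latticeMap_inv_left]
    have hshift : latticeInvShift U 0 = 0 := by simp [latticeInvShift]
    rw [hshift, latticeMap_latticePoint, add_zero] at hU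
    have h0 := hQ.eq_zero _ (hU.symm ▸ hp)
    rw [← hU, h0, latticePoint_zero, latticeMap_zero_right, ← latticePoint_zero] at hpz
    exact (latticePoint_injective hpz).symm

theorem convex (hQ : IsOriginPolygon Q) : Convex ℝ Q := hQ.isLatticePolygon.convex

theorem zero_mem (hQ : IsOriginPolygon Q) : ![0, 0] ∈ Q := by
  convert interior_subset hQ.zero_mem_interior
  ext i; fin_cases i <;> rfl

/-- Nonzero lattice points of the polygon lie on its boundary. -/
theorem le_one (hQ : IsOriginPolygon Q) {x y : ℤ} (hxy : x ≠ 0 ∨ y ≠ 0) {s p q : ℝ}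
    (h : ![p, q] ∈ Q) (hp : p = s * x) (hq : q = s * y) : s ≤ 1 := by
  by_contra! hs
  -- For s > 1 the lattice point (x, y) lies strictly between the interior point 0 and a point of Q,
  -- so it would be interior too.
  have hmem : latticePoint ![x, y] ∈ openSegment ℝ 0 ![p, q] := by
    refine ⟨1 - 1 / s, 1 / s, ?_, by positivity, by ring, ?_⟩
    · rw [sub_pos, div_lt_one (by linarith)]; exact hs
    · ext i
      fin_cases i
      · simp [latticePoint, hp]; field_simp
      · simp [latticePoint, hq]; field_simp
  have h0 := hQ.eq_zero _ (hQ.convex.openSegment_interior_self_subset_interior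
    hQ.zero_mem_interior h hmem)
  rcases hxy with h | h
  · exact h (congrFun h0 0)
  · exact h (congrFun h0 1)

/-- A closed half-plane bounded by a line through 0 and containing all lattice points of Q would
contain Q, and 0 would not be interior. This is how interiority of the origin is used on lattice
points. -/
theorem exists_pos (hQ : IsOriginPolygon Q) {A B : ℝ} (hAB : A ≠ 0 ∨ B ≠ 0) :
    ∃ x y : ℤ, ![(x : ℝ), (y : ℝ)] ∈ Q ∧ 0 < A * x + B * y := by
  by_contra! hcon
  obtain ⟨q, hq, hlt⟩ := exists_lt_linForm_of_mem_interior hQ.zero_mem_interior hAB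
  have hsub : Q ⊆ {p | linForm A B p ≤ 0} := by
    rw [hQ.isLatticePolygon.eq_latticeHull]
    refine convexHull_min ?_ (convex_halfSpace_le (linForm A B).isLinear 0)
    rintro _ ⟨z, hz, rfl⟩
    have hz' : latticePoint z ∈ Q := hz
    rw [latticePoint_eq_mk] at hz'
    exact hcon _ _ hz'
  rw [map_zero] at hlt
  exact absurd hlt (not_lt.2 (hsub hq))

theorem exists_row (hQ : IsOriginPolygon Q) (j : ℤ) (h : ∃ x : ℤ, ![(x : ℝ), (j : ℝ)] ∈ Q) :
    ∃ α β : ℤ, ![(α : ℝ), (j : ℝ)] ∈ Q ∧ ![(β : ℝ), (j : ℝ)] ∈ Q ∧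
      ∀ x : ℤ, ![(x : ℝ), (j : ℝ)] ∈ Q → α ≤ x ∧ x ≤ β := by
  have hfin : {x : ℤ | ![(x : ℝ), (j : ℝ)] ∈ Q}.Finite := by
    refine ((finite_latticePoints hQ.isLatticePolygon.isCompact.isBounded).image
      (fun z => z 0)).subset fun x hx => ⟨![x, j], ?_, rfl⟩
    change latticePoint _ ∈ Q
    rw [latticePoint_mk]
    exact hx
  obtain ⟨α, hα, hα'⟩ := Set.exists_min_image _ id hfin h
  obtain ⟨β, hβ, hβ'⟩ := Set.exists_max_image _ id hfin h
  exact ⟨α, β, hα, hβ, fun x hx => ⟨hα' x hx, hβ' x hx⟩⟩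

end IsOriginPolygon

/-! ### Origin polygons in a strip of width two -/

/-- Spanning points of an origin polygon in the strip `|y| ≤ 1`. -/
def stripPoints (β γ δ : ℤ) (f g : Bool) : List (ℤ × ℤ) :=
  [(-1, 1), (β, 1), (γ, -1), (δ, -1)] ++ (if f then [(-1, 0)] else []) ++
    (if g then [(1, 0)] else [])

/-- Indices of Fano polygons together with unimodular matrices, enough to reach every origin polygon
in the strip `|y| ≤ 1`. -/
def stripTable : List (Fin 16 × ℤ × ℤ × ℤ × ℤ) :=
  [(0, -1, -1, 0, 1), (0, 0, 1, -1, 0), (1, -1, -1, 0, 1), (1, -1, 0, 1, -1), (2, -1, -1, 0, 1),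
    (2, -1, 1, 0, -1), (2, -1, 1, 1, 0), (2, 0, -1, -1, 0), (2, 0, 1, -1, -1), (2, 1, 0, 0, 1), (3,
    -2, -1, 1, 0), (3, -1, -1, 0, 1), (3, -1, 0, 0, -1), (3, 0, 1, -1, 0), (4, -1, 0, 0, 1), (4,
    -1, 0, 1, -1), (4, -1, 1, 0, -1), (4, -1, 1, 1, 0), (4, 0, 1, 1, -1), (4, 1, 1, -1, 0), (5, -1,
    -1, 0, 1), (5, -1, -1, 1, 0), (5, -1, 0, 0, -1), (5, 0, 1, -1, 0), (5, 0, 1, 1, 0), (5, 1, -1,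
    0, 1), (5, 1, 0, 0, -1), (5, 2, -1, -1, 0), (6, -1, 0, 0, 1), (7, -1, -1, 0, 1), (7, -1, -1, 1,
    0), (7, -1, 0, 0, -1), (7, 0, 1, -1, 0), (8, -2, -1, 1, 0), (8, -1, -1, 0, 1), (8, -1, 0, 0,
    -1), (8, 0, -1, -1, 0), (8, 0, 1, -1, 0), (8, 0, 1, 1, 0), (8, 1, 0, 0, -1), (8, 1, 0, 0, 1),
    (9, -1, -2, 0, 1), (9, -1, -1, 0, -1), (9, 1, 0, 0, -1), (9, 1, 0, 0, 1), (10, -1, -1, 0, 1),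
    (10, -1, 0, 0, -1), (10, 0, 1, -1, 0), (10, 0, 1, 1, 0), (11, -1, -2, 0, 1), (11, -1, -1, 0,
    -1), (11, 1, 0, 0, -1), (11, 1, 0, 0, 1), (12, 1, 0, 0, -1), (12, 1, 0, 0, 1), (13, -1, 0, 0,
    -1), (14, 1, 0, 0, -1), (14, 1, 0, 0, 1)]

theorem stripTable_unimodular : ∀ r ∈ stripTable,
    r.2.1 * r.2.2.2.2 - r.2.2.1 * r.2.2.2.1 = 1 ∨ r.2.1 * r.2.2.2.2 - r.2.2.1 * r.2.2.2.1 = -1 := by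
  decide

/-- The top row runs from -1 to β, the bottom row from γ to δ, and f, g tell whether (-1, 0) and (1,
0) occur. The last two conditions say that the origin is interior and that the flags are set
whenever the midpoints of the row ends force them. -/
theorem stripTable_complete : ∀ δ ∈ [(-1 : ℤ), 0, 1, 2, 3], ∀ γ ∈ [(-1 : ℤ), 0, 1, 2, 3],
    ∀ β ∈ [(-1 : ℤ), 0, 1, 2, 3], ∀ f g : Bool, γ ≤ δ → β + δ ≤ 2 →
      (γ = 0 ∨ f = true) → (β + δ = 1 ∨ g = true) →
      stripTable.any (fun r => coverCheck r.2.1 r.2.2.1 r.2.2.2.1 r.2.2.2.2 0 0 (fanoList r.1)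
        (stripPoints β γ δ f g)) = true := by
  decide +kernel

namespace IsOriginPolygon

variable {Q : Set (Fin 2 → ℝ)}

theorem abs_le_one_of_mem_axis (hQ : IsOriginPolygon Q) {x : ℤ} (h : ![(x : ℝ), 0] ∈ Q) :
    x = -1 ∨ x = 0 ∨ x = 1 := by
  have h1 : (x : ℝ) ≤ 1 := hQ.le_one (x := 1) (y := 0) (by simp) h (by simp) (by simp)
  have h2 : (-x : ℝ) ≤ 1 := hQ.le_one (x := -1) (y := 0) (by simp) h (by simp) (by simp)
  have h1' : x ≤ 1 := by exact_mod_cast h1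
  have h2' : -x ≤ 1 := by exact_mod_cast h2
  omega

theorem isStandardFano_of_normalized_strip (hQ : IsOriginPolygon Q)
    (hstrip : ∀ x y : ℤ, ![(x : ℝ), (y : ℝ)] ∈ Q → -1 ≤ y ∧ y ≤ 1) (hα : ![-1, 1] ∈ Q)
    (hα' : ∀ x : ℤ, ![(x : ℝ), 1] ∈ Q → -1 ≤ x) : IsStandardFano Q := by
  obtain ⟨_, β, -, hβ, hrow⟩ := hQ.exists_row 1 ⟨-1, by simpa using hα⟩
  have hβ' : ∀ x : ℤ, ![(x : ℝ), 1] ∈ Q → x ≤ β := fun x hx => (hrow x (by simpa using hx)).2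
  obtain ⟨x₀, y₀, hxy, hpos⟩ := hQ.exists_pos (A := 0) (B := -1) (by simp)
  have hy₀ : y₀ = -1 := by
    have h1 := (hstrip _ _ hxy).1
    have : (y₀ : ℝ) < 0 := by linarith
    have : y₀ < 0 := by exact_mod_cast this
    omega
  subst hy₀
  obtain ⟨γ, δ, hγ, hδ, hrow'⟩ := hQ.exists_row (-1) ⟨x₀, hxy⟩
  have hβ1 : -1 ≤ β := hα' β (by simpa using hβ)
  have hγδ : γ ≤ δ := (hrow' δ hδ).1
  push_cast at hβ hγ hδ hrow'
  -- The midpoints of the left ends and of the right ends of the two rows lie on the x-axis, where Q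
  -- is confined to [-1, 1]. This bounds γ below and β + δ above, so that finitely many cases
  -- remain.
  have hmidl : ![((γ : ℝ) - 1) / 2, 0] ∈ Q :=
    hQ.convex.triple_mem hα hγ hγ (1 / 2) (1 / 2) 0 (by norm_num) (by norm_num) le_rfl (by norm_num)
      (by simp; ring) (by simp)
  have hmidr : ![((β : ℝ) + δ) / 2, 0] ∈ Q :=
    hQ.convex.triple_mem hβ hδ hδ (1 / 2) (1 / 2) 0 (by norm_num) (by norm_num) le_rfl (by norm_num)
      (by simp; ring) (by simp)
  have hγ1 : -1 ≤ γ := by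
    have := hQ.le_one (x := -1) (y := 0) (s := (1 - γ) / 2) (by simp) hmidl (by simp; ring)
      (by simp)
    have : (-1 : ℝ) ≤ γ := by linarith
    exact_mod_cast this
  have hβδ : β + δ ≤ 2 := by
    have := hQ.le_one (x := 1) (y := 0) (s := (β + δ) / 2) (by simp) hmidr (by simp) (by simp)
    have : (β + δ : ℝ) ≤ 2 := by linarith
    exact_mod_cast this
  classical
  set f : Bool := decide (![-1, 0] ∈ Q) with hf
  set g : Bool := decide (![1, 0] ∈ Q) with hg
  have axis : ∀ x : ℤ, ![(x : ℝ), 0] ∈ Q → (x = -1 ∧ f = true) ∨ x = 0 ∨ (x = 1 ∧ g = true) := by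
    intro x hx
    rcases hQ.abs_le_one_of_mem_axis hx with rfl | rfl | rfl
    · exact Or.inl ⟨rfl, by rw [hf, decide_eq_true_eq]; simpa using hx⟩
    · exact Or.inr (Or.inl rfl)
    · exact Or.inr (Or.inr ⟨rfl, by rw [hg, decide_eq_true_eq]; simpa using hx⟩)
  have cases : ∀ x y : ℤ, ![(x : ℝ), (y : ℝ)] ∈ Q → (y = 1 ∧ -1 ≤ x ∧ x ≤ β) ∨
      (y = -1 ∧ γ ≤ x ∧ x ≤ δ) ∨ (y = 0 ∧ ((x = -1 ∧ f = true) ∨ x = 0 ∨ (x = 1 ∧ g = true))) := by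
    intro x y hx
    have := hstrip x y hx
    obtain rfl | rfl | rfl : y = 1 ∨ y = -1 ∨ y = 0 := by omega
    · exact Or.inl ⟨rfl, hα' x (by simpa using hx), hβ' x (by simpa using hx)⟩
    · exact Or.inr (Or.inl ⟨rfl, hrow' x (by simpa using hx)⟩)
    · exact Or.inr (Or.inr ⟨rfl, axis x (by simpa using hx)⟩)
  -- Otherwise all lattice points satisfy x + y ≥ 0.
  have hleft : γ ≤ 0 ∨ f = true := by
    by_contra! hcon
    obtain ⟨x, y, hx, hlt⟩ := hQ.exists_pos (A := -1) (B := -1) (by simp)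
    have hlt' : 0 < -x - y := by
      have : (0 : ℝ) < -x - y := by linarith
      exact_mod_cast this
    rcases cases x y hx with h | h | h
    · omega
    · omega
    · rcases h with ⟨h, ⟨-, h'⟩ | h' | ⟨h', -⟩⟩
      · exact hcon.2 h'
      · omega
      · omega
  -- Otherwise all lattice points satisfy x ≤ βy.
  have hright : 1 ≤ β + δ ∨ g = true := by
    by_contra! hcon
    obtain ⟨x, y, hx, hlt⟩ := hQ.exists_pos (A := 1) (B := -β) (by simp)
    have hlt' : 0 < x - β * y := by
      have : (0 : ℝ) < x - β * y := by linarith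
      exact_mod_cast this
    rcases cases x y hx with ⟨rfl, h⟩ | ⟨rfl, h⟩ | h
    · omega
    · omega
    · rcases h with ⟨rfl, ⟨h', -⟩ | h' | ⟨-, h'⟩⟩
      · omega
      · omega
      · exact hcon.2 h'
  have hf1 : γ = -1 → f = true := by
    rintro rfl
    rw [hf, decide_eq_true_eq]
    convert hmidl using 2
    norm_num
  have hg1 : β + δ = 2 → g = true := by
    intro h
    rw [hg, decide_eq_true_eq]
    convert hmidr using 2
    have : (β + δ : ℝ) = 2 := by exact_mod_cast h
    rw [this]; norm_num
  have hQK : Q = hullList (stripPoints β γ δ f g) := by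
    have hconv : Convex ℝ (hullList (stripPoints β γ δ f g)) := convex_convexHull ℝ _
    have k1 : ![-1, 1] ∈ hullList (stripPoints β γ δ f g) := by
      have := mem_hullList_of_mem (l := stripPoints β γ δ f g) (x := -1) (y := 1)
        (by simp [stripPoints])
      simpa using this
    have k2 : ![(β : ℝ), 1] ∈ hullList (stripPoints β γ δ f g) := by
      have := mem_hullList_of_mem (l := stripPoints β γ δ f g) (x := β) (y := 1)
        (by simp [stripPoints])
      simpa using this
    have k3 : ![(γ : ℝ), -1] ∈ hullList (stripPoints β γ δ f g) := by
      have := mem_hullList_of_mem (l := stripPoints β γ δ f g) (x := γ) (y := -1)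
        (by simp [stripPoints])
      simpa using this
    have k4 : ![(δ : ℝ), -1] ∈ hullList (stripPoints β γ δ f g) := by
      have := mem_hullList_of_mem (l := stripPoints β γ δ f g) (x := δ) (y := -1)
        (by simp [stripPoints])
      simpa using this
    have k5 : f = true → ![-1, 0] ∈ hullList (stripPoints β γ δ f g) := by
      intro h
      have := mem_hullList_of_mem (l := stripPoints β γ δ f g) (x := -1) (y := 0)
        (by simp [stripPoints, h])
      simpa using this
    have k6 : g = true → ![1, 0] ∈ hullList (stripPoints β γ δ f g) := by
      intro h
      have := mem_hullList_of_mem (l := stripPoints β γ δ f g) (x := 1) (y := 0)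
        (by simp [stripPoints, h])
      simpa using this
    have hl : ∃ l : ℝ, 0 < l ∧ ![-l, 0] ∈ hullList (stripPoints β γ δ f g) := by
      rcases hleft with h | h
      · have h' : (γ : ℝ) ≤ 0 := by exact_mod_cast h
        refine ⟨(1 - γ) / 2, by linarith, ?_⟩
        exact hconv.triple_mem k1 k3 k3 (1 / 2) (1 / 2) 0 (by norm_num) (by norm_num) le_rfl
          (by norm_num) (by simp; ring) (by simp)
      · exact ⟨1, one_pos, k5 h⟩
    have hr : ∃ r : ℝ, 0 < r ∧ ![r, 0] ∈ hullList (stripPoints β γ δ f g) := by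
      rcases hright with h | h
      · have h' : (1 : ℝ) ≤ β + δ := by exact_mod_cast h
        refine ⟨(β + δ) / 2, by linarith, ?_⟩
        exact hconv.triple_mem k2 k4 k4 (1 / 2) (1 / 2) 0 (by norm_num) (by norm_num) le_rfl
          (by norm_num) (by simp; ring) (by simp)
      · exact ⟨1, one_pos, k6 h⟩
    have hrowmem : ∀ (u v x : ℤ) (y : ℝ), u ≤ x → x ≤ v →
        ![(u : ℝ), y] ∈ hullList (stripPoints β γ δ f g) →
        ![(v : ℝ), y] ∈ hullList (stripPoints β γ δ f g) →
        ![(x : ℝ), y] ∈ hullList (stripPoints β γ δ f g) := by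
      intro u v x y hux hxv hu hv
      rcases (hux.trans hxv).eq_or_lt with rfl | huv
      · obtain rfl : x = u := by omega
        exact hu
      have huv' : (0 : ℝ) < v - u := by
        have : (u : ℝ) < v := by exact_mod_cast huv
        linarith
      have hux' : (u : ℝ) ≤ x := by exact_mod_cast hux
      have hxv' : (x : ℝ) ≤ v := by exact_mod_cast hxv
      refine hconv.triple_mem hu hv hv ((v - x) / (v - u)) ((x - u) / (v - u)) 0
        (div_nonneg (by linarith) huv'.le) (div_nonneg (by linarith) huv'.le) le_rfl ?_ ?_ ?_
      · field_simp; ring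
      · simp; field_simp; ring
      · simp; field_simp; ring
    apply Set.Subset.antisymm
    · conv_lhs => rw [hQ.isLatticePolygon.eq_latticeHull]
      refine convexHull_min ?_ hconv
      rintro _ ⟨z, hz, rfl⟩
      have hz' : latticePoint z ∈ Q := hz
      rw [latticePoint_eq_mk] at hz' ⊢
      rcases cases _ _ hz' with ⟨h, h1, h2⟩ | ⟨h, h1, h2⟩ | ⟨h, h1⟩
      · rw [h]
        simpa using hrowmem (-1) β (z 0) 1 h1 h2 (by simpa using k1) k2
      · rw [h]
        simpa using hrowmem γ δ (z 0) (-1) h1 h2 k3 k4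
      · rw [h]
        rcases h1 with ⟨h1, h2⟩ | h1 | ⟨h1, h2⟩
        · rw [h1]; simpa using k5 h2
        · rw [h1]
          obtain ⟨l, hl0, hl⟩ := hl
          obtain ⟨r, hr0, hr⟩ := hr
          refine hconv.triple_mem hl hr hr (r / (l + r)) (l / (l + r)) 0 (by positivity)
            (by positivity) le_rfl ?_ ?_ ?_
          · field_simp; ring
          · simp; field_simp; ring
          · simp
        · rw [h1]; simpa using k6 h2
    · refine convexHull_min ?_ hQ.convex
      rintro _ ⟨z, hz, rfl⟩
      rw [latticePoint_eq_mk]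
      have hz' : (z 0, z 1) ∈ stripPoints β γ δ f g := hz
      simp only [stripPoints, List.mem_append, List.mem_cons, Prod.mk.injEq, List.not_mem_nil,
        or_false] at hz'
      rcases hz' with ((⟨h0, h1⟩ | ⟨h0, h1⟩ | ⟨h0, h1⟩ | ⟨h0, h1⟩) | h) | h
      · rw [h0, h1]; simpa using hα
      · rw [h0, h1]; simpa using hβ
      · rw [h0, h1]; simpa using hγ
      · rw [h0, h1]; simpa using hδ
      · by_cases hft : f = true
        · rw [if_pos hft] at h
          simp at h
          rw [h.1, h.2]
          rw [hf, decide_eq_true_eq] at hft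
          simpa using hft
        · rw [if_neg hft] at h
          simp at h
      · by_cases hgt : g = true
        · rw [if_pos hgt] at h
          simp at h
          rw [h.1, h.2]
          rw [hg, decide_eq_true_eq] at hgt
          simpa using hgt
        · rw [if_neg hgt] at h
          simp at h
  have range : ∀ x : ℤ, -1 ≤ x → x ≤ 3 → x ∈ [(-1 : ℤ), 0, 1, 2, 3] := by
    intro x h1 h2
    simp
    omega
  have htable := stripTable_complete δ (range δ (by omega) (by omega)) γ
    (range γ (by omega) (by omega)) β (range β (by omega) (by omega)) f g hγδ hβδ
    (by
      by_cases h : f = true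
      · exact Or.inr h
      · left
        have h1 := hleft.resolve_right h
        have h2 : γ ≠ -1 := fun h' => h (hf1 h')
        omega)
    (by
      by_cases h : g = true
      · exact Or.inr h
      · left
        have h1 := hright.resolve_right h
        have h2 : β + δ ≠ 2 := fun h' => h (hg1 h')
        omega)
  rw [List.any_eq_true] at htable
  obtain ⟨r, hr, hcheck⟩ := htable
  refine ⟨r.1, ?_⟩
  rw [fanoPolygon_eq, hQK]
  exact latticeEquivalent_hullList (Int.isUnit_iff.2 (stripTable_unimodular r hr)) hcheck

/-- A horizontal shear preserves the strip and moves the leftmost lattice point of the top row to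
(-1, 1). -/
theorem isStandardFano_of_strip (hQ : IsOriginPolygon Q)
    (hstrip : ∀ x y : ℤ, ![(x : ℝ), (y : ℝ)] ∈ Q → -1 ≤ y ∧ y ≤ 1) : IsStandardFano Q := by
  obtain ⟨x₀, y₀, hxy, hpos⟩ := hQ.exists_pos (A := 0) (B := 1) (by simp)
  have hy₀ : y₀ = 1 := by
    have h1 := (hstrip _ _ hxy).2
    have : (0 : ℝ) < y₀ := by linarith
    have : 0 < y₀ := by exact_mod_cast this
    omega
  subst hy₀
  obtain ⟨α, _, hα, -, hrow⟩ := hQ.exists_row 1 ⟨x₀, hxy⟩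
  have hU : IsUnit ((1 : ℤ) * 1 - (-(α + 1)) * 0) := by simp
  have himg : ∀ x y : ℤ, ![(x : ℝ), (y : ℝ)] ∈ latticeMap (unimodular 1 (-(α + 1)) 0 1 hU) 0 '' Q →
      ![((x + (α + 1) * y : ℤ) : ℝ), (y : ℝ)] ∈ Q := by
    intro x y h
    obtain ⟨p, q, hpq, e0, e1⟩ := exists_of_mem_image_latticeMap hU h
    simp at e0 e1
    subst e1
    convert hpq using 2
    push_cast
    rw [e0]; ring
  refine IsStandardFano.of_image (U := unimodular 1 (-(α + 1)) 0 1 hU) (t := 0)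
    ((hQ.image _).isStandardFano_of_normalized_strip ?_ ?_ ?_)
  · intro x y h
    exact hstrip _ _ (himg x y h)
  · exact mem_image_latticeMap hU hα (by simp) (by simp)
  · intro x h
    have := (hrow _ (himg x 1 (by simpa using h))).1
    linarith

/-! ### Edges with at least three lattice points -/

theorem le_one_of_facet (hQ : IsOriginPolygon Q) (hl : ![-1, 1] ∈ Q) (hr : ![1, 1] ∈ Q)
    {x y : ℝ} (h : ![x, y] ∈ Q) : y ≤ 1 := by
  by_contra! hy
  -- If (x, y) lay above the edge, its chord to the end of the edge across the y-axis would meet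
  -- that axis above (0, 1), making (0, 1) interior.
  rcases le_total 0 x with hx | hx
  · have hmem : ![0, (x + y) / (x + 1)] ∈ Q := by
      refine hQ.convex.triple_mem hl h h (x / (x + 1)) (1 / (x + 1)) 0 (by positivity)
        (by positivity) le_rfl ?_ ?_ ?_
      · field_simp; ring
      · simp; field_simp; ring
      · simp; field_simp
    have := hQ.le_one (x := 0) (y := 1) (s := (x + y) / (x + 1)) (by simp) hmem
      (by simp) (by simp)
    rw [div_le_one (by linarith)] at this
    linarith
  · have hx1 : 0 < 1 - x := by linarith
    have hmem : ![0, (y - x) / (1 - x)] ∈ Q := by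
      refine hQ.convex.triple_mem hr h h (-x / (1 - x)) (1 / (1 - x)) 0
        (div_nonneg (by linarith) hx1.le) (by positivity) le_rfl ?_ ?_ ?_
      · field_simp; ring
      · simp; field_simp; ring
      · simp; field_simp; ring
    have := hQ.le_one (x := 0) (y := 1) (s := (y - x) / (1 - x)) (by simp) hmem
      (by simp) (by simp)
    rw [div_le_one hx1] at this
    linarith

/-- The chords from the ends of the edge to a point (p, q) below the strip must meet the x-axis
within [-1, 1]. This gives -1 ≤ p ≤ 1 + q and leaves only (-1, -2). Each side of the resulting
triangle then supports Q by `le_one_of_facet`, so Q is the triangle. -/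
theorem isStandardFano_of_long_facet (hQ : IsOriginPolygon Q) (hl : ![-1, 1] ∈ Q)
    (hr : ![2, 1] ∈ Q) : IsStandardFano Q := by
  have hr1 : ![1, 1] ∈ Q := hQ.convex.triple_mem hl hr hr (1 / 3) (2 / 3) 0 (by norm_num)
    (by norm_num) le_rfl (by norm_num) (by norm_num) (by norm_num)
  by_cases hstrip : ∀ x y : ℤ, ![(x : ℝ), (y : ℝ)] ∈ Q → -1 ≤ y
  · refine hQ.isStandardFano_of_strip fun x y h => ⟨hstrip x y h, ?_⟩
    exact_mod_cast hQ.le_one_of_facet hl hr1 h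
  push Not at hstrip
  obtain ⟨p, q, hpq, hq⟩ := hstrip
  have hq' : (q : ℝ) ≤ -2 := by
    have : q ≤ -2 := by omega
    exact_mod_cast this
  have hpos : (0 : ℝ) < 1 - q := by linarith
  have hm1 : ![((p : ℝ) + q) / (1 - q), 0] ∈ Q := by
    refine hQ.convex.triple_mem hl hpq hpq (-q / (1 - q)) (1 / (1 - q)) 0
      (div_nonneg (by linarith) hpos.le) (by positivity) le_rfl ?_ ?_ ?_
    · field_simp; ring
    · simp; field_simp; ring
    · simp; field_simp; ring
  have hm2 : ![((p : ℝ) - 2 * q) / (1 - q), 0] ∈ Q := by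
    refine hQ.convex.triple_mem hr hpq hpq (-q / (1 - q)) (1 / (1 - q)) 0
      (div_nonneg (by linarith) hpos.le) (by positivity) le_rfl ?_ ?_ ?_
    · field_simp; ring
    · simp; field_simp; ring
    · simp; field_simp; ring
  have b1 := hQ.le_one (x := -1) (y := 0) (s := -((p + q) / (1 - q))) (by simp) hm1 (by simp)
    (by simp)
  have b2 := hQ.le_one (x := 1) (y := 0) (s := (p - 2 * q) / (1 - q)) (by simp) hm2 (by simp) (by simp)
  rw [← neg_div, div_le_one hpos] at b1
  rw [div_le_one hpos] at b2
  have b1' : -1 ≤ p := by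
    have : (-1 : ℝ) ≤ p := by linarith
    exact_mod_cast this
  have b2' : p ≤ 1 + q := by
    have : (p : ℝ) ≤ 1 + q := by linarith
    exact_mod_cast this
  obtain ⟨rfl, rfl⟩ : p = -1 ∧ q = -2 := by omega
  push_cast at hpq
  have hleft : ∀ x y : ℝ, ![x, y] ∈ Q → -1 ≤ x := by
    intro x y h
    have hU : IsUnit ((0 : ℤ) * 0 - 1 * (-1)) := by simp
    have hv : ![-1, -1] ∈ Q := hQ.convex.triple_mem hl hpq hpq (1 / 3) (2 / 3) 0 (by norm_num)
      (by norm_num) le_rfl (by norm_num) (by norm_num) (by norm_num)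
    have := (hQ.image (unimodular 0 1 (-1) 0 hU)).le_one_of_facet
      (mem_image_latticeMap hU hv (by simp) (by simp))
      (mem_image_latticeMap hU hl (by simp) (by simp))
      (mem_image_latticeMap hU h rfl rfl)
    simp at this
    linarith
  have hright : ∀ x y : ℝ, ![x, y] ∈ Q → x - y ≤ 1 := by
    intro x y h
    have hU : IsUnit ((0 : ℤ) * (-1) - 1 * 1) := by simp
    have hv : ![0, -1] ∈ Q := hQ.convex.triple_mem hr hpq hpq (1 / 3) (2 / 3) 0 (by norm_num)
      (by norm_num) le_rfl (by norm_num) (by norm_num) (by norm_num)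
    have := (hQ.image (unimodular 0 1 1 (-1) hU)).le_one_of_facet
      (mem_image_latticeMap hU hv (by simp) (by simp))
      (mem_image_latticeMap hU hr (by simp) (by norm_num))
      (mem_image_latticeMap hU h rfl rfl)
    simp at this
    linarith
  have hQK : Q = hullList [(-1, 1), (2, 1), (-1, -2)] := by
    apply Set.Subset.antisymm
    · intro z hz
      have hz' : ![z 0, z 1] ∈ Q := by
        convert hz using 1
        ext i; fin_cases i <;> rfl
      have c1 := hQ.le_one_of_facet hl hr1 hz'
      have c2 := hleft _ _ hz'
      have c3 := hright _ _ hz'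
      refine (convex_convexHull ℝ _ : Convex ℝ (hullList [(-1, 1), (2, 1), (-1, -2)])).triple_mem
        (mem_hullList_of_mem (x := -1) (y := 1) (by simp))
        (mem_hullList_of_mem (x := 2) (y := 1) (by simp))
        (mem_hullList_of_mem (x := -1) (y := -2) (by simp))
        ((1 - (z 0 - z 1)) / 3) ((z 0 + 1) / 3) ((1 - z 1) / 3) (by linarith) (by linarith)
        (by linarith) (by ring) ?_ ?_
      · simp; ring
      · simp; ring
    · refine convexHull_min ?_ hQ.convex
      rintro _ ⟨z, hz, rfl⟩
      have hz' : (z 0, z 1) ∈ [((-1 : ℤ), (1 : ℤ)), (2, 1), (-1, -2)] := hz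
      rw [latticePoint_eq_mk]
      simp at hz'
      rcases hz' with ⟨h0, h1⟩ | ⟨h0, h1⟩ | ⟨h0, h1⟩ <;> rw [h0, h1]
      · simpa using hl
      · simpa using hr
      · simpa using hpq
  refine ⟨15, ?_⟩
  rw [fanoPolygon_eq, hQK]
  exact latticeEquivalent_hullList (a := 1) (b := 0) (c := 0) (d := -1) (s := 0) (t := 0)
    (by simp) (by decide)

/-- A point (p, q) below the strip has |p| ≤ 1, again by its chords to the ends of the edge. The
value p = 0 contradicts `le_one`, and p = ±1 produces a vertical segment through four lattice
points, which is the long case after a unimodular map. -/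
theorem isStandardFano_of_facet (hQ : IsOriginPolygon Q) (hl : ![-1, 1] ∈ Q)
    (hr : ![1, 1] ∈ Q) : IsStandardFano Q := by
  by_cases hstrip : ∀ x y : ℤ, ![(x : ℝ), (y : ℝ)] ∈ Q → -1 ≤ y
  · refine hQ.isStandardFano_of_strip fun x y h => ⟨hstrip x y h, ?_⟩
    exact_mod_cast hQ.le_one_of_facet hl hr h
  push Not at hstrip
  obtain ⟨p, q, hpq, hq⟩ := hstrip
  have hq' : (q : ℝ) ≤ -2 := by
    have : q ≤ -2 := by omega
    exact_mod_cast this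
  have hpos : (0 : ℝ) < 1 - q := by linarith
  have hm1 : ![((p : ℝ) + q) / (1 - q), 0] ∈ Q := by
    refine hQ.convex.triple_mem hl hpq hpq (-q / (1 - q)) (1 / (1 - q)) 0
      (div_nonneg (by linarith) hpos.le) (by positivity) le_rfl ?_ ?_ ?_
    · field_simp; ring
    · simp; field_simp; ring
    · simp; field_simp; ring
  have hm2 : ![((p : ℝ) - q) / (1 - q), 0] ∈ Q := by
    refine hQ.convex.triple_mem hr hpq hpq (-q / (1 - q)) (1 / (1 - q)) 0
      (div_nonneg (by linarith) hpos.le) (by positivity) le_rfl ?_ ?_ ?_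
    · field_simp; ring
    · simp; field_simp; ring
    · simp; field_simp; ring
  have b1 := hQ.le_one (x := -1) (y := 0) (s := -((p + q) / (1 - q))) (by simp) hm1 (by simp)
    (by simp)
  have b2 := hQ.le_one (x := 1) (y := 0) (s := (p - q) / (1 - q)) (by simp) hm2 (by simp) (by simp)
  rw [← neg_div, div_le_one hpos] at b1
  rw [div_le_one hpos] at b2
  have b1' : -1 ≤ p := by
    have : (-1 : ℝ) ≤ p := by linarith
    exact_mod_cast this
  have b2' : p ≤ 1 := by
    have : (p : ℝ) ≤ 1 := by linarith
    exact_mod_cast this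
  have hdown : ∀ e : ℝ, ![e, 1] ∈ Q → ![e, (q : ℝ)] ∈ Q → ![e, -2] ∈ Q := by
    intro e h1 h2
    refine hQ.convex.triple_mem h1 h2 h2 ((-2 - q) / (1 - q)) (3 / (1 - q)) 0
      (div_nonneg (by linarith) hpos.le) (by positivity) le_rfl ?_ ?_ ?_
    · field_simp; ring
    · simp; field_simp; ring
    · simp; field_simp; ring
  obtain rfl | rfl | rfl : p = -1 ∨ p = 0 ∨ p = 1 := by omega
  · have hv := hdown (-1) hl (by simpa using hpq)
    have hU : IsUnit ((0 : ℤ) * 0 - (-1) * (-1)) := by simp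
    exact IsStandardFano.of_image ((hQ.image (unimodular 0 (-1) (-1) 0
      hU)).isStandardFano_of_long_facet (mem_image_latticeMap hU hl (by simp) (by simp))
      (mem_image_latticeMap hU hv (by simp) (by simp)))
  · have := hQ.le_one (x := 0) (y := -1) (s := -q) (by simp) hpq (by simp) (by simp)
    linarith
  · have hv := hdown 1 hr (by simpa using hpq)
    have hU : IsUnit ((0 : ℤ) * 0 - (-1) * 1) := by simp
    exact IsStandardFano.of_image ((hQ.image (unimodular 0 (-1) 1 0
      hU)).isStandardFano_of_long_facet (mem_image_latticeMap hU hr (by simp) (by simp))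
      (mem_image_latticeMap hU hv (by simp) (by simp)))

end IsOriginPolygon

/-! ### Lattice points modulo 2 and the general classification -/

namespace IsOriginPolygon

variable {Q : Set (Fin 2 → ℝ)}

/-- An edge with three equally spaced lattice points gives an edge of lattice length two. -/
theorem isStandardFano_of_midpoint (hQ : IsOriginPolygon Q) {m₀ m₁ d₀ d₁ : ℤ}
    (hm : m₀ ≠ 0 ∨ m₁ ≠ 0) (hd : d₀ ≠ 0 ∨ d₁ ≠ 0)
    (hadd : ![((m₀ + d₀ : ℤ) : ℝ), ((m₁ + d₁ : ℤ) : ℝ)] ∈ Q)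
    (hsub : ![((m₀ - d₀ : ℤ) : ℝ), ((m₁ - d₁ : ℤ) : ℝ)] ∈ Q) : IsStandardFano Q := by
  obtain ⟨g, a, b, c, d, hg, hdet, e1, e2⟩ := exists_unimodular_eq_gcd _ _ hm
  have hk : a * d₀ + b * d₁ ≠ 0 ∨ c * d₀ + d * d₁ ≠ 0 := by
    by_contra! h
    have f0 : d₀ = 0 := by
      linear_combination -d₀ * hdet + d * h.1 - b * h.2
    have f1 : d₁ = 0 := by
      linear_combination -d₁ * hdet - c * h.1 + a * h.2
    rcases hd with h | h
    · exact h f0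
    · exact h f1
  -- move the midpoint to `(0, g)`
  have hU : IsUnit (c * b - d * a) := by
    rw [show c * b - d * a = -1 by linear_combination -hdet]
    simp
  set W := unimodular c d a b hU
  refine IsStandardFano.of_image (U := W) (t := 0) ?_
  have hW := hQ.image W
  rify at e1 e2
  obtain ⟨k, j, hkj, p1, p2⟩ : ∃ k j : ℤ, (j ≠ 0 ∨ k ≠ 0) ∧
      ![(k : ℝ), ((g + j : ℤ) : ℝ)] ∈ latticeMap W 0 '' Q ∧
      ![((-k : ℤ) : ℝ), ((g - j : ℤ) : ℝ)] ∈ latticeMap W 0 '' Q := by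
    refine ⟨c * d₀ + d * d₁, a * d₀ + b * d₁, hk, ?_, ?_⟩
    · refine mem_image_latticeMap hU hadd ?_ ?_
      · push_cast; simp; linear_combination -e2
      · push_cast; simp; linear_combination -e1
    · refine mem_image_latticeMap hU hsub ?_ ?_
      · push_cast; simp; linear_combination -e2
      · push_cast; simp; linear_combination -e1
  clear_value W
  generalize latticeMap W 0 '' Q = R at hW p1 p2
  clear hadd hsub hQ
  have hgR : ![0, (g : ℝ)] ∈ R :=
    hW.convex.triple_mem p1 p2 p2 (1 / 2) (1 / 2) 0 (by norm_num) (by norm_num) le_rfl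
      (by norm_num) (by simp) (by simp; ring)
  -- The midpoint lies in Q, so it is primitive and has become (0, 1).
  have hg1 : g = 1 := by
    have := hW.le_one (x := 0) (y := 1) (s := g) (by simp) hgR (by simp) (by simp)
    have : g ≤ 1 := by exact_mod_cast this
    omega
  subst hg1
  -- If the segment were on the y-axis, one of its ends would lie above (0, 1).
  have hk0 : k ≠ 0 := by
    rintro rfl
    have hj : j ≠ 0 := by simpa using hkj
    have h1 := hW.le_one (x := 0) (y := 1) (s := 1 + j) (by simp) p1 (by simp) (by simp)
    have h2 := hW.le_one (x := 0) (y := 1) (s := 1 - j) (by simp) p2 (by simp) (by simp)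
    have h1' : j ≤ 0 := by
      have : (j : ℝ) ≤ 0 := by linarith
      exact_mod_cast this
    have h2' : 0 ≤ j := by
      have : (0 : ℝ) ≤ j := by linarith
      exact_mod_cast this
    omega
  clear hkj hk hg e1 e2
  wlog hkpos : 0 < k generalizing k j
  · refine this (-k) (-j) ?_ ?_ (by omega) (by omega)
    · simpa [sub_eq_add_neg] using p2
    · simpa using p1
  have hr0 := Int.emod_nonneg j hk0
  have hrk := Int.emod_lt_of_pos j hkpos
  have hjr := Int.emod_add_mul_ediv j k
  set r := j % k
  set q := j / k
  have hS : IsUnit ((1 : ℤ) * 1 - 0 * (-q)) := by simp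
  refine IsStandardFano.of_image (U := unimodular 1 0 (-q) 1 hS) (t := 0) ?_
  have hWS := hW.image (unimodular 1 0 (-q) 1 hS)
  rify at hjr
  have s0 : ![0, 1] ∈ latticeMap (unimodular 1 0 (-q) 1 hS) 0 '' R :=
    mem_image_latticeMap hS hgR (by simp) (by simp)
  have s1 : ![(k : ℝ), 1 + r] ∈ latticeMap (unimodular 1 0 (-q) 1 hS) 0 '' R :=
    mem_image_latticeMap hS p1 (by simp) (by push_cast; simp; linear_combination hjr)
  have s2 : ![-(k : ℝ), 1 - r] ∈ latticeMap (unimodular 1 0 (-q) 1 hS) 0 '' R :=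
    mem_image_latticeMap hS p2 (by simp) (by push_cast; simp; linear_combination -hjr)
  generalize latticeMap (unimodular 1 0 (-q) 1 hS) 0 '' R = T at hWS s0 s1 s2
  have hkpos' : (0 : ℝ) < k := by exact_mod_cast hkpos
  have hr : r = 0 := by
    -- After the shear the slope is r / k with 0 ≤ r < k. The segment from (0, 1) to (k, 1 + r)
    -- meets the diagonal at k / (k - r) times (1, 1), and this factor must not exceed 1, so r = 0.
    have hkr : (1 : ℝ) ≤ k - r := by
      have : 1 ≤ k - r := by omega
      exact_mod_cast this
    have hmem : ![(k : ℝ) / (k - r), k / (k - r)] ∈ T := by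
      refine hWS.convex.triple_mem s1 s0 s0 (1 / (k - r)) ((k - r - 1) / (k - r)) 0
        (div_nonneg zero_le_one (by linarith)) (div_nonneg (by linarith) (by linarith)) le_rfl
        ?_ ?_ ?_
      · rw [← add_div, add_zero, div_eq_one_iff_eq (by linarith)]; ring
      · simp; ring
      · simp; ring
    have := hWS.le_one (x := 1) (y := 1) (by simp) hmem (by simp; rfl) (by simp)
    rw [div_le_one (by linarith)] at this
    have hr' : (r : ℝ) ≤ 0 := by linarith
    have : r ≤ 0 := by exact_mod_cast hr'
    omega
  rw [hr] at s1 s2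
  simp only [Int.cast_zero, add_zero, sub_zero] at s1 s2
  have hk1 : (1 : ℝ) ≤ k := by exact_mod_cast (show 1 ≤ k from hkpos)
  refine hWS.isStandardFano_of_facet ?_ ?_
  · refine hWS.convex.triple_mem s1 s2 s2 ((k - 1) / (2 * k)) ((k + 1) / (2 * k)) 0
      (div_nonneg (by linarith) (by linarith)) (by positivity) le_rfl ?_ ?_ ?_
    · field_simp; ring
    · simp; field_simp; ring
    · simp; field_simp; ring
  · refine hWS.convex.triple_mem s1 s2 s2 ((k + 1) / (2 * k)) ((k - 1) / (2 * k)) 0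
      (by positivity) (div_nonneg (by linarith) (by linarith)) le_rfl ?_ ?_ ?_
    · field_simp; ring
    · simp; field_simp; ring
    · simp; field_simp; ring

theorem exists_noncollinear (hQ : IsOriginPolygon Q) : ∃ u₀ u₁ v₀ v₁ : ℤ,
    ![(u₀ : ℝ), (u₁ : ℝ)] ∈ Q ∧ ![(v₀ : ℝ), (v₁ : ℝ)] ∈ Q ∧ u₀ * v₁ - u₁ * v₀ ≠ 0 := by
  obtain ⟨x, y, z, hx, hy, hz, hdet⟩ :=
    hQ.isLatticePolygon.exists_noncollinear_extremePoints ⟨0, hQ.zero_mem_interior⟩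
  replace hx := hx.1
  replace hy := hy.1
  replace hz := hz.1
  rw [latticePoint_eq_mk] at hx hy hz
  -- The three determinants of pairs of vertices add up to twice the signed area of the triangle, so
  -- they do not all vanish.
  by_contra! hcon
  have h1 := hcon _ _ _ _ hx hy
  have h2 := hcon _ _ _ _ hy hz
  have h3 := hcon _ _ _ _ hz hx
  exact hdet (by linear_combination h1 + h2 + h3)

/-- Half of a nonzero such point would be a nonzero lattice point strictly inside. -/
theorem even_even (hQ : IsOriginPolygon Q) {x y : ℤ} (h : ![(x : ℝ), (y : ℝ)] ∈ Q)
    (hx : 2 ∣ x) (hy : 2 ∣ y) : x = 0 ∧ y = 0 := by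
  obtain ⟨x', rfl⟩ := hx
  obtain ⟨y', rfl⟩ := hy
  by_contra hne
  have h2 := hQ.le_one (x := x') (y := y') (s := 2) (by omega) h (by push_cast; ring)
    (by push_cast; ring)
  norm_num at h2

/-- Assuming that Q is not in the list, its lattice points are determined up to sign by their
classes modulo 2. The classes of e₁ and e₂ are taken, so every point with a coordinate of size at
least 2 has both coordinates odd. If Q lies in neither strip, it has such a point with |y| ≥ 2 and
one with |x| ≥ 2; they agree up to sign, but the first satisfies |x| < |y| and the second |y| < |x|.
-/
theorem isStandardFano_of_basis (hQ : IsOriginPolygon Q) (he₁ : ![1, 0] ∈ Q)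
    (he₂ : ![0, 1] ∈ Q) : IsStandardFano Q := by
  by_contra hnot
  have he₁' : ![((1 : ℤ) : ℝ), ((0 : ℤ) : ℝ)] ∈ Q := by simpa using he₁
  have he₂' : ![((0 : ℤ) : ℝ), ((1 : ℤ) : ℝ)] ∈ Q := by simpa using he₂
  -- Two congruent points that are neither equal nor opposite have a nonzero lattice point as
  -- midpoint, and `isStandardFano_of_midpoint` applies.
  have anti : ∀ x y x' y' : ℤ, ![(x : ℝ), (y : ℝ)] ∈ Q → ![(x' : ℝ), (y' : ℝ)] ∈ Q →
      2 ∣ x - x' → 2 ∣ y - y' → (x = x' ∧ y = y') ∨ (x = -x' ∧ y = -y') := by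
    intro x y x' y' h h' hx hy
    by_contra hcon
    obtain ⟨d₀, hd₀⟩ := hx
    obtain ⟨d₁, hd₁⟩ := hy
    refine hnot (hQ.isStandardFano_of_midpoint (m₀ := x - d₀) (m₁ := y - d₁) (d₀ := d₀) (d₁ := d₁)
      (by omega) (by omega) ?_ ?_)
    · simpa using h
    · rw [show x - d₀ - d₀ = x' by omega, show y - d₁ - d₁ = y' by omega]
      exact h'
  have parity : ∀ x y : ℤ, ![(x : ℝ), (y : ℝ)] ∈ Q → (2 ≤ y ∨ y ≤ -2 ∨ 2 ≤ x ∨ x ≤ -2) →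
      ¬ 2 ∣ x ∧ ¬ 2 ∣ y := by
    intro x y h hbig
    by_cases hx : 2 ∣ x
    · by_cases hy : 2 ∣ y
      · have := hQ.even_even h hx hy
        omega
      · have := anti x y 0 1 h he₂' (by omega) (by omega)
        omega
    · by_cases hy : 2 ∣ y
      · have := anti x y 1 0 h he₁' (by omega) (by omega)
        omega
      · exact ⟨hx, hy⟩
  have tall : ∀ x y : ℤ, ![(x : ℝ), (y : ℝ)] ∈ Q → (2 ≤ y ∨ y ≤ -2) → ¬ 2 ∣ x → ¬ 2 ∣ y →
      |x| < |y| := by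
    intro x y h hy hx2 hy2
    obtain ⟨σ, hσ, hpos⟩ : ∃ σ : ℤ, (σ = 1 ∨ σ = -1) ∧ 2 ≤ σ * y := by
      rcases hy with hy | hy
      · exact ⟨1, Or.inl rfl, by omega⟩
      · exact ⟨-1, Or.inr rfl, by omega⟩
    have hσy : σ * (σ * y) = y := by rcases hσ with rfl | rfl <;> ring
    have hσy' : (σ : ℝ) * ((σ * y : ℤ) : ℝ) = y := by exact_mod_cast hσy
    obtain ⟨c, hc, hc1, hc2⟩ := exists_height_one hQ.convex hQ.zero_mem he₁ (x := x) (y := σ * y)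
      (by omega) σ (by rw [hσy']; exact h)
    -- The lattice point (c, σ) at height ±1 is congruent to (0, 1) if c is even, and then c = 0. If
    -- c is odd it is congruent to (x, y), which is impossible since |y| ≥ 2.
    have hc0 : c = 0 := by
      by_cases hcp : 2 ∣ c
      · have := anti c σ 0 1 hc he₂' (by omega) (by omega)
        omega
      · have := anti c σ x y hc h (by omega) (by omega)
        omega
    subst hc0
    have habs : |y| = σ * y := by
      rcases hσ with rfl | rfl
      · rw [abs_of_nonneg] <;> omega
      · rw [abs_of_nonpos] <;> omega
    rw [habs, abs_of_nonpos (by omega)]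
    omega
  have wide : ∀ x y : ℤ, ![(x : ℝ), (y : ℝ)] ∈ Q → (2 ≤ x ∨ x ≤ -2) → ¬ 2 ∣ x → ¬ 2 ∣ y →
      |y| < |x| := by
    intro x y h hx hx2 hy2
    obtain ⟨σ, hσ, hpos⟩ : ∃ σ : ℤ, (σ = 1 ∨ σ = -1) ∧ 2 ≤ σ * x := by
      rcases hx with hx | hx
      · exact ⟨1, Or.inl rfl, by omega⟩
      · exact ⟨-1, Or.inr rfl, by omega⟩
    have hσx : σ * (σ * x) = x := by rcases hσ with rfl | rfl <;> ring
    have hσx' : (σ : ℝ) * ((σ * x : ℤ) : ℝ) = x := by exact_mod_cast hσx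
    obtain ⟨c, hc, hc1, hc2⟩ := exists_width_one hQ.convex hQ.zero_mem he₂ (x := σ * x) (y := y)
      (by omega) σ (by rw [hσx']; exact h)
    have hc0 : c = 0 := by
      by_cases hcp : 2 ∣ c
      · have := anti σ c 1 0 hc he₁' (by omega) (by omega)
        omega
      · have := anti σ c x y hc h (by omega) (by omega)
        omega
    subst hc0
    have habs : |x| = σ * x := by
      rcases hσ with rfl | rfl
      · rw [abs_of_nonneg] <;> omega
      · rw [abs_of_nonpos] <;> omega
    rw [habs, abs_of_nonpos (by omega)]
    omega
  by_cases hy : ∀ x y : ℤ, ![(x : ℝ), (y : ℝ)] ∈ Q → -1 ≤ y ∧ y ≤ 1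
  · exact hnot (hQ.isStandardFano_of_strip hy)
  by_cases hx : ∀ x y : ℤ, ![(x : ℝ), (y : ℝ)] ∈ Q → -1 ≤ x ∧ x ≤ 1
  · have hU : IsUnit ((0 : ℤ) * 0 - 1 * 1) := by simp
    refine hnot (IsStandardFano.of_image (U := unimodular 0 1 1 0 hU) (t := 0)
      ((hQ.image _).isStandardFano_of_strip fun x y h => ?_))
    obtain ⟨p, q, hpq, e0, e1⟩ := exists_of_mem_image_latticeMap hU h
    simp at e0 e1
    subst e0 e1
    exact hx y x hpq
  push Not at hx hy
  obtain ⟨x, y, h, hbig⟩ := hy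
  obtain ⟨x', y', h', hbig'⟩ := hx
  have hb : 2 ≤ y ∨ y ≤ -2 := by omega
  have hb' : 2 ≤ x' ∨ x' ≤ -2 := by omega
  have hp := parity x y h (by omega)
  have hp' := parity x' y' h' (by omega)
  have t1 := tall x y h hb hp.1 hp.2
  have t2 := wide x' y' h' hb' hp'.1 hp'.2
  rcases anti x y x' y' h h' (by omega) (by omega) with ⟨rfl, rfl⟩ | ⟨rfl, rfl⟩
  · exact lt_asymm t1 t2
  · rw [abs_neg, abs_neg] at t1
    exact lt_asymm t1 t2

theorem isStandardFano (hQ : IsOriginPolygon Q) : IsStandardFano Q := by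
  obtain ⟨u₀, u₁, v₀, v₁, hu, hv, hdet⟩ := hQ.exists_noncollinear
  obtain ⟨U, h1, h2⟩ := exists_unimodular_basis hQ.convex hQ.zero_mem hu hv hdet
  exact IsStandardFano.of_image ((hQ.image U).isStandardFano_of_basis h1 h2)

end IsOriginPolygon

theorem IsFanoPolygon.isStandardFano {Q : Set (Fin 2 → ℝ)} (hQ : IsFanoPolygon Q) :
    IsStandardFano Q := by
  obtain ⟨hQ, hI⟩ := hQ
  obtain ⟨w, hw⟩ := Set.ncard_eq_one.1 hI
  have hw' : ∀ z, latticePoint z ∈ interior Q ↔ z = w := by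
    intro z
    have : z ∈ {z | latticePoint z ∈ interior Q} ↔ z ∈ ({w} : Set (Fin 2 → ℤ)) := by rw [hw]
    exact this
  have hmap : ∀ z, latticeMap 1 (-w) (latticePoint z) = latticePoint (z - w) := by
    intro z
    rw [latticeMap_latticePoint]
    simp [sub_eq_add_neg]
  refine IsStandardFano.of_image (U := 1) (t := -w) (IsOriginPolygon.isStandardFano
    ⟨hQ.latticeMap_image _ _, ?_, ?_⟩)
  · rw [interior_latticeMap_image]
    exact ⟨latticePoint w, (hw' w).2 rfl, by rw [hmap, sub_self, latticePoint_zero]⟩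
  · intro z hz
    rw [interior_latticeMap_image] at hz
    have h1 : latticeMap 1 (-w) (latticePoint (z + w)) = latticePoint z := by
      rw [hmap, add_sub_cancel_right]
    rw [← h1, (latticeMap_injective 1 (-w)).mem_set_image] at hz
    simpa using (hw' _).1 hz

/-! ### The main theorem -/

/-- `A - B` has fewer lattice points than `A` when `A` and `B` are dilates of a lattice polygon. -/
theorem latticeCount_minkowskiDiff_lt {Q : Set (Fin 2 → ℝ)} (hQ : IsLatticePolygon Q)
    (hpt : Q.Nontrivial) (a : ℕ) {m : ℕ} (hm : 0 < m) :
    latticeCount (minkowskiDiff ((a : ℝ) • Q) ((m : ℝ) • Q)) < latticeCount ((a : ℝ) • Q) := by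
  have hcopy := hQ
  obtain ⟨S, hS, hSne, hQS⟩ := hcopy
  obtain ⟨p, hp, q, hq, hpq⟩ := hpt
  obtain ⟨f, hf⟩ := geometric_hahn_banach_point_point (E := Fin 2 → ℝ) hpq
  -- Translation by m times a point s where f is least embeds the lattice points of the difference
  -- into those of aQ. It misses a times a point t where f is greatest.
  obtain ⟨s, hs, hmin⟩ := Set.exists_min_image S (fun z => f (latticePoint z)) hS hSne
  obtain ⟨t, ht, hmax⟩ := Set.exists_max_image S (fun z => f (latticePoint z)) hS hSne
  have hge : ∀ x ∈ Q, f (latticePoint s) ≤ f x := by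
    have : Q ⊆ {x | f (latticePoint s) ≤ f x} := by
      rw [hQS]
      refine convexHull_min ?_ (convex_halfSpace_ge f.isLinear _)
      rintro _ ⟨z, hz, rfl⟩
      exact hmin z hz
    exact this
  have hle : ∀ x ∈ Q, f x ≤ f (latticePoint t) := by
    have : Q ⊆ {x | f x ≤ f (latticePoint t)} := by
      rw [hQS]
      refine convexHull_min ?_ (convex_halfSpace_le f.isLinear _)
      rintro _ ⟨z, hz, rfl⟩
      exact hmax z hz
    exact this
  have hlt : f (latticePoint s) < f (latticePoint t) := by
    have := hge p hp
    have := hle q hq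
    linarith
  have hmem : ∀ z ∈ S, latticePoint z ∈ Q := by
    intro z hz
    rw [hQS]
    exact subset_convexHull ℝ _ ⟨z, hz, rfl⟩
  have hm' : (0 : ℝ) < m := by exact_mod_cast hm
  unfold latticeCount
  rw [← Set.ncard_image_of_injective _ (add_left_injective (m • s))]
  refine Set.ncard_lt_ncard ⟨?_, ?_⟩ (finite_latticePoints (hQ.isCompact.smul _).isBounded)
  · rintro _ ⟨z, hz, rfl⟩
    have h := hz ((m : ℝ) • latticePoint s) (Set.smul_mem_smul_set (hmem s hs))
    rw [← latticePoint_natCast_smul, ← latticePoint_add] at h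
    exact h
  · intro hsub
    have ha : a • t ∈ {z | latticePoint z ∈ (a : ℝ) • Q} := by
      change latticePoint (a • t) ∈ (a : ℝ) • Q
      rw [latticePoint_natCast_smul]
      exact Set.smul_mem_smul_set (hmem t ht)
    obtain ⟨z, hz, hzt⟩ := hsub ha
    have h := hz ((m : ℝ) • latticePoint t) (Set.smul_mem_smul_set (hmem t ht))
    obtain ⟨x, hx, hxe⟩ := h
    have e1 := congrArg f hxe
    have e2 := congrArg (fun w => f (latticePoint w)) hzt
    simp only [latticePoint_add, latticePoint_natCast_smul, map_add, map_smul, smul_eq_mul]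
      at e1 e2
    have e3 := mul_le_mul_of_nonneg_left (hle x hx) (Nat.cast_nonneg (α := ℝ) a)
    have e4 := mul_lt_mul_of_pos_left hlt hm'
    linarith

/-- Without interior points Q would be contained in its own frontier, which is null by convexity. -/
theorem IsLatticePolygon.interior_nonempty_of_volume {Q : Set (Fin 2 → ℝ)}
    (hQ : IsLatticePolygon Q) (hV : MeasureTheory.volume.real Q ≠ 0) : (interior Q).Nonempty := by
  by_contra hne
  rw [Set.not_nonempty_iff_eq_empty] at hne
  apply hV
  have hsub : Q ⊆ frontier Q := fun p hp => ⟨subset_closure hp, by rw [hne]; exact id⟩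
  rw [MeasureTheory.Measure.real, MeasureTheory.measure_mono_null hsub
    (hQ.convex.addHaar_frontier _), ENNReal.toReal_zero]

theorem IsLatticePolygon.three_le_latticeCount {Q : Set (Fin 2 → ℝ)}
    (hQ : IsLatticePolygon Q) (hint : (interior Q).Nonempty) : 3 ≤ latticeCount Q := by
  obtain ⟨x, y, z, hx, hy, hz, hdet⟩ := hQ.exists_noncollinear_extremePoints hint
  have hcard : ({x, y, z} : Set (Fin 2 → ℤ)).ncard = 3 := by
    rw [Set.ncard_eq_three]
    refine ⟨x, y, z, ?_, ?_, ?_, rfl⟩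
    · rintro rfl; simp at hdet
    · rintro rfl; simp at hdet
    · rintro rfl
      exact hdet (by ring)
  rw [← hcard]
  refine Set.ncard_le_ncard ?_ (finite_latticePoints hQ.isCompact.isBounded)
  rintro w (rfl | rfl | rfl)
  exacts [hx.1, hy.1, hz.1]

/-- With d = m₁ + m₂ - 2a ≥ 1 the equation gives N - I ≥ N + I - 2, so I ≤ 1. For I = 0 it reads N =
(N - 2)d, where d = 1 is impossible and d ≥ 2 forces N ≤ 4; for I = 1 the factor N - 1 cancels. -/
theorem counts_of_le {N I m₁ m₂ a : ℤ} (hN : 3 ≤ N) (hI : 0 ≤ I) (h₂ : 2 * a < m₁ + m₂)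
    (h : N - I = (N + I - 2) * (m₁ + m₂ - 2 * a)) :
    (I = 0 ∧ N = 3 ∧ 2 * a = m₁ + m₂ - 3) ∨ (I = 0 ∧ N = 4 ∧ 2 * a = m₁ + m₂ - 2) ∨
      (I = 1 ∧ 2 * a = m₁ + m₂ - 1) := by
  obtain ⟨d, hd⟩ : ∃ d, d = m₁ + m₂ - 2 * a := ⟨_, rfl⟩
  rw [← hd] at h
  have hd1 : 1 ≤ d := by omega
  have hI1 : I ≤ 1 := by nlinarith
  obtain rfl | rfl : I = 0 ∨ I = 1 := by omega
  · have hd2 : 2 ≤ d := by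
      by_contra hlt
      obtain rfl : d = 1 := by omega
      omega
    have hN4 : N ≤ 4 := by nlinarith
    obtain rfl | rfl : N = 3 ∨ N = 4 := by omega
    · omega
    · omega
  · right; right
    refine ⟨rfl, ?_⟩
    have : d = 1 := by nlinarith
    omega

/-- Since m₁m₂ ≥ (a + 1)², the equation yields N(a + 1) + I(3a + 1) ≤ 4(a + 1), hence I = 0 and N ≤
4. Then m₁m₂ is (a + 1)(a + 2) for N = 3 and (a + 1)² for N = 4, which fixes m₁ + m₂. -/
theorem counts_of_lt {N I m₁ m₂ a : ℤ} (hN : 3 ≤ N) (hI : 0 ≤ I) (ha : 0 < a) (h₁ : a < m₁)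
    (h₂ : a < m₂) (h : (N + I - 2) * a ^ 2 + (N - I) * a + 2 = m₁ * m₂ * (N + I - 2)) :
    (I = 0 ∧ N = 3 ∧ 2 * a = m₁ + m₂ - 3) ∨ (I = 0 ∧ N = 4 ∧ 2 * a = m₁ + m₂ - 2) := by
  obtain ⟨p, rfl⟩ : ∃ p, m₁ = a + 1 + p := ⟨m₁ - a - 1, by ring⟩
  obtain ⟨q, rfl⟩ : ∃ q, m₂ = a + 1 + q := ⟨m₂ - a - 1, by ring⟩
  have hp : 0 ≤ p := by omega
  have hq : 0 ≤ q := by omega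
  have hpq : 0 ≤ p * q := mul_nonneg hp hq
  have hprod : (a + 1) ^ 2 ≤ (a + 1 + p) * (a + 1 + q) := by nlinarith
  have hn : 0 ≤ N + I - 2 := by omega
  have hineq : N * (a + 1) + I * (3 * a + 1) ≤ 4 * a + 4 := by
    have := mul_le_mul_of_nonneg_right hprod hn
    nlinarith
  have hI0 : I = 0 := by
    by_contra hne
    have : 1 ≤ I := by omega
    nlinarith
  subst hI0
  have hN4 : N ≤ 4 := by nlinarith
  obtain rfl | rfl : N = 3 ∨ N = 4 := by omega
  · left
    have h1 : p + q < 2 := by nlinarith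
    have h2 : p + q ≠ 0 := by
      intro h0
      obtain ⟨rfl, rfl⟩ : p = 0 ∧ q = 0 := by omega
      nlinarith
    omega
  · right
    have h1 : p + q < 1 := by nlinarith
    omega

theorem mainTheorem4 (Q : Set (Fin 2 → ℝ)) (hQ : IsLatticePolygon Q) (hpt : Q.Nontrivial)
    (m₁ m₂ a : ℕ) (hm₁ : 0 < m₁) (hm₂ : 0 < m₂) (ha : 0 < a)
    (h₁ : a < m₂) (h₂ : 2 * a < m₁ + m₂)
    (h₃ : (latticeCount ((a : ℝ) • Q) : ℝ)
        - (latticeCount (minkowskiDiff ((a : ℝ) • Q) ((m₁ : ℝ) • Q)) : ℝ)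
        = (m₁ : ℝ) * (m₂ : ℝ) * MeasureTheory.volume.real Q) :
    (LatticeEquivalent Q standardSimplex ∧ (a : ℝ) = ((m₁ : ℝ) + (m₂ : ℝ) - 3) / 2) ∨
    ((LatticeEquivalent Q doubleTriangle ∨ LatticeEquivalent Q standardSquare) ∧
      (a : ℝ) = ((m₁ : ℝ) + (m₂ : ℝ) - 2) / 2) ∨
    (IsFanoPolygon Q ∧ (∃ i : Fin 16, LatticeEquivalent Q (fanoPolygon i)) ∧
      (a : ℝ) = ((m₁ : ℝ) + (m₂ : ℝ) - 1) / 2) := by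
  have hV : MeasureTheory.volume.real Q ≠ 0 := by
    intro h0
    have hlt := latticeCount_minkowskiDiff_lt hQ hpt a hm₁
    rw [h0, mul_zero, sub_eq_zero] at h₃
    exact hlt.ne' (by exact_mod_cast h₃)
  have hint := hQ.interior_nonempty_of_volume hV
  have hE := ehrhartFormula_of_interior_nonempty hQ hint
  have hN := hQ.three_le_latticeCount hint
  have hE1 := hE 1
  rw [Nat.cast_one, one_smul] at hE1
  have hEa := hE a
  obtain ⟨N, hNdef⟩ : ∃ N, N = latticeCount Q := ⟨_, rfl⟩
  obtain ⟨I, hIdef⟩ : ∃ I, I = latticeCount (interior Q) := ⟨_, rfl⟩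
  rw [← hNdef] at hN hE1 hEa
  rw [← hIdef] at hE1 hEa
  -- The Ehrhart formula at k = 1 is Pick's theorem.
  have hV2 : 2 * MeasureTheory.volume.real Q = (N : ℝ) + I - 2 := by linarith
  rw [hV2] at hEa
  have key : ((I : ℤ) = 0 ∧ (N : ℤ) = 3 ∧ 2 * (a : ℤ) = m₁ + m₂ - 3) ∨
      ((I : ℤ) = 0 ∧ (N : ℤ) = 4 ∧ 2 * (a : ℤ) = m₁ + m₂ - 2) ∨
      ((I : ℤ) = 1 ∧ 2 * (a : ℤ) = m₁ + m₂ - 1) := by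
    rcases le_or_gt m₁ a with hle | hlt
    · refine counts_of_le (by exact_mod_cast hN) (by positivity) (by exact_mod_cast h₂) ?_
      have hEd := hE (a - m₁)
      rw [minkowskiDiff_smul_of_le hQ hle] at h₃
      rw [Nat.cast_sub hle, ← hNdef, ← hIdef, hV2] at hEd
      have hm : (m₁ : ℝ) ≠ 0 := by exact_mod_cast hm₁.ne'
      rify
      apply mul_left_cancel₀ hm
      -- Subtracting the formulas at a and a - m₁ leaves a common factor m₁, which is cancelled.
      linear_combination 2 * h₃ - hEa + hEd + (m₁ : ℝ) * m₂ * hV2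
    · have h := counts_of_lt (N := N) (I := I) (m₁ := m₁) (m₂ := m₂) (a := a)
        (by exact_mod_cast hN) (by positivity) (by exact_mod_cast ha) (by exact_mod_cast hlt)
        (by exact_mod_cast h₁) ?_
      · rcases h with h | h
        · exact Or.inl h
        · exact Or.inr (Or.inl h)
      · rw [minkowskiDiff_smul_of_lt hQ hpt hlt] at h₃
        have h0 : latticeCount ∅ = 0 := by
          simp [latticeCount]
        rw [h0] at h₃
        push_cast at h₃
        rify
        linear_combination -hEa + 2 * h₃ + (m₁ : ℝ) * m₂ * hV2
  rcases key with ⟨hI, hN3, h⟩ | ⟨hI, hN4, h⟩ | ⟨hI, h⟩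
  · left
    rify at h
    refine ⟨hQ.latticeEquivalent_standardSimplex hint ?_, by linarith⟩
    rw [← hNdef]
    exact_mod_cast hN3
  · right; left
    rify at h
    refine ⟨hQ.latticeEquivalent_of_four hint ?_ ?_, by linarith⟩
    · rw [← hNdef]
      exact_mod_cast hN4
    · rw [← hIdef]
      exact_mod_cast hI
  · right; right
    rify at h
    have hF : IsFanoPolygon Q := ⟨hQ, by rw [← hIdef]; exact_mod_cast hI⟩
    exact ⟨hF, hF.isStandardFano, by linarith⟩
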